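/- Let $n,m\ge 0$ be integers with $2m\le n$ and let $x_1,\dots,x_n\in\mathbb R$ be distinct (the growth points; the marked boundary point of $\mathbb H$ is $\infty$). Definitions: - Screening charges for $x$: a tuple $\xi=(\xi_1,\dots,\xi_m)$ of distinct complex numbers, none equal to any $x_j$, whose set of entries is closed under complex conjugation. - Stationary relations: $-\sum_{j=1}^n\frac1{\xi_k-x_j}+\sum_{l\ne k}\frac2{\xi_k-\xi_l}=0$ for $k=1,\dots,m$. - Master function: $\Phi(x,\xi)=\prod_{i<j}(x_i-x_j)^2\prod_{i<j}(\xi_i-\xi_j)^8\prod_{i,j}(x_i-\xi_j)^{-4}$. - Multiple chordal SLE(0) system with growth points $x$ and screening charges $\xi$: the family, indexed by the capacity parametrizations $\nu=(\nu_1,\dots,\nu_n)$ (measurable, nonnegative and locally integrable on $[0,\infty)$), of the maximal solutions on $[0,\tau)$, before any collision among growth points or between growth points and charges, of the Loewner equation $\partial_t g_t(z)=\sum_j\frac{2\nu_j(t)}{g_t(z)-x_j(t)}$, $g_0(z)=z$, with $x_j(0)=x_j$, $\xi_l(t)=g_t(\xi_l)$ and $\dot x_j=\nu_j\big(\sum_{k\ne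 j}\frac{2}{x_j-x_k}-\sum_l\frac4{x_j-\xi_l(t)}\big)+\sum_{k\ne j}\frac{2\nu_k}{x_j-x_k}$ (equations in integrated form). Two systems are equal if for every $\nu$ they have the same lifetime, the same driving functions and the same flow at all points not yet swallowed. - $\mathcal{CR}_{m,n}(x)$: the rational functions $R$ with $\overline{R(\bar z)}=R(z)$ whose finite critical points are exactly $x_1,\dots,x_n$, all simple, which have exactly $m$ finite poles, all simple, and a pole of order $n-2m+1$ at $\infty$. The real locus is $\Gamma(R)=R^{-1}(\mathbb R\cup\{\infty\})$. - $\Gamma(R)$ forms an $(n,m)$ chordal link pattern: $\Gamma(R)\cap\mathbb H$ is a union of pairwise disjoint open simple arcs, of which $m$ join the two points of $m$ disjoint pairs of growth points and $n-2m$ join each of the remaining growth points to $\infty$. Theorem. The following three families are classified by the same data, namely unordered screening charges. (a) For every tuple $\xi\in\mathbb C^m$ the following are equivalent: (1) $\xi$ are screening charges for $x$, they solve the stationary relations, and there is a multiple chordal SLE(0) system with growth points $x$ and charges $\xi$; (2) there is $R\in\mathcal{CR}_{m,n}(x)$ whose set of finite poles is $\{\xi_1,\dots,\xi_m\}$ and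 whose real locus forms an $(n,m)$ chordal link pattern; (3) $\xi$ are screening charges for $x$ and $\xi$ is a critical point of $\eta\mapsto\Phi(x,\eta)$. (b) Two multiple chordal SLE(0) systems with growth points $x$ and with screening charges $\xi$, $\xi'$ that solve the stationary relations are equal if and only if $\xi'$ is a permutation of $\xi$. (c) If $R$, $R'$ are as in (2) for $\xi$, $\xi'$ respectively, then $R'=aR+b$ for some real $a\ne0$, $b$ if and only if $\xi'$ is a permutation of $\xi$. -/

import Mathlib

open scoped BigOperators ENNReal

noncomputable section

namespace ChordalSLE

/-! ### Screening charges, stationary relations, master function -/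

/-- `ξ` is a configuration of `m` screening charges for the growth points `x`: the charges are
pairwise distinct, distinct from the growth points, and closed under complex conjugation. -/
structure IsScreening {n m : ℕ} (x : Fin n → ℝ) (ξ : Fin m → ℂ) : Prop where
  injective : Function.Injective ξ
  ne_growth : ∀ k j, ξ k ≠ (x j : ℂ)
  conj_mem : ∀ k, ∃ l, ξ l = (starRingEnd ℂ) (ξ k)

/-- The stationary relations in the upper half-plane with marked point `u = ∞`. -/
def Stationary {n m : ℕ} (x : Fin n → ℝ) (ξ : Fin m → ℂ) : Prop :=
  ∀ k, -∑ j, 1 / (ξ k - (x j : ℂ)) + ∑ l ∈ Finset.univ.erase k, 2 / (ξ k - ξ l) = 0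

/-- The master function
`∏_{i<j} (x_i - x_j)^2 ∏_{i<j} (ξ_i - ξ_j)^8 ∏_{i,j} (x_i - ξ_j)^{-4}`. -/
def masterFunction {n m : ℕ} (x : Fin n → ℂ) (ξ : Fin m → ℂ) : ℂ :=
  (∏ i, ∏ j ∈ Finset.Ioi i, (x i - x j) ^ 2) *
    (∏ i, ∏ j ∈ Finset.Ioi i, (ξ i - ξ j) ^ 8) *
      ∏ i, ∏ j, (x i - ξ j) ^ (-4 : ℤ)

/-- `ξ` is a critical point of `ξ ↦ Φ(x, ξ)` (the growth points `x` being fixed). -/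
def IsMasterCritical {n m : ℕ} (x : Fin n → ℝ) (ξ : Fin m → ℂ) : Prop :=
  HasFDerivAt (fun η : Fin m → ℂ => masterFunction (fun j => (x j : ℂ)) η)
    (0 : (Fin m → ℂ) →L[ℂ] ℂ) ξ

/-! ### Multiple chordal SLE(0) Loewner chains -/

/-- The logarithmic derivative of the master function with respect to the growth point `x_j`
(with `x` and `ξ` treated as independent variables). -/
def logDerivGrowth {n m : ℕ} (x : Fin n → ℝ) (ξ : Fin m → ℂ) (j : Fin n) : ℂ :=
  ∑ k ∈ Finset.univ.erase j, 2 / ((x j : ℂ) - (x k : ℂ)) - ∑ l, 4 / ((x j : ℂ) - ξ l)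

/-- A parametrization of capacity: measurable nonnegative rates on `[0, ∞)`, integrable on
bounded intervals (so that the Loewner equation makes sense). Values at negative times play no
role. -/
structure IsParametrization {n : ℕ} (ν : Fin n → ℝ → ℝ) : Prop where
  measurable : ∀ j, Measurable (ν j)
  nonneg : ∀ j t, 0 ≤ t → 0 ≤ ν j t
  integrable : ∀ j t, 0 ≤ t → IntervalIntegrable (ν j) MeasureTheory.volume 0 t

/-- `w` is, on `[0, t]`, a solution of the Loewner equation
`∂_s w = ∑_j 2 ν_j(s) / (w - X_j(s))` with `w 0 = z` (in integrated form) that never meets the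
driving functions `X_j`. -/
structure IsLoewnerOrbit {n : ℕ} (ν : Fin n → ℝ → ℝ) (X : ℝ → Fin n → ℝ) (t : ℝ) (z : ℂ)
    (w : ℝ → ℂ) : Prop where
  continuousOn : ContinuousOn w (Set.Icc 0 t)
  avoids : ∀ s ∈ Set.Icc 0 t, ∀ j, w s ≠ (X s j : ℂ)
  equation : ∀ s ∈ Set.Icc 0 t,
    w s = z + ∫ r in (0 : ℝ)..s, ∑ j, 2 * (ν j r : ℂ) / (w r - (X r j : ℂ))

/-- `z` has not been swallowed by time `t`, that is `t < τ_z`. -/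
def IsAlive {n : ℕ} (ν : Fin n → ℝ → ℝ) (X : ℝ → Fin n → ℝ) (t : ℝ) (z : ℂ) : Prop :=
  ∃ w, IsLoewnerOrbit ν X t z w

/-- The data of a Loewner chain with `n` driving functions: a lifetime `τ`, the driving functions
`x_j(t)` and the flow `g_t(z)`. Only the driving functions on `[0, τ)`, and `g_t(z)` for
`t < τ` and `z` alive at time `t`, are meaningful. -/
structure Chain (n : ℕ) where
  lifetime : ℝ≥0∞
  driving : ℝ → Fin n → ℝ
  flow : ℝ → ℂ → ℂ

/-- The time interval `[0, τ)` of a chain. -/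
def Chain.times {n : ℕ} (c : Chain n) : Set ℝ :=
  {t | 0 ≤ t ∧ ENNReal.ofReal t < c.lifetime}

/-- `c` solves the multiple chordal SLE(0) equations started from the growth points `x` and the
charges `ξ`, with capacity parametrization `ν`, on the whole of `[0, c.lifetime)`; on this interval
there is no collision among growth points or between growth points and charges.
The charges are transported by the flow, `ξ_l(t) = g_t(ξ_l)`, and the driving functions solve
`ẋ_j = ν_j ∂_{x_j} log Z(x, ξ) + ∑_{k ≠ j} 2 ν_k / (x_j - x_k)` (in integrated form). -/
structure IsSLEZeroSolution {n m : ℕ} (x : Fin n → ℝ) (ξ : Fin m → ℂ) (ν : Fin n → ℝ → ℝ)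
    (c : Chain n) : Prop where
  lifetime_pos : 0 < c.lifetime
  continuousOn : ∀ j, ContinuousOn (fun t => c.driving t j) c.times
  no_collision : ∀ t ∈ c.times, Function.Injective (c.driving t)
  flow_orbit : ∀ t ∈ c.times, ∀ z, IsAlive ν c.driving t z →
    IsLoewnerOrbit ν c.driving t z (fun s => c.flow s z)
  charge_alive : ∀ t ∈ c.times, ∀ l, IsAlive ν c.driving t (ξ l)
  driving_equation : ∀ t ∈ c.times, ∀ j,
    (c.driving t j : ℂ) = (x j : ℂ) + ∫ s in (0 : ℝ)..t,
      ((ν j s : ℂ) * logDerivGrowth (c.driving s) (fun l => c.flow s (ξ l)) j +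
        ∑ k ∈ Finset.univ.erase j,
          2 * (ν k s : ℂ) / ((c.driving s j : ℂ) - (c.driving s k : ℂ)))

/-- `c` is the multiple chordal SLE(0) Loewner chain for `x`, `ξ`, `ν`: a solution with maximal
lifetime. -/
def IsSLEZeroChain {n m : ℕ} (x : Fin n → ℝ) (ξ : Fin m → ℂ) (ν : Fin n → ℝ → ℝ)
    (c : Chain n) : Prop :=
  IsSLEZeroSolution x ξ ν c ∧
    ∀ c' : Chain n, IsSLEZeroSolution x ξ ν c' → c'.lifetime ≤ c.lifetime

/-- A multiple chordal SLE(0) system with growth points `x` and charges `ξ`: a Loewner chain for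
every parametrization of capacity. -/
def IsSLEZeroSystem {n m : ℕ} (x : Fin n → ℝ) (ξ : Fin m → ℂ)
    (S : (Fin n → ℝ → ℝ) → Chain n) : Prop :=
  ∀ ν, IsParametrization ν → IsSLEZeroChain x ξ ν (S ν)

/-- Two families of chains are the same system: for every parametrization the lifetimes, the driving
functions before the lifetime, and the flows at all points that are still alive, agree. -/
def SameSystem {n : ℕ} (S S' : (Fin n → ℝ → ℝ) → Chain n) : Prop :=
  ∀ ν, IsParametrization ν →
    (S ν).lifetime = (S' ν).lifetime ∧
      ∀ t ∈ (S ν).times,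
        (S ν).driving t = (S' ν).driving t ∧
          ∀ z, IsAlive ν (S ν).driving t z → (S ν).flow t z = (S' ν).flow t z

/-! ### Real rational functions with prescribed critical points and their real locus -/

/-- The value of a rational function at a complex number (meaningful off the poles). -/
def value (R : RatFunc ℂ) (z : ℂ) : ℂ := R.eval (RingHom.id ℂ) z

/-- The finite poles of a rational function (`RatFunc.denom` is the reduced denominator). -/
def poles (R : RatFunc ℂ) : Set ℂ := {z | R.denom.eval z = 0}

/-- The class `CR_{m,n}(x)`: rational functions symmetric under conjugation, whose finite critical
points are exactly the points `x_j`, all simple, with exactly `m` finite poles, all simple, and a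
pole of order `n - 2m + 1` at infinity. -/
structure IsCR {n : ℕ} (m : ℕ) (x : Fin n → ℝ) (R : RatFunc ℂ) : Prop where
  conj_symm : ∀ z, (starRingEnd ℂ) (value R ((starRingEnd ℂ) z)) = value R z
  critical : {z | z ∉ poles R ∧ deriv (value R) z = 0} = Set.range (fun j => (x j : ℂ))
  critical_simple : ∀ j, deriv (deriv (value R)) (x j : ℂ) ≠ 0
  poles_ncard : (poles R).ncard = m
  poles_simple : ∀ z ∈ poles R, R.denom.rootMultiplicity z = 1
  pole_infty : R.intDegree = (n : ℤ) - 2 * m + 1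

/-- The real locus `Γ(R) = R⁻¹(ℝ ∪ {∞})`, in the finite plane. -/
def realLocus (R : RatFunc ℂ) : Set ℂ := {z | z ∈ poles R ∨ (value R z).im = 0}

/-- `Γ` forms an `(n, m)` chordal link pattern: there are `m` pairs of growth points (the 2-cycles
of the involution `σ`) such that the part of `Γ` in the open upper half-plane consists of pairwise
disjoint (hence non-crossing) open simple arcs, one joining the two points of each pair, and one
joining each of the `n - 2m` remaining growth points (the fixed points of `σ`) to `∞`.
`γ j` is the arc started at `x_j`, closed up by its endpoints in the Riemann sphere; the two growth
points of a pair have the same arc, with opposite orientations. -/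
def FormsLinkPattern {n : ℕ} (m : ℕ) (x : Fin n → ℝ) (Γ : Set ℂ) : Prop :=
  ∃ (σ : Fin n → Fin n) (γ : Fin n → C(unitInterval, OnePoint ℂ)),
    Function.Involutive σ ∧
    (Finset.univ.filter (fun j => σ j ≠ j)).card = 2 * m ∧
    (∀ j, Function.Injective (γ j)) ∧
    (∀ j, γ j 0 = (((x j : ℂ)) : OnePoint ℂ)) ∧
    (∀ j, σ j = j → γ j 1 = OnePoint.infty) ∧
    (∀ j, σ j ≠ j → ∀ t, γ (σ j) t = γ j (unitInterval.symm t)) ∧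
    (∀ j t, t ≠ 0 → t ≠ 1 → ∃ z : ℂ, 0 < z.im ∧ γ j t = (z : OnePoint ℂ)) ∧
    (∀ i j, i ≠ j → i ≠ σ j → ∀ s t, s ≠ 0 → s ≠ 1 → t ≠ 0 → t ≠ 1 → γ i s ≠ γ j t) ∧
    (∀ z : ℂ, 0 < z.im → (z ∈ Γ ↔ ∃ j t, γ j t = (z : OnePoint ℂ)))

/-- `R` is a rational function of the class `CR_{m,n}(x)` with `ξ` as finite poles whose real locus
forms an `(n, m)` chordal link pattern. -/
structure IsLinkRational {n m : ℕ} (x : Fin n → ℝ) (ξ : Fin m → ℂ) (R : RatFunc ℂ) : Prop where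
  isCR : IsCR m x R
  poles_eq : poles R = Set.range ξ
  link : FormsLinkPattern m x (realLocus R)

/-- Equality of rational functions up to a real multiplicative and a real additive constant. -/
def RealAffineEquiv (R R' : RatFunc ℂ) : Prop :=
  ∃ a b : ℝ, a ≠ 0 ∧ R' = RatFunc.C (a : ℂ) * R + RatFunc.C (b : ℂ)

end ChordalSLE

end

/-! Let P = ∏ (X - x_j) and Q = ∏ (X - ξ_k), and let W(Q, N) = Q N' - Q' N be the numerator of (N /
Q)'.

Algebra. In a direction v the logarithmic derivative of the master function is 4 times the sum of
v_k times the left side of the k-th stationary relation. The master function does not vanish at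
screening charges, so critical means stationary (`isMasterCritical_iff_stationary`). The k-th
relation says that P / Q ^ 2 has no residue at ξ_k (`stationary_iff_derivatives`). Hence stationary
charges give a rational primitive N / Q of P / Q ^ 2 (`exists_wronskian_eq`), which can be taken
real, and 2 m ≤ n yields deg N = n + 1 - m. Conversely, a function in the class has Wronskian c P
(`IsCR.data`), and this identity with its derivative at the poles returns the relations. The
numerator is determined up to scaling and adding a multiple of Q, because W(Q, M) = 0 forces M to be
a multiple of Q; this is part (c).

Topology. All critical points of R = N / Q are real, so R is a local homeomorphism on the upper
half-plane and its real locus there can be followed by lifting the real line. A lift over all of ℝ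
is impossible: lifting vertical segments would extend it to an entire section of R with values in
the half-plane, against Liouville (`IsPencil.not_isLift_univ`). A real Möbius map sends the critical
value at x_j to ∞, and the single branch of the locus leaving x_j becomes a lift of a half-line (-∞,
b) that stops at another growth point or at ∞ (`exists_arc`). Two arcs that meet coincide, which
pairs the growth points. Every point of the locus lies on an arc, since otherwise it could be
followed both ways over all of ℝ (`IsPencil.mem_arc`). At ∞, R has a pole of order n - 2m + 1, so n
- 2m branches of the locus enter the upper half-plane there; this counts the unpaired growth points
(`card_finish_infty`).

Dynamics. Growth points and charges together solve a finite-dimensional equation whose velocity is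
linear in the rates and Lipschitz away from collisions. Picard iteration and Grönwall give existence
and uniqueness, and uniqueness applied to the conjugate solution keeps the growth points real
(`exists_isSLEZeroChain`). When only x_j grows, its initial speed reveals ∑_l 1 / (x_j - ξ_l). If
these sums agree for two sets of charges, the Wronskian of their monic polynomials has n zeros but
degree below 2 m ≤ n, so it vanishes and the polynomials are equal (`exists_perm_of_sum_eq`). -/

namespace ChordalSLE

open Polynomial Filter Topology Set

/-! ### Polynomials with real coefficients -/

/-- A complex polynomial with real coefficients. -/
def IsRealPoly (p : ℂ[X]) : Prop := p.map (starRingEnd ℂ) = p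

theorem IsRealPoly.eval_conj {p : ℂ[X]} (hp : IsRealPoly p) (z : ℂ) :
    p.eval ((starRingEnd ℂ) z) = (starRingEnd ℂ) (p.eval z) := by
  conv_lhs => rw [← hp]
  rw [Polynomial.eval_map_apply]

theorem IsRealPoly.im_coeff {p : ℂ[X]} (hp : IsRealPoly p) (k : ℕ) : (p.coeff k).im = 0 := by
  have := congrArg (fun q => q.coeff k) hp
  simp only [coeff_map] at this
  exact Complex.conj_eq_iff_im.1 this

theorem IsRealPoly.im_eval {p : ℂ[X]} (hp : IsRealPoly p) (x : ℝ) : (p.eval (x : ℂ)).im = 0 := by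
  have := hp.eval_conj x
  rw [Complex.conj_ofReal] at this
  exact Complex.conj_eq_iff_im.1 this.symm

theorem IsRealPoly.sub {p q : ℂ[X]} (hp : IsRealPoly p) (hq : IsRealPoly q) :
    IsRealPoly (p - q) := by
  simp only [IsRealPoly, Polynomial.map_sub] at *; rw [hp, hq]

theorem IsRealPoly.mul {p q : ℂ[X]} (hp : IsRealPoly p) (hq : IsRealPoly q) :
    IsRealPoly (p * q) := by
  simp only [IsRealPoly, Polynomial.map_mul] at *; rw [hp, hq]

theorem isRealPoly_C (a : ℝ) : IsRealPoly (C (a : ℂ)) := by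
  simp [IsRealPoly]

theorem IsRealPoly.neg {p : ℂ[X]} (hp : IsRealPoly p) : IsRealPoly (-p) := by
  simp only [IsRealPoly, Polynomial.map_neg] at *; rw [hp]

/-! ### Real pencils -/

/-- A pair of coprime real polynomials whose quotient `N / Q` has no critical point in the open
upper half-plane. -/
structure IsPencil (N Q : ℂ[X]) : Prop where
  real_num : IsRealPoly N
  real_den : IsRealPoly Q
  coprime : ∀ z, N.eval z = 0 → Q.eval z ≠ 0
  wronskian_ne : ∀ z : ℂ, 0 < z.im → (wronskian Q N).eval z ≠ 0

/-- The rational function `N / Q`. -/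
noncomputable def quot (N Q : ℂ[X]) (z : ℂ) : ℂ := N.eval z / Q.eval z

theorem hasStrictDerivAt_quot {N Q : ℂ[X]} {z : ℂ} (hQ : Q.eval z ≠ 0) :
    HasStrictDerivAt (quot N Q) ((wronskian Q N).eval z / Q.eval z ^ 2) z := by
  refine ((N.hasStrictDerivAt z).div (Q.hasStrictDerivAt z) hQ).congr_deriv ?_
  simp only [wronskian, eval_sub, eval_mul]
  ring

theorem IsPencil.quot_conj {N Q : ℂ[X]} (h : IsPencil N Q) (z : ℂ) :
    quot N Q ((starRingEnd ℂ) z) = (starRingEnd ℂ) (quot N Q z) := by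
  simp [quot, h.real_num.eval_conj, h.real_den.eval_conj]

theorem IsPencil.im_quot_ofReal {N Q : ℂ[X]} (h : IsPencil N Q) {z : ℂ} (hz : z.im = 0) :
    (quot N Q z).im = 0 := by
  rw [← Complex.conj_eq_iff_im, ← h.quot_conj, Complex.conj_eq_iff_im.2 hz]

theorem exists_openPartialHomeomorph_quot {N Q : ℂ[X]} {z : ℂ} (hQ : Q.eval z ≠ 0)
    (hW : (wronskian Q N).eval z ≠ 0) :
    ∃ φ : OpenPartialHomeomorph ℂ ℂ, z ∈ φ.source ∧ ⇑φ = quot N Q := by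
  have h1 := hasStrictDerivAt_quot (N := N) hQ
  have h2 := h1.hasStrictFDerivAt_equiv (div_ne_zero hW (pow_ne_zero 2 hQ))
  exact ⟨h2.toOpenPartialHomeomorph _, h2.mem_toOpenPartialHomeomorph_source,
    h2.toOpenPartialHomeomorph_coe⟩

theorem injOn_quot_nhds {N Q : ℂ[X]} {z : ℂ} (hQ : Q.eval z ≠ 0)
    (hW : (wronskian Q N).eval z ≠ 0) :
    ∃ U ∈ 𝓝 z, InjOn (quot N Q) U := by
  obtain ⟨φ, hz, hφ⟩ := exists_openPartialHomeomorph_quot hQ hW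
  exact ⟨φ.source, φ.open_source.mem_nhds hz, hφ ▸ φ.injOn⟩

theorem eventually_ne_eval {Q : ℂ[X]} {z : ℂ} (hQ : Q.eval z ≠ 0) :
    ∀ᶠ y in 𝓝 z, Q.eval y ≠ 0 :=
  Q.continuous.continuousAt.eventually_ne hQ

/-! ### Limits of curves with finitely many cluster points -/

/-- A connected tail cannot hop between isolated cluster points. A closed neighbourhood K of one
cluster point that excludes the other points of Z has no cluster point on its frontier, so by
compactness the curve eventually misses the frontier. As it visits the interior of K at times
arbitrarily close to b, it ends up staying there. -/
theorem tendsto_of_finite_clusterPts {X : Type*} [TopologicalSpace X] [CompactSpace X] [T2Space X]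
    {c : ℝ → X} {a b : ℝ} (hab : a < b) (hc : ContinuousOn c (Ico a b)) {Z : Set X}
    (hZ : Z.Finite) (hcl : ∀ x, MapClusterPt x (𝓝[<] b) c → x ∈ Z) :
    ∃ x ∈ Z, Tendsto c (𝓝[<] b) (𝓝 x) := by
  obtain ⟨x, hx⟩ : ∃ x, MapClusterPt x (𝓝[<] b) c := by
    obtain ⟨x, -, hx⟩ := (isCompact_univ (X := X)).exists_mapClusterPt (u := c) (f := 𝓝[<] b)
      (by simp)
    exact ⟨x, hx⟩
  refine ⟨x, hcl x hx, ?_⟩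
  rw [tendsto_nhds]
  intro s hs hxs
  have hs' : s ∩ (Z \ {x})ᶜ ∈ 𝓝 x :=
    inter_mem (hs.mem_nhds hxs) ((hZ.subset sdiff_subset).isClosed.isOpen_compl.mem_nhds (by simp))
  obtain ⟨K, hK, hKc, hKs⟩ := exists_mem_nhds_isClosed_subset hs'
  have hfr : ∀ᶠ t in 𝓝[<] b, c t ∉ frontier K := by
    by_contra hcon
    have hfreq : ∃ᶠ t in 𝓝[<] b, c t ∈ frontier K := by
      intro h'; exact hcon h'
    obtain ⟨y, hy, hyc⟩ := (isClosed_frontier (s := K)).isCompact.exists_mapClusterPt_of_frequently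
      hfreq
    have hyZ := hcl y hyc
    have hyK : y ∈ K := hKc.frontier_subset hy
    have : y = x := by
      by_contra hne
      exact (hKs hyK).2 ⟨hyZ, hne⟩
    rw [this, hKc.frontier_eq] at hy
    exact hy.2 (mem_interior_iff_mem_nhds.2 hK)
  obtain ⟨d, hd, hdb⟩ := (mem_nhdsLT_iff_exists_Ioo_subset' hab).1 hfr
  have hd' : max a d < b := max_lt hab hd
  have hpre : IsPreconnected (c '' Ioo (max a d) b) :=
    isPreconnected_Ioo.image _ (hc.mono fun t ht => ⟨(le_max_left _ _).trans ht.1.le, ht.2⟩)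
  obtain ⟨t, hct, ht⟩ := ((hx.frequently (interior_mem_nhds.2 hK)).and_eventually
    (Ioo_mem_nhdsLT hd')).exists
  have hsub : c '' Ioo (max a d) b ⊆ interior K := by
    refine hpre.subset_left_of_subset_union isOpen_interior hKc.isOpen_compl
      (disjoint_compl_right.mono_left interior_subset) ?_ ⟨c t, mem_image_of_mem c ht, hct⟩
    rintro _ ⟨u, hu, rfl⟩
    have hu' := hdb ⟨(le_max_right _ _).trans_lt hu.1, hu.2⟩
    by_cases h : c u ∈ K
    · left
      by_contra hcon
      exact hu' (hKc.frontier_eq ▸ ⟨h, hcon⟩)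
    · exact Or.inr h
  filter_upwards [Ioo_mem_nhdsLT hd'] with u hu
  exact (hKs (interior_subset (hsub (mem_image_of_mem c hu)))).1

/-! ### End points of lifted curves -/

theorem eval_eq_reflect {p : ℂ[X]} {D : ℕ} (hD : p.natDegree ≤ D) {z : ℂ} (hz : z ≠ 0) :
    p.eval z = (p.reflect D).eval z⁻¹ * z ^ D := by
  let := invertibleOfNonzero hz
  have := eval₂_reflect_mul_pow (RingHom.id ℂ) z D p hD
  rw [invOf_eq_inv] at this
  exact this.symm

theorem eval_zero_reflect (p : ℂ[X]) (D : ℕ) : (p.reflect D).eval 0 = p.coeff D := by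
  rw [← coeff_zero_eq_eval_zero, coeff_reflect]
  simp [revAt_le]

/-- Division by `c ^ D` turns the relation into one between the reversed polynomials at `c⁻¹ → 0`,
whose values at 0 are the coefficients of degree `D`. It computes the value of N / Q at ∞. -/
theorem coeff_eq_of_tendsto_cobounded {α : Type*} {l : Filter α} [l.NeBot] {N Q : ℂ[X]} {D : ℕ}
    (hN : N.natDegree ≤ D) (hQ : Q.natDegree ≤ D) {c w : α → ℂ} {w₀ : ℂ}
    (hc : Tendsto c l (Bornology.cobounded ℂ)) (hw : Tendsto w l (𝓝 w₀))
    (h : ∀ᶠ t in l, N.eval (c t) = w t * Q.eval (c t)) : N.coeff D = w₀ * Q.coeff D := by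
  have hinv : Tendsto (fun t => (c t)⁻¹) l (𝓝 0) := tendsto_inv₀_cobounded.comp hc
  have hlim : ∀ p : ℂ[X], Tendsto (fun t => (p.reflect D).eval (c t)⁻¹) l (𝓝 (p.coeff D)) := by
    intro p
    rw [← eval_zero_reflect]
    exact ((p.reflect D).continuous.tendsto 0).comp hinv
  refine tendsto_nhds_unique_of_eventuallyEq (hlim N) (hw.mul (hlim Q)) ?_
  have hne : ∀ᶠ t in l, c t ≠ 0 := by
    filter_upwards [hc.eventually (Bornology.eventually_ne_cobounded 0)] with t ht using ht
  filter_upwards [h, hne] with t ht h0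
  rw [eval_eq_reflect hN h0, eval_eq_reflect hQ h0, ← mul_assoc] at ht
  exact mul_right_cancel₀ (pow_ne_zero D h0) ht

theorem tendsto_coe_infty_iff {α : Type*} {l : Filter α} {c : α → ℂ} :
    Tendsto (fun t => (c t : OnePoint ℂ)) l (𝓝 OnePoint.infty) ↔
      Tendsto c l (Bornology.cobounded ℂ) := by
  rw [Metric.cobounded_eq_cocompact, ← coclosedCompact_eq_cocompact,
    ← OnePoint.comap_coe_nhds_infty, tendsto_comap_iff]
  rfl

theorem tendsto_coe_coe_iff {α : Type*} {l : Filter α} {c : α → ℂ} {z : ℂ} :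
    Tendsto (fun t => (c t : OnePoint ℂ)) l (𝓝 (z : OnePoint ℂ)) ↔ Tendsto c l (𝓝 z) :=
  (OnePoint.isOpenEmbedding_coe.isInducing.tendsto_nhds_iff (f := c) (y := z)).symm

/-! ### Lifting curves along a rational function in the upper half-plane -/

theorem IsPencil.sub_ne_zero {N Q : ℂ[X]} (h : IsPencil N Q) (w : ℂ) : N - C w * Q ≠ 0 := by
  intro h0
  apply h.wronskian_ne Complex.I (by simp)
  rw [sub_eq_zero.1 h0]
  simp only [wronskian, derivative_mul, derivative_C, zero_mul, zero_add, eval_sub, eval_mul,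
    eval_C]
  ring

/-- A lift of the curve `w` along `N / Q`, staying in the upper half-plane. -/
structure IsLift (N Q : ℂ[X]) (w : ℝ → ℂ) (s : Set ℝ) (c : ℝ → ℂ) : Prop where
  continuousOn : ContinuousOn c s
  im_pos : ∀ t ∈ s, 0 < (c t).im
  den_ne : ∀ t ∈ s, Q.eval (c t) ≠ 0
  eq : ∀ t ∈ s, quot N Q (c t) = w t

theorem IsLift.eval_eq {N Q : ℂ[X]} {w : ℝ → ℂ} {s : Set ℝ} {c : ℝ → ℂ} (h : IsLift N Q w s c)
    {t : ℝ} (ht : t ∈ s) : N.eval (c t) = w t * Q.eval (c t) := by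
  rw [← h.eq t ht, quot, div_mul_cancel₀ _ (h.den_ne t ht)]

theorem IsLift.mono {N Q : ℂ[X]} {w : ℝ → ℂ} {s s' : Set ℝ} {c : ℝ → ℂ} (h : IsLift N Q w s c)
    (hs : s' ⊆ s) : IsLift N Q w s' c :=
  ⟨h.continuousOn.mono hs, fun t ht => h.im_pos t (hs ht), fun t ht => h.den_ne t (hs ht),
    fun t ht => h.eq t (hs ht)⟩

/-- A finite cluster point of the lift is a root of the nonzero polynomial N - w₀ Q, so on the
sphere there are only finitely many candidates and the lift converges. -/
theorem IsPencil.exists_limit {N Q : ℂ[X]} (h : IsPencil N Q) {w c : ℝ → ℂ} {a b : ℝ}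
    (hab : a < b) (hc : IsLift N Q w (Ico a b) c) {w₀ : ℂ} (hw : Tendsto w (𝓝[<] b) (𝓝 w₀)) :
    ∃ e : OnePoint ℂ, Tendsto (fun t => (c t : OnePoint ℂ)) (𝓝[<] b) (𝓝 e) ∧
      (e = OnePoint.infty ∨ ∃ z : ℂ, e = z ∧ 0 ≤ z.im ∧ N.eval z = w₀ * Q.eval z) := by
  have hmem : ∀ᶠ t in 𝓝[<] b, t ∈ Ico a b := Ico_mem_nhdsLT hab
  set Z : Set (OnePoint ℂ) :=
    insert OnePoint.infty ((fun z : ℂ => (z : OnePoint ℂ)) '' {z | (N - C w₀ * Q).IsRoot z}) with hZ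
  have hZf : Z.Finite := ((finite_setOfPred_isRoot (h.sub_ne_zero w₀)).image _).insert _
  obtain ⟨e, he, hlim⟩ := tendsto_of_finite_clusterPts (c := fun t => (c t : OnePoint ℂ)) hab
    (OnePoint.continuous_coe.comp_continuousOn hc.continuousOn) hZf (by
      intro x hx
      induction x using OnePoint.rec with
      | infty => exact mem_insert _ _
      | coe z =>
        refine mem_insert_of_mem _ ⟨z, ?_, rfl⟩
        have hx' : MapClusterPt z (𝓝[<] b) c :=
          (OnePoint.isOpenEmbedding_coe.isInducing.mapClusterPt_iff (f := fun z : ℂ => (z : OnePoint ℂ))).1 hx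
        obtain ⟨U, hU, hUz⟩ := mapClusterPt_iff_ultrafilter.1 hx'
        have h1 : Tendsto (fun t => N.eval (c t)) U (𝓝 (N.eval z)) :=
          (N.continuous.tendsto z).comp hUz
        have h2 : Tendsto (fun t => w t * Q.eval (c t)) U (𝓝 (w₀ * Q.eval z)) :=
          (hw.mono_left hU).mul ((Q.continuous.tendsto z).comp hUz)
        have h3 := tendsto_nhds_unique_of_eventuallyEq h1 h2
          (hU (hmem.mono fun t ht => hc.eval_eq ht))
        simp [h3])
  refine ⟨e, hlim, ?_⟩
  rcases he with he | ⟨z, hz, rfl⟩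
  · exact Or.inl he
  · refine Or.inr ⟨z, rfl, ?_, ?_⟩
    · rw [tendsto_coe_coe_iff] at hlim
      exact ge_of_tendsto ((Complex.continuous_im.tendsto z).comp hlim)
        (hmem.mono fun t ht => (hc.im_pos t ht).le)
    · simpa [sub_eq_zero] using hz

/-- The coincidence set is closed by continuity, and open because N / Q is locally injective where
its Wronskian and Q do not vanish. -/
theorem IsLift.eqOn {N Q : ℂ[X]} (h : IsPencil N Q) {w c₁ c₂ : ℝ → ℂ} {s : Set ℝ}
    (hs : IsPreconnected s) (h₁ : IsLift N Q w s c₁) (h₂ : IsLift N Q w s c₂) {t₀ : ℝ}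
    (ht₀ : t₀ ∈ s) (h0 : c₁ t₀ = c₂ t₀) : EqOn c₁ c₂ s := by
  have : PreconnectedSpace s := isPreconnected_iff_preconnectedSpace.1 hs
  have hcl : IsClopen {t : s | c₁ t = c₂ t} := by
    constructor
    · exact isClosed_eq (continuousOn_iff_continuous_domRestrict.1 h₁.continuousOn)
        (continuousOn_iff_continuous_domRestrict.1 h₂.continuousOn)
    · rw [isOpen_iff_mem_nhds]
      rintro t ht
      obtain ⟨U, hU, hinj⟩ := injOn_quot_nhds (h₁.den_ne t t.2) (h.wronskian_ne _ (h₁.im_pos t t.2))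
      have e1 := (continuousOn_iff_continuous_domRestrict.1 h₁.continuousOn).continuousAt (x := t) hU
      have e2 := (continuousOn_iff_continuous_domRestrict.1 h₂.continuousOn).continuousAt (x := t)
        (show U ∈ 𝓝 (c₂ t) by rwa [← show c₁ t = c₂ t from ht])
      filter_upwards [e1, e2] with u hu1 hu2
      exact hinj hu1 hu2 ((h₁.eq u u.2).trans (h₂.eq u u.2).symm)
  intro t ht
  have := hcl.eq_univ ⟨⟨t₀, ht₀⟩, h0⟩
  exact (this ▸ mem_univ (⟨t, ht⟩ : s) : (⟨t, ht⟩ : s) ∈ {t : s | c₁ t = c₂ t})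

/-- A local lift through a given point. -/
theorem IsPencil.exists_local_lift {N Q : ℂ[X]} (h : IsPencil N Q) {w : ℝ → ℂ}
    (hw : Continuous w) {z₀ : ℂ} (him : 0 < z₀.im) (hQ : Q.eval z₀ ≠ 0) {t₀ : ℝ}
    (h0 : quot N Q z₀ = w t₀) :
    ∃ δ > 0, ∃ c, IsLift N Q w (Ioo (t₀ - δ) (t₀ + δ)) c ∧ c t₀ = z₀ := by
  obtain ⟨φ, hz, hφ⟩ := exists_openPartialHomeomorph_quot hQ (h.wronskian_ne _ him)
  have ht : w t₀ ∈ φ.target := by rw [← h0, ← hφ]; exact φ.map_source hz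
  have hsymm : φ.symm (w t₀) = z₀ := by rw [← h0, ← hφ]; exact φ.left_inv hz
  have hca : ContinuousAt (fun t => φ.symm (w t)) t₀ :=
    (φ.continuousAt_symm ht).comp hw.continuousAt
  have e1 : ∀ᶠ t in 𝓝 t₀, w t ∈ φ.target :=
    hw.continuousAt (φ.open_target.mem_nhds ht)
  have e2 : ∀ᶠ t in 𝓝 t₀, 0 < (φ.symm (w t)).im ∧ Q.eval (φ.symm (w t)) ≠ 0 := by
    refine hca.eventually (p := fun z => 0 < z.im ∧ Q.eval z ≠ 0) ?_
    simp only [hsymm]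
    exact (Complex.continuous_im.continuousAt.eventually_const_lt him).and (eventually_ne_eval hQ)
  obtain ⟨δ, hδ, hball⟩ := Metric.eventually_nhds_iff_ball.1 (e1.and e2)
  rw [Real.ball_eq_Ioo] at hball
  refine ⟨δ, hδ, fun t => φ.symm (w t), ⟨?_, fun t ht => (hball t ht).2.1,
    fun t ht => (hball t ht).2.2, fun t ht => ?_⟩, hsymm⟩
  · exact φ.continuousOn_symm.comp hw.continuousOn fun t ht => (hball t ht).1
  · rw [← hφ]; exact φ.right_inv (hball t ht).1

/-- Gluing of a lift on `[a, b)` with a lift around `b`. -/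
theorem IsLift.glue {N Q : ℂ[X]} (h : IsPencil N Q) {w c₁ c₂ : ℝ → ℂ} {a b u v : ℝ}
    (hab : a < b) (hub : u < b) (hbv : b < v) (h₁ : IsLift N Q w (Ico a b) c₁)
    (h₂ : IsLift N Q w (Ioo u v) c₂) (hlim : Tendsto c₁ (𝓝[<] b) (𝓝 (c₂ b))) :
    ∃ c, IsLift N Q w (Ico a v) c ∧ EqOn c c₁ (Ico a b) := by
  obtain ⟨U, hU, hinj⟩ := injOn_quot_nhds (h₂.den_ne b ⟨hub, hbv⟩)
    (h.wronskian_ne _ (h₂.im_pos b ⟨hub, hbv⟩))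
  have h2c : ContinuousAt c₂ b := h₂.continuousOn.continuousAt (Ioo_mem_nhds hub hbv)
  have e : ∀ᶠ t in 𝓝[<] b, c₁ t = c₂ t ∧ max a u < t := by
    filter_upwards [hlim hU, (h2c.tendsto.mono_left nhdsWithin_le_nhds : Tendsto c₂ (𝓝[<] b) _) hU,
      Ioo_mem_nhdsLT (max_lt hab hub)] with t h1 h2 ht
    have m1 : t ∈ Ico a b := ⟨(le_max_left a u).trans ht.1.le, ht.2⟩
    have m2 : t ∈ Ioo u v := ⟨(le_max_right a u).trans_lt ht.1, ht.2.trans hbv⟩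
    exact ⟨hinj h1 h2 ((h₁.eq t m1).trans (h₂.eq t m2).symm), ht.1⟩
  obtain ⟨t₁, ⟨ht₁, hm⟩, ht₁b⟩ := (e.and self_mem_nhdsWithin).exists
  have ht₁b : t₁ < b := ht₁b
  have hat : a < t₁ := (le_max_left a u).trans_lt hm
  have hut : u < t₁ := (le_max_right a u).trans_lt hm
  have hon : EqOn c₁ c₂ (Ico t₁ b) :=
    IsLift.eqOn h isPreconnected_Ico (h₁.mono fun t ht => ⟨hat.le.trans ht.1, ht.2⟩)
      (h₂.mono fun t ht => ⟨hut.trans_le ht.1, ht.2.trans hbv⟩) ⟨le_rfl, ht₁b⟩ ht₁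
  set c : ℝ → ℂ := fun t => if t < t₁ then c₁ t else c₂ t with hc
  have hc1 : EqOn c c₁ (Ico a b) := by
    intro t ht
    by_cases hlt : t < t₁
    · simp [hc, hlt]
    · simp only [hc, hlt, if_false]
      exact (hon ⟨not_lt.1 hlt, ht.2⟩).symm
  have hc2 : EqOn c c₂ (Ico t₁ v) := by
    intro t ht
    simp [hc, not_lt.2 ht.1]
  refine ⟨c, ⟨?_, ?_, ?_, ?_⟩, hc1⟩
  · intro t ht
    by_cases hlt : t < b
    · have := (h₁.continuousOn.congr hc1) t ⟨ht.1, hlt⟩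
      exact this.mono_of_mem_nhdsWithin (mem_nhdsWithin.2 ⟨Iio b, isOpen_Iio, hlt, fun x hx =>
        ⟨hx.2.1, hx.1⟩⟩)
    · have htb : t₁ < t := ht₁b.trans_le (not_lt.1 hlt)
      have h3 : ContinuousOn c (Ioo t₁ v) :=
        (h₂.continuousOn.mono (Ioo_subset_Ioo_left hut.le)).congr
          (hc2.mono Ioo_subset_Ico_self)
      exact (h3.continuousAt (Ioo_mem_nhds htb ht.2)).continuousWithinAt
  all_goals
    intro t ht
    by_cases hlt : t < b
    · rw [hc1 ⟨ht.1, hlt⟩]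
      first
        | exact h₁.im_pos t ⟨ht.1, hlt⟩
        | exact h₁.den_ne t ⟨ht.1, hlt⟩
        | exact h₁.eq t ⟨ht.1, hlt⟩
    · rw [hc2 ⟨ht₁b.le.trans (not_lt.1 hlt), ht.2⟩]
      have : t ∈ Ioo u v := ⟨hub.trans_le (not_lt.1 hlt), ht.2⟩
      first
        | exact h₂.im_pos t this
        | exact h₂.den_ne t this
        | exact h₂.eq t this

/-- A curve with a starting point either lifts for all times, or lifts up to a finite time at which
the lift has a limit in the Riemann sphere that is not a point of the open upper half-plane. -/
theorem IsPencil.exists_maximal_lift {N Q : ℂ[X]} (h : IsPencil N Q) {w : ℝ → ℂ}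
    (hw : Continuous w) {z₀ : ℂ} (him : 0 < z₀.im) (hQ : Q.eval z₀ ≠ 0) {a : ℝ}
    (h0 : quot N Q z₀ = w a) :
    (∃ c, IsLift N Q w (Ici a) c ∧ c a = z₀) ∨
    ∃ b > a, ∃ c, IsLift N Q w (Ico a b) c ∧ c a = z₀ ∧
      ∃ e : OnePoint ℂ, Tendsto (fun t => (c t : OnePoint ℂ)) (𝓝[<] b) (𝓝 e) ∧
      (e = OnePoint.infty ∨ ∃ z : ℂ, e = z ∧ z.im = 0 ∧ N.eval z = w b * Q.eval z) := by
  set S : Set ℝ := {b | a < b ∧ ∃ c, IsLift N Q w (Ico a b) c ∧ c a = z₀} with hS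
  have hlift : ∀ b : ℝ, ∃ c, b ∈ S → IsLift N Q w (Ico a b) c ∧ c a = z₀ := by
    intro b
    by_cases hb : b ∈ S
    · obtain ⟨c, hc⟩ := hb.2
      exact ⟨c, fun _ => hc⟩
    · exact ⟨0, fun h => absurd h hb⟩
  choose L hL using hlift
  have hagree : ∀ b ∈ S, ∀ b' ∈ S, b ≤ b' → EqOn (L b) (L b') (Ico a b) := by
    intro b hb b' hb' hle
    exact IsLift.eqOn h isPreconnected_Ico (hL b hb).1 ((hL b' hb').1.mono (Ico_subset_Ico_right hle))
      ⟨le_rfl, hb.1⟩ ((hL b hb).2.trans (hL b' hb').2.symm)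
  have hSne : S.Nonempty := by
    obtain ⟨δ, hδ, c, hc, hc0⟩ := h.exists_local_lift hw him hQ h0
    exact ⟨a + δ, by linarith, c, hc.mono fun t ht => ⟨by linarith [ht.1], ht.2⟩, hc0⟩
  -- gluing on any half-open interval covered by `S`
  have hglue : ∀ I : Set ℝ, (∀ t ∈ I, a ≤ t) → (∀ t ∈ I, ∃ b ∈ S, t < b) →
      ∃ c, IsLift N Q w I c ∧ (a ∈ I → c a = z₀) := by
    intro I hI hex
    have hex' : ∀ t, ∃ b, t ∈ I → b ∈ S ∧ t < b := by
      intro t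
      by_cases ht : t ∈ I
      · obtain ⟨b, hb⟩ := hex t ht; exact ⟨b, fun _ => hb⟩
      · exact ⟨0, fun h => absurd h ht⟩
    choose β hβ using hex'
    have key : ∀ t ∈ I, ∀ b ∈ S, t < b → L (β t) t = L b t := by
      intro t ht b hb htb
      rcases le_total (β t) b with hle | hle
      · exact hagree _ (hβ t ht).1 _ hb hle ⟨hI t ht, (hβ t ht).2⟩
      · exact (hagree _ hb _ (hβ t ht).1 hle ⟨hI t ht, htb⟩).symm
    refine ⟨fun t => L (β t) t, ⟨?_, ?_, ?_, ?_⟩, fun ha => (hL _ (hβ a ha).1).2⟩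
    · intro t ht
      have h1 : ContinuousWithinAt (L (β t)) (Ico a (β t)) t :=
        (hL _ (hβ t ht).1).1.continuousOn t ⟨hI t ht, (hβ t ht).2⟩
      have h2 : Ico a (β t) ∈ 𝓝[I] t := mem_nhdsWithin.2 ⟨Iio (β t), isOpen_Iio, (hβ t ht).2,
        fun x hx => ⟨hI x hx.2, hx.1⟩⟩
      refine (h1.mono_of_mem_nhdsWithin h2).congr_of_eventuallyEq ?_ rfl
      filter_upwards [h2, self_mem_nhdsWithin] with x hx hxI
      exact key x hxI _ (hβ t ht).1 hx.2
    · intro t ht; exact (hL _ (hβ t ht).1).1.im_pos t ⟨hI t ht, (hβ t ht).2⟩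
    · intro t ht; exact (hL _ (hβ t ht).1).1.den_ne t ⟨hI t ht, (hβ t ht).2⟩
    · intro t ht; exact (hL _ (hβ t ht).1).1.eq t ⟨hI t ht, (hβ t ht).2⟩
  by_cases hbdd : BddAbove S
  · right
    have hlt : ∀ t, t < sSup S → ∃ b ∈ S, t < b := fun t ht => exists_lt_of_lt_csSup hSne ht
    have hab : a < sSup S := by
      obtain ⟨b, hb⟩ := hSne
      exact hb.1.trans_le (le_csSup hbdd hb)
    obtain ⟨c, hc, hca⟩ := hglue (Ico a (sSup S)) (fun t ht => ht.1) (fun t ht => hlt t ht.2)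
    have hca := hca ⟨le_rfl, hab⟩
    refine ⟨sSup S, hab, c, hc, hca, ?_⟩
    obtain ⟨e, he, hor⟩ := h.exists_limit hab hc (hw.continuousAt.tendsto.mono_left nhdsWithin_le_nhds)
    refine ⟨e, he, hor.imp_right ?_⟩
    rintro ⟨z, rfl, hz, hNQ⟩
    refine ⟨z, rfl, ?_, hNQ⟩
    -- A limit in the open half-plane would be a regular point with finite value; a local lift there
    -- could be glued on, giving an element of `S` beyond its supremum.
    by_contra hne
    have hzpos : 0 < z.im := lt_of_le_of_ne hz (Ne.symm hne)
    have hQz : Q.eval z ≠ 0 := by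
      intro h'
      rw [h', mul_zero] at hNQ
      exact h.coprime z hNQ h'
    obtain ⟨δ, hδ, c₂, hc₂, hc₂b⟩ := h.exists_local_lift hw hzpos hQz (t₀ := sSup S)
      (by rw [quot, hNQ, mul_div_cancel_right₀ _ hQz])
    obtain ⟨c₃, hc₃, heq⟩ := IsLift.glue h hab (by linarith) (by linarith) hc hc₂
      (by rw [hc₂b]; exact tendsto_coe_coe_iff.1 he)
    have : sSup S + δ ∈ S := ⟨by linarith, c₃, hc₃, by rw [heq ⟨le_rfl, hab⟩, hca]⟩
    linarith [le_csSup hbdd this]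
  · left
    obtain ⟨c, hc, hca⟩ := hglue (Ici a) (fun t ht => ht) (fun t ht => by
      rw [not_bddAbove_iff] at hbdd
      exact hbdd t)
    exact ⟨c, hc, hca self_mem_Ici⟩

theorem IsPencil.num_ne_zero {N Q : ℂ[X]} (h : IsPencil N Q) : N ≠ 0 := by
  simpa using h.sub_ne_zero 0

theorem IsPencil.den_ne_zero {N Q : ℂ[X]} (h : IsPencil N Q) : Q ≠ 0 := by
  rintro rfl
  exact h.wronskian_ne Complex.I (by simp) (by simp [wronskian])

/-- If N / Q has a finite value at ∞, that value is a quotient of two real coefficients. The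
coefficient of Q is nonzero, since otherwise a leading coefficient of N or of Q would vanish. -/
theorem IsPencil.im_eq_zero_of_coeff {N Q : ℂ[X]} (h : IsPencil N Q) {w : ℂ}
    (hw : N.coeff (max N.natDegree Q.natDegree) = w * Q.coeff (max N.natDegree Q.natDegree)) :
    w.im = 0 := by
  set D := max N.natDegree Q.natDegree with hD
  have hQ : Q.coeff D ≠ 0 := by
    intro h0
    rw [h0, mul_zero] at hw
    rcases max_choice N.natDegree Q.natDegree with h1 | h1
    · rw [hD, h1, coeff_natDegree, leadingCoeff_eq_zero] at hw
      exact h.num_ne_zero hw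
    · rw [hD, h1, coeff_natDegree, leadingCoeff_eq_zero] at h0
      exact h.den_ne_zero h0
  have : w = N.coeff D / Q.coeff D := by rw [hw, mul_div_cancel_right₀ _ hQ]
  rw [this, Complex.div_im, h.real_num.im_coeff, h.real_den.im_coeff]
  simp

/-- Curves leaving the real axis immediately have lifts for all times. -/
theorem IsPencil.exists_lift_of_im_ne {N Q : ℂ[X]} (h : IsPencil N Q) {w : ℝ → ℂ}
    (hw : Continuous w) {z₀ : ℂ} (him : 0 < z₀.im) (hQ : Q.eval z₀ ≠ 0) {a : ℝ}
    (h0 : quot N Q z₀ = w a) (hne : ∀ t > a, (w t).im ≠ 0) :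
    ∃ c, IsLift N Q w (Ici a) c ∧ c a = z₀ := by
  -- A lift that stops at time b > a ends at ∞ or at a real point. There N / Q can only have a real
  -- finite value, whereas w b is not real.
  rcases h.exists_maximal_lift hw him hQ h0 with h1 | ⟨b, hab, c, hc, -, e, he, rfl | ⟨z, rfl, hz, hb⟩⟩
  · exact h1
  · exfalso
    rw [tendsto_coe_infty_iff] at he
    refine hne b hab (h.im_eq_zero_of_coeff ?_)
    exact coeff_eq_of_tendsto_cobounded (le_max_left _ _) (le_max_right _ _) he
      (hw.continuousAt.tendsto.mono_left nhdsWithin_le_nhds)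
      (by filter_upwards [Ico_mem_nhdsLT hab] with t ht using hc.eval_eq ht)
  · exfalso
    have hQz : Q.eval z ≠ 0 := by
      intro h'
      rw [h', mul_zero] at hb
      exact h.coprime z hb h'
    apply hne b hab
    have : w b = quot N Q z := by rw [quot, hb, mul_div_cancel_right₀ _ hQz]
    rw [this]
    exact h.im_quot_ofReal hz

/-! ### No lift of the whole real line -/

/-- The part of the upper half-plane where `Q` does not vanish. -/
abbrev regularDomain (Q : ℂ[X]) : Type := {z : ℂ // 0 < z.im ∧ Q.eval z ≠ 0}

theorem isOpen_regularDomain (Q : ℂ[X]) : IsOpen {z : ℂ | 0 < z.im ∧ Q.eval z ≠ 0} :=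
  (isOpen_lt continuous_const Complex.continuous_im).inter
    (isOpen_ne_fun Q.continuous continuous_const)

theorem IsPencil.isLocalHomeomorph {N Q : ℂ[X]} (h : IsPencil N Q) :
    IsLocalHomeomorph (fun z : regularDomain Q => quot N Q z) := by
  have h1 : IsLocalHomeomorph (Subtype.val : regularDomain Q → ℂ) :=
    (isOpen_regularDomain Q).isOpenEmbedding_subtypeVal.isLocalHomeomorph
  have h2 : IsLocalHomeomorphOn (quot N Q) {z : ℂ | 0 < z.im ∧ Q.eval z ≠ 0} := by
    intro z hz
    obtain ⟨φ, hφz, hφ⟩ := exists_openPartialHomeomorph_quot hz.2 (h.wronskian_ne z hz.1)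
    exact ⟨φ, hφz, hφ.symm⟩
  rw [isLocalHomeomorph_iff_isLocalHomeomorphOn_univ] at h1 ⊢
  exact h2.comp h1 fun z _ => z.2

/-- The vertical segment from `u.re` to `u` leaves the real axis at once, so its lift from `c u.re`
never stops; a real `u` gives a constant path. These lifts spread a section over ℝ to one over ℂ. -/
theorem IsPencil.exists_segment_lift {N Q : ℂ[X]} (h : IsPencil N Q) {c : ℝ → ℂ}
    (hc : IsLift N Q (fun t => (t : ℂ)) univ c) (u : ℂ) :
    ∃ g : unitInterval → regularDomain Q, Continuous g ∧ (g 0 : ℂ) = c u.re ∧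
      ∀ s, quot N Q (g s) = (u.re : ℂ) + (s : ℝ) * (u.im * Complex.I) := by
  by_cases hu : u.im = 0
  · refine ⟨fun _ => ⟨c u.re, hc.im_pos _ trivial, hc.den_ne _ trivial⟩, continuous_const, rfl, ?_⟩
    intro s
    simp [hu, hc.eq u.re trivial]
  · obtain ⟨d, hd, hd0⟩ := h.exists_lift_of_im_ne
      (w := fun s : ℝ => (u.re : ℂ) + (s : ℂ) * (u.im * Complex.I)) (by fun_prop)
      (hc.im_pos u.re trivial) (hc.den_ne u.re trivial) (a := 0)
      (by simp [hc.eq u.re trivial]) (by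
        intro t ht
        simp [ht.ne', hu])
    refine ⟨fun s => ⟨d s, hd.im_pos s s.2.1, hd.den_ne s s.2.1⟩, ?_, hd0, fun s => hd.eq s s.2.1⟩
    refine Continuous.subtype_mk ?_ _
    exact hd.continuousOn.comp_continuous continuous_subtype_val fun s => s.2.1

/-- There is no curve in the upper half-plane along which `N / Q` takes every real value exactly
once: such a curve would extend to a global holomorphic section of `N / Q`, and a holomorphic
function from the plane to the half-plane is constant. -/
theorem IsPencil.not_isLift_univ {N Q : ℂ[X]} (h : IsPencil N Q) (c : ℝ → ℂ) :
    ¬ IsLift N Q (fun t => (t : ℂ)) univ c := by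
  intro hc
  choose g hgc hg0 hg using h.exists_segment_lift hc
  let f : C(unitInterval × ℂ, ℂ) :=
    ⟨fun p => (p.2.re : ℂ) + ((p.1 : ℝ) : ℂ) * (p.2.im * Complex.I), by fun_prop⟩
  have hcont : Continuous (fun p : unitInterval × ℂ => g p.2 p.1) := by
    -- Lifts through a local homeomorphism that are continuous along each segment and have
    -- continuously varying starting points are jointly continuous.
    refine h.isLocalHomeomorph.continuous_lift (T2Space.isSeparatedMap _) f ?_ ?_ ?_
    · funext p
      exact hg p.2 p.1
    · refine continuous_induced_rng.2 ?_
      have : Continuous (fun u : ℂ => c u.re) :=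
        (continuousOn_univ.1 hc.continuousOn).comp Complex.continuous_re
      exact this.congr fun u => (hg0 u).symm
    · exact hgc
  set S : ℂ → ℂ := fun u => (g u 1 : ℂ) with hS
  have hSc : Continuous S :=
    continuous_subtype_val.comp (hcont.comp (Continuous.prodMk_right (1 : unitInterval)))
  have hSr : ∀ u, quot N Q (S u) = u := by
    intro u
    rw [hS]; simp only
    rw [hg u 1]
    simp [Complex.re_add_im]
  have hSd : Differentiable ℂ S := by
    intro u
    have h1 := (hasStrictDerivAt_quot (N := N) (g u 1).2.2).hasDerivAt
    exact (h1.of_local_left_inverse (hSc.continuousAt)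
      (div_ne_zero (h.wronskian_ne _ (g u 1).2.1) (pow_ne_zero 2 (g u 1).2.2))
      (Eventually.of_forall hSr)).differentiableAt
  have hne : ∀ u, S u + Complex.I ≠ 0 := by
    intro u h0
    have h1 : 0 < (S u).im := (g u 1).2.1
    have h2 := congrArg Complex.im h0
    simp at h2
    linarith
  -- Since Im S > 0, the function 1 / (S + i) is bounded by 1, so Liouville makes S constant. This
  -- contradicts R ∘ S = id.
  have hTd : Differentiable ℂ (fun u => (S u + Complex.I)⁻¹) :=
    (hSd.add_const _).inv hne
  have hTb : Bornology.IsBounded (range (fun u => (S u + Complex.I)⁻¹)) := by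
    rw [isBounded_iff_forall_norm_le]
    refine ⟨1, ?_⟩
    rintro _ ⟨u, rfl⟩
    rw [norm_inv]
    apply inv_le_one_of_one_le₀
    have h1 : 0 < (S u).im := (g u 1).2.1
    have h2 := Complex.abs_im_le_norm (S u + Complex.I)
    simp only [Complex.add_im, Complex.I_im] at h2
    linarith [le_abs_self ((S u).im + 1)]
  have h01 := hTd.apply_eq_apply_of_bounded hTb 0 1
  have h02 : S 0 = S 1 := by simpa using h01
  have := hSr 0
  rw [h02, hSr 1] at this
  exact one_ne_zero this

/-! ### Root coordinates at real points -/

/-- A real function with a zero of order `k` at a real point is the `k`-th power of a local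
coordinate that preserves the upper half-plane. -/
theorem exists_root_coordinate {k : ℕ} (hk : k ≠ 0) {x : ℝ} {h : ℂ → ℂ} {h' : ℂ}
    (hd : HasStrictDerivAt h h' x) (hconj : ∀ z, h ((starRingEnd ℂ) z) = (starRingEnd ℂ) (h z))
    (hpos : 0 < (h x).re) :
    ∃ φ : OpenPartialHomeomorph ℂ ℂ, (x : ℂ) ∈ φ.source ∧ φ x = 0 ∧
      (∀ z ∈ φ.source, φ z ^ k = (z - x) ^ k * h z) ∧
      (∀ z ∈ φ.source, 0 < (φ z).im ↔ 0 < z.im) := by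
  have hxim : (h x).im = 0 := by
    have := hconj x
    rw [Complex.conj_ofReal] at this
    exact Complex.conj_eq_iff_im.1 this.symm
  obtain ⟨p, hp⟩ : ∃ p : ℝ, h x = p := ⟨(h x).re, by apply Complex.ext <;> simp [hxim]⟩
  have hp0 : 0 < p := by rw [hp] at hpos; simpa using hpos
  -- The coordinate is (z - x) times the principal k-th root of h. The root commutes with
  -- conjugation on the slit plane, and the derivative at x is the positive real number q =
  -- h(x)^(1/k).
  set H : ℂ → ℂ := fun z => (h z) ^ ((k : ℂ)⁻¹) with hH
  have hslit : h x ∈ Complex.slitPlane := Or.inl hpos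
  have hHd := hd.cpow (hasStrictDerivAt_const (x : ℂ) ((k : ℂ)⁻¹)) hslit
  obtain ⟨q, hq0, hq⟩ : ∃ q : ℝ, 0 < q ∧ H x = q := by
    refine ⟨p ^ ((k : ℝ)⁻¹), Real.rpow_pos_of_pos hp0 _, ?_⟩
    simp only [hH, hp]
    rw [Complex.ofReal_cpow hp0.le]
    simp
  have hψd : HasStrictDerivAt (fun z => (z - x) * H z) (q : ℂ) x := by
    refine (HasStrictDerivAt.mul ((hasStrictDerivAt_id (x : ℂ)).sub_const (x : ℂ)) hHd).congr_deriv ?_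
    have : (h x) ^ ((k : ℂ)⁻¹) = q := hq
    simp [this]
  have hHconj : ∀ z, h z ∈ Complex.slitPlane → H ((starRingEnd ℂ) z) = (starRingEnd ℂ) (H z) := by
    intro z hz
    simp only [hH, hconj]
    rw [Complex.conj_cpow _ _ (Complex.slitPlane_arg_ne_pi hz)]
    simp
  have hev : ∀ᶠ z in 𝓝 (x : ℂ), h z ∈ Complex.slitPlane :=
    hd.hasDerivAt.continuousAt (Complex.isOpen_slitPlane.mem_nhds hslit)
  -- Strict differentiability is applied to the pair (z, Re z): the coordinate is real at Re z, so
  -- its imaginary part at z is q Im z up to an error of (q / 2) |Im z| and has the sign of Im z.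
  have hlo := (hasStrictDerivAt_iff_hasStrictFDerivAt.1 hψd).isLittleO.def (c := q / 2) (by positivity)
  have hre : Tendsto (fun z : ℂ => (z, (z.re : ℂ))) (𝓝 (x : ℂ)) (𝓝 ((x : ℂ), (x : ℂ))) := by
    have : Continuous (fun z : ℂ => (z, (z.re : ℂ))) := by fun_prop
    simpa using this.tendsto (x : ℂ)
  have hre' : Tendsto (fun z : ℂ => (z.re : ℂ)) (𝓝 (x : ℂ)) (𝓝 (x : ℂ)) := by
    have : Continuous (fun z : ℂ => (z.re : ℂ)) := by fun_prop
    simpa using this.tendsto (x : ℂ)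
  obtain ⟨r, hr, hball⟩ := Metric.eventually_nhds_iff_ball.1
    (hev.and ((hre'.eventually hev).and (hre.eventually hlo)))
  have hq' : (q : ℂ) ≠ 0 := by exact_mod_cast hq0.ne'
  have hF := hψd.hasStrictFDerivAt_equiv hq'
  set φ₀ := hF.toOpenPartialHomeomorph (fun z => (z - x) * H z) with hφ₀
  have hcoe : ∀ z, φ₀ z = (z - x) * H z := fun z => rfl
  have hkey : ∀ z ∈ Metric.ball (x : ℂ) r, |(φ₀ z).im - q * z.im| ≤ q / 2 * |z.im| := by
    intro z hz
    obtain ⟨-, h2, h3⟩ := hball z hz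
    have him : (φ₀ z.re).im = 0 := by
      rw [hcoe, ← Complex.conj_eq_iff_im, map_mul, ← hHconj _ h2]
      simp
    have h4 := (Complex.abs_im_le_norm _).trans h3
    have e1 : z - (z.re : ℂ) = z.im * Complex.I := by
      apply Complex.ext <;> simp
    simp only [e1] at h4
    simpa [him, ← hcoe, abs_of_pos hq0, mul_comm] using h4
  refine ⟨φ₀.restrOpen (Metric.ball x r) Metric.isOpen_ball, ?_, ?_, ?_, ?_⟩
  · exact ⟨hF.mem_toOpenPartialHomeomorph_source, Metric.mem_ball_self hr⟩
  · change φ₀ x = 0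
    simp [hcoe]
  · intro z hz
    change φ₀ z ^ k = _
    rw [hcoe, mul_pow, hH]
    simp only
    rw [Complex.cpow_nat_inv_pow _ hk]
  · intro z hz
    change 0 < (φ₀ z).im ↔ _
    have h5 := hkey z hz.2
    rw [abs_le] at h5
    constructor
    · intro h6
      by_contra h7
      rw [abs_of_nonpos (not_lt.1 h7)] at h5
      nlinarith [h5.2]
    · intro h6
      rw [abs_of_pos h6] at h5
      nlinarith [h5.1]

/-! ### The real locus and the arcs from the critical points -/

/-- The set where `N / Q` takes values in the real projective line. -/
def locus (N Q : ℂ[X]) : Set ℂ := {z | (N.eval z * (starRingEnd ℂ) (Q.eval z)).im = 0}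

theorem im_div_eq_zero_iff {a b : ℂ} (hb : b ≠ 0) :
    (a / b).im = 0 ↔ (a * (starRingEnd ℂ) b).im = 0 := by
  have hn : Complex.normSq b ≠ 0 := by simpa using hb
  rw [div_eq_mul_inv, Complex.inv_def, ← mul_assoc, Complex.im_mul_ofReal]
  simp [hb]

theorem mem_locus_iff {N Q : ℂ[X]} {z : ℂ} (hQ : Q.eval z ≠ 0) :
    z ∈ locus N Q ↔ (quot N Q z).im = 0 := (im_div_eq_zero_iff hQ).symm

theorem IsLift.mem_locus {N Q : ℂ[X]} {s : Set ℝ} {c : ℝ → ℂ}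
    (h : IsLift N Q (fun t => (t : ℂ)) s c) {t : ℝ} (ht : t ∈ s) : c t ∈ locus N Q := by
  rw [mem_locus_iff (h.den_ne t ht), h.eq t ht, Complex.ofReal_im]

/-- The new quotient is w ↦ ε / (w - v) applied to N / Q, and this map preserves the real projective
line. -/
theorem locus_comb {N Q : ℂ[X]} (ε v : ℝ) (hε : ε ≠ 0) :
    locus (C (ε : ℂ) * Q) (N - C (v : ℂ) * Q) = locus N Q := by
  ext z
  simp only [locus, mem_ofPred_eq, eval_mul, eval_C, eval_sub, map_sub, map_mul, Complex.conj_ofReal]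
  have : ε * eval z Q * ((starRingEnd ℂ) (eval z N) - v * (starRingEnd ℂ) (eval z Q)) =
      (ε : ℂ) * ((starRingEnd ℂ) (eval z N * (starRingEnd ℂ) (eval z Q)) -
        ((v * Complex.normSq (eval z Q) : ℝ) : ℂ)) := by
    rw [Complex.ofReal_mul, ← Complex.mul_conj]
    simp
    ring
  rw [this, Complex.im_ofReal_mul, Complex.sub_im, Complex.ofReal_im, sub_zero, Complex.conj_im,
    mul_eq_zero, neg_eq_zero]
  exact or_iff_right hε

/-- A lift whose values are real cannot end at a regular real point. -/
theorem IsPencil.wronskian_eq_zero_of_limit {N Q : ℂ[X]} (h : IsPencil N Q) {c : ℝ → ℂ} {a b : ℝ}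
    (hab : a < b) (hc : IsLift N Q (fun t => (t : ℂ)) (Ico a b) c) {z : ℂ}
    (hlim : Tendsto c (𝓝[<] b) (𝓝 z)) (hz : z.im = 0) (hQ : Q.eval z ≠ 0) :
    (wronskian Q N).eval z = 0 := by
  by_contra hW
  obtain ⟨U, hU, hinj⟩ := injOn_quot_nhds hQ hW
  -- The lift and its mirror image take the same real values and both tend to z, so local
  -- injectivity would force the lift onto the real axis.
  have hconj : Tendsto (fun t => (starRingEnd ℂ) (c t)) (𝓝[<] b) (𝓝 z) := by
    have := (Complex.continuous_conj.tendsto z).comp hlim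
    rwa [Complex.conj_eq_iff_im.2 hz] at this
  obtain ⟨t, ⟨h1, h2⟩, ht⟩ := (((hlim.eventually hU).and (hconj.eventually hU)).and
    (Ico_mem_nhdsLT hab)).exists
  have : c t = (starRingEnd ℂ) (c t) := by
    refine hinj h1 h2 ?_
    rw [h.quot_conj, hc.eq t ht, Complex.conj_ofReal]
  have h3 := hc.im_pos t ht
  rw [Complex.conj_eq_iff_im.1 this.symm] at h3
  exact lt_irrefl _ h3

/-- Gluing of a lift on a left half-line with a lift on an interval to the right. -/
theorem IsLift.union {N Q : ℂ[X]} (h : IsPencil N Q) {w c₁ c₂ : ℝ → ℂ} {T t₁ : ℝ} {J : Set ℝ}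
    (hJ : J.OrdConnected) (hJ₁ : J ⊆ Ici t₁) (ht₁ : t₁ ∈ J) (hT : t₁ < T)
    (h₁ : IsLift N Q w (Iio T) c₁) (h₂ : IsLift N Q w J c₂) (heq : c₁ t₁ = c₂ t₁) :
    IsLift N Q w (Iio t₁ ∪ J) (fun t => if t < t₁ then c₁ t else c₂ t) := by
  have hpre : (J ∩ Iio T).OrdConnected := hJ.inter ordConnected_Iio
  have hon : EqOn c₁ c₂ (J ∩ Iio T) :=
    IsLift.eqOn h hpre.isPreconnected (h₁.mono inter_subset_right) (h₂.mono inter_subset_left)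
      ⟨ht₁, hT⟩ heq
  set c : ℝ → ℂ := fun t => if t < t₁ then c₁ t else c₂ t with hc
  have hc1 : EqOn c c₁ ((Iio t₁ ∪ J) ∩ Iio T) := by
    rintro t ⟨ht, htT⟩
    by_cases hlt : t < t₁
    · simp [hc, hlt]
    · simp only [hc, hlt, if_false]
      exact (hon ⟨ht.resolve_left hlt, htT⟩).symm
  have hc2 : EqOn c c₂ J := by
    intro t ht
    simp [hc, not_lt.2 (mem_Ici.1 (hJ₁ ht))]
  refine ⟨?_, ?_, ?_, ?_⟩
  · intro t ht
    by_cases hlt : t < T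
    · have h3 : ContinuousWithinAt c ((Iio t₁ ∪ J) ∩ Iio T) t :=
        ((h₁.continuousOn.mono inter_subset_right).congr hc1) t ⟨ht, hlt⟩
      exact (continuousWithinAt_inter (Iio_mem_nhds hlt)).1 h3
    · have htt : t₁ < t := hT.trans_le (not_lt.1 hlt)
      have htJ : t ∈ J := ht.resolve_left (notMem_Iio.2 htt.le)
      refine ((h₂.continuousOn.congr hc2) t htJ).mono_of_mem_nhdsWithin ?_
      exact mem_nhdsWithin.2 ⟨Ioi t₁, isOpen_Ioi, htt, fun u hu =>
        hu.2.resolve_left (notMem_Iio.2 (le_of_lt hu.1))⟩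
  all_goals
    rintro t (ht | ht)
    · rw [hc1 ⟨Or.inl ht, lt_trans ht hT⟩]
      first
        | exact h₁.im_pos t (lt_trans ht hT)
        | exact h₁.den_ne t (lt_trans ht hT)
        | exact h₁.eq t (lt_trans ht hT)
    · rw [hc2 ht]
      first
        | exact h₂.im_pos t ht
        | exact h₂.den_ne t ht
        | exact h₂.eq t ht

/-- An arc of the real locus in the upper half-plane, started at the real point `x`: it is
parametrized by the values of a real linear fractional transform of the rational function. -/
structure IsArc (N Q : ℂ[X]) (x : ℝ) (c : ℝ → ℂ) (b : ℝ) (e : OnePoint ℂ) : Prop where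
  lift : ∃ N' Q', IsPencil N' Q' ∧ locus N' Q' = locus N Q ∧
    IsLift N' Q' (fun t => (t : ℂ)) (Iio b) c
  start : Tendsto c atBot (𝓝 (x : ℂ))
  finish : Tendsto (fun t => (c t : OnePoint ℂ)) (𝓝[<] b) (𝓝 e)
  finish_ne : e ≠ ((x : ℂ) : OnePoint ℂ)
  finish_eq : e = OnePoint.infty ∨ ∃ z : ℂ, e = z ∧ z.im = 0 ∧ (wronskian Q N).eval z = 0
  nhds : ∀ᶠ z in 𝓝 (x : ℂ), 0 < z.im → z ∈ locus N Q → z ∈ c '' Iio b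

theorem IsPencil.comb {N Q : ℂ[X]} (h : IsPencil N Q) {ε v : ℝ} (hε : ε ≠ 0) :
    IsPencil (C (ε : ℂ) * Q) (N - C (v : ℂ) * Q) := by
  refine ⟨(isRealPoly_C ε).mul h.real_den, h.real_num.sub ((isRealPoly_C v).mul h.real_den), ?_, ?_⟩
  · intro z hz hz'
    have h1 : Q.eval z = 0 := by simpa [hε] using hz
    have h2 : N.eval z = 0 := by simpa [h1] using hz'
    exact h.coprime z h2 h1
  · intro z hz
    have : (wronskian (N - C (v : ℂ) * Q) (C (ε : ℂ) * Q)).eval z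
        = -ε * (wronskian Q N).eval z := by
      simp [wronskian]; ring
    rw [this]
    exact mul_ne_zero (neg_ne_zero.2 (by exact_mod_cast hε)) (h.wronskian_ne z hz)

theorem wronskian_comb (N Q : ℂ[X]) (ε v : ℂ) :
    wronskian (N - C v * Q) (C ε * Q) = - C ε * wronskian Q N := by
  simp [wronskian]; ring

/-- A double real zero of a real polynomial splits off. -/
theorem exists_eq_sq_mul {p : ℂ[X]} (hp : IsRealPoly p) (hp0 : p ≠ 0) {x : ℝ}
    (h1 : p.eval (x : ℂ) = 0) (h2 : (derivative p).eval (x : ℂ) = 0) :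
    ∃ h, IsRealPoly h ∧ p = (X - C (x : ℂ)) ^ 2 * h := by
  have : 1 < p.rootMultiplicity (x : ℂ) :=
    (one_lt_rootMultiplicity_iff_isRoot hp0).2 ⟨h1, h2⟩
  obtain ⟨h, hh⟩ := (le_rootMultiplicity_iff hp0).1 (Nat.succ_le_of_lt this)
  refine ⟨h, ?_, hh⟩
  have h3 : ((X - C (x : ℂ)) ^ 2).map (starRingEnd ℂ) * h.map (starRingEnd ℂ) =
      (X - C (x : ℂ)) ^ 2 * h := by
    rw [← Polynomial.map_mul]
    rw [hh] at hp
    exact hp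
  simp only [Polynomial.map_pow, Polynomial.map_sub, map_X, map_C, Complex.conj_ofReal] at h3
  exact mul_left_cancel₀ (pow_ne_zero 2 (X_sub_C_ne_zero _)) h3

/-- The germ of the arc started at a simple zero of the Wronskian. -/
theorem exists_arc_germ {N Q H : ℂ[X]} (h : IsPencil N Q) {x : ℝ} (hNx : N.eval (x : ℂ) ≠ 0)
    (hQ : Q = (X - C (x : ℂ)) ^ 2 * H) (hH : IsRealPoly H)
    (hpos : 0 < (H.eval (x : ℂ) / N.eval (x : ℂ)).re) :
    ∃ T : ℝ, ∃ c : ℝ → ℂ, IsLift N Q (fun t => (t : ℂ)) (Iio T) c ∧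
      Tendsto c atBot (𝓝 (x : ℂ)) ∧
      ∀ t₁ < T, ∀ᶠ z in 𝓝 (x : ℂ), 0 < z.im → z ∈ locus N Q → z ∈ c '' Iio t₁ := by
  obtain ⟨φ, hxφ, hφx, hφ, hφim⟩ := exists_root_coordinate (k := 2) two_ne_zero (x := x)
    (h := fun z => H.eval z / N.eval z) ((H.hasStrictDerivAt _).div (N.hasStrictDerivAt _) hNx)
    (fun z => by simp [hH.eval_conj, h.real_num.eval_conj]) hpos
  have h0t : (0 : ℂ) ∈ φ.target := hφx ▸ φ.map_source hxφ
  have hsymm0 : φ.symm 0 = x := by rw [← hφx]; exact φ.left_inv hxφ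
  have hca : ContinuousAt φ.symm 0 := φ.continuousAt_symm h0t
  have hNev : ∀ᶠ z in 𝓝 (x : ℂ), N.eval z ≠ 0 := eventually_ne_eval hNx
  have hev : ∀ᶠ u in 𝓝 (0 : ℂ), u ∈ φ.target ∧ N.eval (φ.symm u) ≠ 0 := by
    refine (φ.open_target.eventually_mem h0t).and
      (hca.eventually (p := fun z => N.eval z ≠ 0) ?_)
    rwa [hsymm0]
  obtain ⟨ρ, hρ, hball⟩ := Metric.eventually_nhds_iff_ball.1 hev
  have hval : ∀ z ∈ φ.source, N.eval z ≠ 0 → φ z ^ 2 = Q.eval z / N.eval z := by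
    intro z hz hN
    rw [hφ z hz, hQ]
    simp
    ring
  -- Here φ ^ 2 = Q / N, so at φ = i y the value of N / Q is -1 / y ^ 2, which equals t for this y.
  -- The bound t < -1 / ρ ^ 2 keeps i y in the ball of radius ρ.
  set y : ℝ → ℝ := fun t => 1 / √(-t) with hy
  have hyT : ∀ t : ℝ, t < -(1 / ρ ^ 2) → 0 < y t ∧ y t < ρ ∧ (y t) ^ 2 = -1 / t := by
    intro t ht
    have hρ2 : 0 < 1 / ρ ^ 2 := by positivity
    have ht0 : 0 < -t := by linarith
    have hs : 0 < √(-t) := Real.sqrt_pos.2 ht0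
    refine ⟨by positivity, ?_, ?_⟩
    · rw [hy]; simp only
      rw [one_div_lt hs hρ]
      refine Real.lt_sqrt_of_sq_lt ?_
      rw [one_div_pow]; linarith
    · rw [hy]; simp only
      rw [one_div_pow, Real.sq_sqrt ht0.le, one_div_neg_eq_neg_one_div, neg_div]
  have hmem : ∀ t : ℝ, t < -(1 / ρ ^ 2) → ((y t : ℂ) * Complex.I) ∈ Metric.ball (0 : ℂ) ρ := by
    intro t ht
    obtain ⟨h1, h2, -⟩ := hyT t ht
    simp [abs_of_pos h1, h2]
  have hycont : ContinuousOn (fun t => (y t : ℂ) * Complex.I) (Iio (-(1 / ρ ^ 2))) := by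
    have hρ2 : 0 < 1 / ρ ^ 2 := by positivity
    have : ContinuousOn y (Iio (-(1 / ρ ^ 2))) := by
      refine continuousOn_const.div (by fun_prop) fun t ht => ?_
      have : 0 < -t := by linarith [mem_Iio.1 ht]
      exact (Real.sqrt_pos.2 this).ne'
    exact (Complex.continuous_ofReal.comp_continuousOn this).mul continuousOn_const
  have hsrc : ∀ t : ℝ, t < -(1 / ρ ^ 2) → φ.symm ((y t : ℂ) * Complex.I) ∈ φ.source ∧
      φ (φ.symm ((y t : ℂ) * Complex.I)) = (y t : ℂ) * Complex.I := fun t ht =>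
    ⟨φ.map_target (hball _ (hmem t ht)).1, φ.right_inv (hball _ (hmem t ht)).1⟩
  refine ⟨-(1 / ρ ^ 2), fun t => φ.symm ((y t : ℂ) * Complex.I), ⟨?_, ?_, ?_, ?_⟩, ?_, ?_⟩
  · exact φ.continuousOn_symm.comp hycont fun t ht => (hball _ (hmem t ht)).1
  · intro t ht
    obtain ⟨h1, h2⟩ := hsrc t ht
    rw [← hφim _ h1, h2]
    simpa using (hyT t ht).1
  · intro t ht hq
    obtain ⟨h1, h2⟩ := hsrc t ht
    have h3 := hval _ h1 (hball _ (hmem t ht)).2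
    rw [h2, hq, zero_div] at h3
    have := (hyT t ht).1.ne'
    simp [this] at h3
  · intro t ht
    obtain ⟨h1, h2⟩ := hsrc t ht
    have h3 := hval _ h1 (hball _ (hmem t ht)).2
    rw [h2] at h3
    rw [quot, ← inv_div, ← h3, mul_pow, Complex.I_sq, ← Complex.ofReal_pow, (hyT t ht).2.2]
    simp [div_neg]
  · have h1 : Tendsto y atBot (𝓝 0) := by
      refine Tendsto.div_atTop tendsto_const_nhds ?_
      exact Real.tendsto_sqrt_atTop.comp tendsto_neg_atBot_atTop
    have h2 : Tendsto (fun t => (y t : ℂ) * Complex.I) atBot (𝓝 0) := by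
      have := ((Complex.continuous_ofReal.tendsto 0).comp h1).mul_const Complex.I
      simpa using this
    have := hca.tendsto.comp h2
    rwa [hsymm0] at this
  · intro t₁ ht₁
    have ht₁0 : 0 < -t₁ := by
      have : 0 < 1 / ρ ^ 2 := by positivity
      linarith
    have hφc : Tendsto φ (𝓝 (x : ℂ)) (𝓝 0) := by
      have := (φ.continuousAt hxφ).tendsto
      rwa [hφx] at this
    have e1 : ∀ᶠ z in 𝓝 (x : ℂ), ‖φ z‖ < 1 / √(-t₁) := by
      have hp : (0 : ℝ) < 1 / √(-t₁) := by
        have := Real.sqrt_pos.2 ht₁0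
        positivity
      have := hφc (Metric.ball_mem_nhds 0 hp)
      filter_upwards [this] with z hz
      simpa using hz
    filter_upwards [e1, φ.open_source.mem_nhds hxφ, hNev] with z hz1 hz2 hz3 him hloc
    -- On the locus φ ^ 2 is real, and Im φ > 0 above the axis, so φ is purely imaginary: only one
    -- branch of the locus enters the half-plane at x.
    have h1 := (hφim z hz2).2 him
    have h2 : (φ z ^ 2).im = 0 := by
      rw [hval z hz2 hz3, im_div_eq_zero_iff hz3, ← neg_eq_zero, ← Complex.conj_im, map_mul,
        Complex.conj_conj, mul_comm]
      exact hloc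
    have hre : (φ z).re = 0 := by
      rw [sq, Complex.mul_im] at h2
      have : (φ z).re * (φ z).im = 0 := by linarith
      exact (mul_eq_zero.1 this).resolve_right h1.ne'
    have hφz : φ z = ((φ z).im : ℂ) * Complex.I := by
      apply Complex.ext <;> simp [hre]
    have hnorm : ‖φ z‖ = (φ z).im := by
      rw [hφz]; simp [abs_of_pos h1]
    set s := (φ z).im with hs
    rw [hnorm] at hz1
    have hst : -(1 / s ^ 2) < t₁ := by
      have h3 : √(-t₁) < 1 / s := by
        rwa [lt_one_div (Real.sqrt_pos.2 ht₁0) h1]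
      have h4 := (Real.sqrt_lt' (by positivity)).1 h3
      rw [one_div_pow] at h4
      linarith
    refine ⟨-(1 / s ^ 2), hst, ?_⟩
    have : y (-(1 / s ^ 2)) = s := by
      rw [hy]; simp only
      rw [neg_neg, ← one_div_pow, Real.sqrt_sq (by positivity), one_div_one_div]
    simp only [this]
    rw [← hφz]
    exact φ.left_inv hz2

/-- The germ at x starts at value -∞ and is continued as far as possible. Continuation to all values
would lift the whole line, so it stops at some finite b. It cannot return to x, where the value is
∞, and a real end point must be critical. -/
theorem exists_arc_of_double_pole {N Q H : ℂ[X]} (h : IsPencil N Q) {x : ℝ}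
    (hNx : N.eval (x : ℂ) ≠ 0)
    (hQ : Q = (X - C (x : ℂ)) ^ 2 * H) (hH : IsRealPoly H)
    (hpos : 0 < (H.eval (x : ℂ) / N.eval (x : ℂ)).re) :
    ∃ c b e, IsArc N Q x c b e := by
  obtain ⟨T, c₁, hc₁, hlim, hnhds⟩ := exists_arc_germ h hNx hQ hH hpos
  set t₁ := T - 1
  have ht₁ : t₁ < T := sub_one_lt T
  have hwc : Continuous (fun t : ℝ => (t : ℂ)) := Complex.continuous_ofReal
  rcases h.exists_maximal_lift hwc (hc₁.im_pos t₁ ht₁) (hc₁.den_ne t₁ ht₁) (hc₁.eq t₁ ht₁) with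
    ⟨c₂, hc₂, h0⟩ | ⟨b, htb, c₂, hc₂, h0, e, he, hor⟩
  · have := IsLift.union h ordConnected_Ici le_rfl self_mem_Ici ht₁ hc₁ hc₂ h0.symm
    rw [Iio_union_Ici] at this
    exact absurd this (h.not_isLift_univ _)
  · have hu := IsLift.union h ordConnected_Ico Ico_subset_Ici_self ⟨le_rfl, htb⟩ ht₁ hc₁ hc₂ h0.symm
    rw [Iio_union_Ico_eq_Iio htb.le] at hu
    set c : ℝ → ℂ := fun t => if t < t₁ then c₁ t else c₂ t with hc
    have hfin : Tendsto (fun t => (c t : OnePoint ℂ)) (𝓝[<] b) (𝓝 e) := by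
      refine he.congr' ?_
      filter_upwards [Ioo_mem_nhdsLT htb] with t ht
      simp [hc, not_lt.2 ht.1.le]
    refine ⟨c, b, e, ⟨N, Q, h, rfl, hu⟩, ?_, hfin, ?_, ?_, ?_⟩
    · refine hlim.congr' ?_
      filter_upwards [Iio_mem_atBot t₁] with t ht
      simp [hc, mem_Iio.1 ht]
    · rintro rfl
      rcases hor with h1 | ⟨z, h1, -, h2⟩
      · exact OnePoint.coe_ne_infty _ h1
      · rw [OnePoint.coe_eq_coe] at h1
        rw [← h1, hQ] at h2
        simp at h2
        exact hNx h2
    · refine hor.imp_right ?_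
      rintro ⟨z, rfl, hz, hNQ⟩
      refine ⟨z, rfl, hz, h.wronskian_eq_zero_of_limit htb hc₂ (tendsto_coe_coe_iff.1 he) hz ?_⟩
      intro h'
      rw [h', mul_zero] at hNQ
      exact h.coprime z hNQ h'
    · filter_upwards [hnhds t₁ ht₁] with z hz him hloc
      obtain ⟨t, ht, rfl⟩ := hz him hloc
      exact ⟨t, lt_trans ht htb, by simp [hc, mem_Iio.1 ht]⟩

/-- The Möbius map w ↦ a / (w - v) with v = R(x) turns the simple critical point into a double pole.
With a = H(x) / Q(x), where N - v Q = (X - x) ^ 2 H, the new quotient is a Q over (X - x) ^ 2 H, and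
the positivity condition reads 1 > 0. -/
theorem exists_arc {N Q : ℂ[X]} (h : IsPencil N Q) {x : ℝ} (hQx : Q.eval (x : ℂ) ≠ 0)
    (hW : (wronskian Q N).eval (x : ℂ) = 0) (hW' : (derivative (wronskian Q N)).eval (x : ℂ) ≠ 0) :
    ∃ c b e, IsArc N Q x c b e := by
  obtain ⟨v, hv⟩ : ∃ v : ℝ, quot N Q x = v := ⟨(quot N Q x).re, by
    apply Complex.ext
    · simp
    · simpa using h.im_quot_ofReal (z := x) (by simp)⟩
  have hNv : N.eval (x : ℂ) = v * Q.eval (x : ℂ) := by rw [← hv, quot, div_mul_cancel₀ _ hQx]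
  set p := N - C (v : ℂ) * Q with hp
  have hpr : IsRealPoly p := h.real_num.sub ((isRealPoly_C v).mul h.real_den)
  have hWp : wronskian Q p = wronskian Q N := by
    simp [hp, wronskian]; ring
  have hp0 : p.eval (x : ℂ) = 0 := by simp [hp, hNv]
  have hp1 : (derivative p).eval (x : ℂ) = 0 := by
    rw [← hWp] at hW
    simpa [wronskian, hp0, hQx] using hW
  obtain ⟨H, hH, hpH⟩ := exists_eq_sq_mul hpr (h.sub_ne_zero v) hp0 hp1
  have hHx : H.eval (x : ℂ) ≠ 0 := by
    intro h0
    apply hW'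
    rw [← hWp, hpH]
    simp [wronskian, h0, sq]
  obtain ⟨a, ha⟩ : ∃ a : ℝ, H.eval (x : ℂ) / Q.eval (x : ℂ) = a :=
    ⟨(H.eval (x : ℂ) / Q.eval (x : ℂ)).re, by
      apply Complex.ext
      · simp
      · rw [Complex.div_im, hH.im_eval, h.real_den.im_eval]; simp⟩
  have ha0 : a ≠ 0 := by
    have := div_ne_zero hHx hQx
    rw [ha] at this
    exact_mod_cast this
  obtain ⟨c, b, e, hc⟩ := exists_arc_of_double_pole (h.comb (ε := a) (v := v) ha0) (x := x) (H := H)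
    (by simp [ha0, hQx]) hpH hH (by
      simp only [eval_mul, eval_C]
      rw [div_mul_eq_div_div_swap, ha, ← Complex.ofReal_div, div_self ha0]
      simp)
  refine ⟨c, b, e, ?_, hc.start, hc.finish, hc.finish_ne, ?_, ?_⟩
  · obtain ⟨N', Q', h1, h2, h3⟩ := hc.lift
    exact ⟨N', Q', h1, h2.trans (locus_comb a v ha0), h3⟩
  · refine hc.finish_eq.imp_right ?_
    rintro ⟨z, rfl, hz, hw⟩
    refine ⟨z, rfl, hz, ?_⟩
    rw [wronskian_comb] at hw
    simpa [ha0] using hw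
  · rw [← locus_comb a v ha0]
    exact hc.nhds

variable {N Q : ℂ[X]} {x b : ℝ} {c : ℝ → ℂ} {e : OnePoint ℂ}

theorem IsArc.im_pos (h : IsArc N Q x c b e) {z : ℂ} (hz : z ∈ c '' Iio b) : 0 < z.im := by
  obtain ⟨N', Q', -, -, hl⟩ := h.lift
  obtain ⟨t, ht, rfl⟩ := hz
  exact hl.im_pos t ht

theorem IsArc.mem_locus (h : IsArc N Q x c b e) {z : ℂ} (hz : z ∈ c '' Iio b) :
    z ∈ locus N Q := by
  obtain ⟨N', Q', -, hloc, hl⟩ := h.lift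
  obtain ⟨t, ht, rfl⟩ := hz
  exact hloc ▸ hl.mem_locus ht

theorem IsArc.injOn (h : IsArc N Q x c b e) : InjOn c (Iio b) := by
  obtain ⟨N', Q', -, hloc, hl⟩ := h.lift
  intro s hs t ht hst
  have := hl.eq s hs
  rw [hst, hl.eq t ht] at this
  exact_mod_cast this.symm

theorem IsArc.continuousOn (h : IsArc N Q x c b e) : ContinuousOn c (Iio b) := by
  obtain ⟨N', Q', -, hloc, hl⟩ := h.lift
  exact hl.continuousOn

theorem IsArc.isPreconnected (h : IsArc N Q x c b e) : IsPreconnected (c '' Iio b) :=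
  isPreconnected_Iio.image _ h.continuousOn

/-- Near a point of the arc the (transformed) function is injective, so a nearby point of the locus
is the arc point with the same real value. Thus arcs are open in the locus. -/
theorem IsArc.eventually_mem (h : IsArc N Q x c b e) {z : ℂ} (hz : z ∈ c '' Iio b) :
    ∀ᶠ y in 𝓝 z, y ∈ locus N Q → y ∈ c '' Iio b := by
  obtain ⟨N', Q', hP, hloc, hl⟩ := h.lift
  obtain ⟨t, ht, rfl⟩ := hz
  obtain ⟨U, hU, hinj⟩ := injOn_quot_nhds (hl.den_ne t ht) (hP.wronskian_ne _ (hl.im_pos t ht))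
  have hre : Tendsto (fun y => (quot N' Q' y).re) (𝓝 (c t)) (𝓝 t) := by
    have h1 := (hasStrictDerivAt_quot (N := N') (hl.den_ne t ht)).hasDerivAt.continuousAt.tendsto
    have := (Complex.continuous_re.tendsto _).comp h1
    rw [hl.eq t ht] at this
    exact this
  have hct : Tendsto c (𝓝 t) (𝓝 (c t)) := (hl.continuousOn.continuousAt (Iio_mem_nhds ht)).tendsto
  filter_upwards [hU, eventually_ne_eval (hl.den_ne t ht), hre.eventually (Iio_mem_nhds ht),
    hre.eventually (hct.eventually hU)] with y hy1 hy2 hy3 hy4 hy5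
  refine ⟨(quot N' Q' y).re, hy3, hinj hy4 hy1 ?_⟩
  rw [hl.eq _ hy3]
  rw [← hloc, mem_locus_iff hy2] at hy5
  apply Complex.ext <;> simp [hy5]

/-! ### Arcs as closed paths on the sphere and as components of the locus -/

theorem tendsto_reparam_zero (b : ℝ) :
    Tendsto (fun s : ℝ => b + 1 - 1 / s) (𝓝[>] 0) atBot := by
  have h1 : Tendsto (fun s : ℝ => 1 / s) (𝓝[>] 0) atTop := by
    simpa using tendsto_inv_nhdsGT_zero (𝕜 := ℝ)
  simpa [sub_eq_add_neg] using
    tendsto_atBot_add_const_left _ (b + 1) (tendsto_neg_atTop_atBot.comp h1)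

/-- The map s ↦ b + 1 - 1 / s is the increasing bijection from (0, 1) to (-∞, b) used to parametrize
arcs by the unit interval. -/
theorem reparam_lt (b : ℝ) {s : ℝ} (hs : s ∈ Ioo (0 : ℝ) 1) : b + 1 - 1 / s < b := by
  have : 1 < 1 / s := by rw [lt_div_iff₀ hs.1]; linarith [hs.2]
  linarith

theorem tendsto_reparam_one (b : ℝ) :
    Tendsto (fun s : ℝ => b + 1 - 1 / s) (𝓝[<] 1) (𝓝[<] b) := by
  refine tendsto_nhdsWithin_iff.2 ⟨?_, ?_⟩
  · have : ContinuousAt (fun s : ℝ => b + 1 - 1 / s) 1 :=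
      continuousAt_const.sub (continuousAt_const.div continuousAt_id one_ne_zero)
    have h2 := this.tendsto
    simp only [div_one, add_sub_cancel_right] at h2
    exact h2.mono_left nhdsWithin_le_nhds
  · filter_upwards [Ioo_mem_nhdsLT (zero_lt_one' ℝ)] with s hs using reparam_lt b hs

theorem mem_Ioo_of_ne {t : unitInterval} (ht0 : t ≠ 0) (ht1 : t ≠ 1) : (t : ℝ) ∈ Ioo (0 : ℝ) 1 :=
  ⟨unitInterval.pos_iff_ne_zero.2 ht0, unitInterval.lt_one_iff_ne_one.2 ht1⟩

/-- A curve on a left half-line with limits at both ends closes up to a path. -/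
theorem exists_path_of_tendsto {X : Type*} [TopologicalSpace X] [T3Space X] {f : ℝ → X} {b : ℝ}
    {p q : X} (hf : ContinuousOn f (Iio b)) (hp : Tendsto f atBot (𝓝 p))
    (hq : Tendsto f (𝓝[<] b) (𝓝 q)) :
    ∃ γ : C(unitInterval, X), γ 0 = p ∧ γ 1 = q ∧
      ∀ t, t ≠ 0 → t ≠ 1 → γ t = f (b + 1 - 1 / (t : ℝ)) := by
  set g : ℝ → X := fun s => f (b + 1 - 1 / s) with hg
  have hτc : ContinuousOn (fun s : ℝ => b + 1 - 1 / s) (Ioo 0 1) :=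
    continuousOn_const.sub (continuousOn_const.div continuousOn_id fun s hs => hs.1.ne')
  have hgc : ContinuousOn g (Ioo 0 1) := hf.comp hτc fun s hs => reparam_lt b hs
  have h0 : Tendsto g (𝓝[>] 0) (𝓝 p) := hp.comp (tendsto_reparam_zero b)
  have h1 : Tendsto g (𝓝[<] 1) (𝓝 q) := hq.comp (tendsto_reparam_one b)
  have hec : ContinuousOn (extendFrom (Ioo (0 : ℝ) 1) g) (Icc 0 1) :=
    continuousOn_Icc_extendFrom_Ioo hgc h0 h1
  refine ⟨⟨fun t => extendFrom (Ioo (0 : ℝ) 1) g t,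
    hec.comp_continuous continuous_subtype_val fun t => t.2⟩,
    eq_lim_at_left_extendFrom_Ioo zero_lt_one h0, eq_lim_at_right_extendFrom_Ioo zero_lt_one h1,
    fun t ht0 ht1 => ?_⟩
  have hs := mem_Ioo_of_ne ht0 ht1
  exact extendFrom_eq (subset_closure hs) (hgc _ hs)

theorem IsArc.coe_ne (h : IsArc N Q x c b e) {z : ℂ} (hz : z ∈ c '' Iio b) :
    (z : OnePoint ℂ) ≠ ((x : ℂ) : OnePoint ℂ) ∧ (z : OnePoint ℂ) ≠ e := by
  have him := h.im_pos hz
  constructor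
  · intro h2
    rw [OnePoint.coe_eq_coe] at h2
    rw [h2] at him
    simp at him
  · intro h2
    rcases h.finish_eq with h3 | ⟨z, h3, hz, -⟩
    · exact OnePoint.coe_ne_infty _ (h2.trans h3)
    · rw [h3, OnePoint.coe_eq_coe] at h2
      rw [h2, hz] at him
      exact lt_irrefl _ him

/-- The arc closed up by its end points, as a path in the Riemann sphere. -/
theorem IsArc.exists_path (h : IsArc N Q x c b e) :
    ∃ γ : C(unitInterval, OnePoint ℂ), Function.Injective γ ∧ γ 0 = ((x : ℂ) : OnePoint ℂ) ∧
      γ 1 = e ∧ (∀ t, t ≠ 0 → t ≠ 1 → ∃ z ∈ c '' Iio b, γ t = (z : OnePoint ℂ)) ∧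
      ∀ z ∈ c '' Iio b, ∃ t, t ≠ 0 ∧ t ≠ 1 ∧ γ t = (z : OnePoint ℂ) := by
  obtain ⟨γ, hγ0, hγ1, hγi⟩ := exists_path_of_tendsto (f := fun t => (c t : OnePoint ℂ))
    (OnePoint.continuous_coe.comp_continuousOn h.continuousOn) (tendsto_coe_coe_iff.2 h.start)
    h.finish
  have hmem : ∀ t : unitInterval, t ≠ 0 → t ≠ 1 → c (b + 1 - 1 / (t : ℝ)) ∈ c '' Iio b :=
    fun t ht0 ht1 => mem_image_of_mem c (reparam_lt b (mem_Ioo_of_ne ht0 ht1))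
  have hbd : ∀ t, t ≠ 0 → t ≠ 1 → γ t ≠ γ 0 ∧ γ t ≠ γ 1 := by
    intro t ht0 ht1
    rw [hγi t ht0 ht1, hγ0, hγ1]
    exact h.coe_ne (hmem t ht0 ht1)
  have h01 : γ 0 ≠ γ 1 := by rw [hγ0, hγ1]; exact h.finish_ne.symm
  refine ⟨γ, ?_, hγ0, hγ1, fun t ht0 ht1 => ⟨_, hmem t ht0 ht1, hγi t ht0 ht1⟩, ?_⟩
  · intro s t hst
    by_cases hs0 : s = 0
    · by_cases ht0 : t = 0
      · rw [hs0, ht0]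
      · by_cases ht1 : t = 1
        · rw [hs0, ht1] at hst; exact absurd hst h01
        · rw [hs0] at hst; exact absurd hst.symm (hbd t ht0 ht1).1
    · by_cases hs1 : s = 1
      · by_cases ht0 : t = 0
        · rw [hs1, ht0] at hst; exact absurd hst.symm h01
        · by_cases ht1 : t = 1
          · rw [hs1, ht1]
          · rw [hs1] at hst; exact absurd hst.symm (hbd t ht0 ht1).2
      · by_cases ht0 : t = 0
        · rw [ht0] at hst; exact absurd hst (hbd s hs0 hs1).1
        · by_cases ht1 : t = 1
          · rw [ht1] at hst; exact absurd hst (hbd s hs0 hs1).2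
          · rw [hγi s hs0 hs1, hγi t ht0 ht1, OnePoint.coe_eq_coe] at hst
            have h4 := h.injOn (reparam_lt b (mem_Ioo_of_ne hs0 hs1))
              (reparam_lt b (mem_Ioo_of_ne ht0 ht1)) hst
            simp only [one_div, sub_right_inj, inv_inj] at h4
            exact Subtype.ext h4
  · rintro _ ⟨u, hu, rfl⟩
    have hu' : 1 < b + 1 - u := by linarith [mem_Iio.1 hu]
    have hs0 : 0 < 1 / (b + 1 - u) := by positivity
    have hs1 : 1 / (b + 1 - u) < 1 := by rw [div_lt_one (by linarith)]; exact hu'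
    have hs0' : (⟨1 / (b + 1 - u), hs0.le, hs1.le⟩ : unitInterval) ≠ 0 :=
      unitInterval.pos_iff_ne_zero.1 hs0
    have hs1' : (⟨1 / (b + 1 - u), hs0.le, hs1.le⟩ : unitInterval) ≠ 1 :=
      unitInterval.lt_one_iff_ne_one.1 hs1
    refine ⟨_, hs0', hs1', ?_⟩
    rw [hγi _ hs0' hs1']
    simp

/-- The closed-up path has compact, hence closed, image on the sphere, so the closure adds only its
two end points. -/
theorem IsArc.closure_subset (h : IsArc N Q x c b e) {z : ℂ} (hz : z ∈ closure (c '' Iio b)) :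
    z ∈ c '' Iio b ∨ z = x ∨ e = z := by
  obtain ⟨γ, -, h0, h1, hi, hs⟩ := h.exists_path
  have hcl : IsClosed (range γ) := (isCompact_range γ.continuous).isClosed
  have hcl' : IsClosed {y : ℂ | (y : OnePoint ℂ) ∈ range γ} := hcl.preimage OnePoint.continuous_coe
  have hsub : c '' Iio b ⊆ {y : ℂ | (y : OnePoint ℂ) ∈ range γ} := by
    intro y hy
    obtain ⟨t, -, -, ht⟩ := hs y hy
    exact ⟨t, ht⟩
  obtain ⟨t, ht⟩ := hcl'.closure_subset_iff.2 hsub hz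
  by_cases ht0 : t = 0
  · rw [ht0, h0, OnePoint.coe_eq_coe] at ht
    exact Or.inr (Or.inl ht.symm)
  · by_cases ht1 : t = 1
    · rw [ht1, h1] at ht
      exact Or.inr (Or.inr ht)
    · obtain ⟨y, hy, hty⟩ := hi t ht0 ht1
      rw [hty, OnePoint.coe_eq_coe] at ht
      exact Or.inl (ht ▸ hy)

theorem IsArc.mem_of_mem_closure (h : IsArc N Q x c b e) {z : ℂ} (hz : z ∈ closure (c '' Iio b))
    (him : 0 < z.im) : z ∈ c '' Iio b := by
  rcases h.closure_subset hz with h1 | h1 | h1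
  · exact h1
  · rw [h1] at him; simp at him
  · exfalso
    rcases h.finish_eq with h2 | ⟨y, h2, hy, -⟩
    · exact OnePoint.coe_ne_infty _ (h1.symm.trans h2)
    · rw [h2, OnePoint.coe_eq_coe] at h1
      rw [← h1, hy] at him
      exact lt_irrefl _ him

/-- Arcs are maximal connected subsets of the real locus in the upper half-plane. -/
theorem IsArc.subset_of_isPreconnected (h : IsArc N Q x c b e) {S : Set ℂ} (hS : IsPreconnected S)
    (hSim : ∀ z ∈ S, 0 < z.im) (hSloc : S ⊆ locus N Q) {z : ℂ} (hzS : z ∈ S)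
    (hz : z ∈ c '' Iio b) : S ⊆ c '' Iio b := by
  have : PreconnectedSpace S := isPreconnected_iff_preconnectedSpace.1 hS
  -- Closed, because the closure of the arc adds no point of the open half-plane; open, because
  -- nearby locus points lie on the arc.
  have hcl : IsClopen {y : S | (y : ℂ) ∈ c '' Iio b} := by
    constructor
    · rw [← closure_subset_iff_isClosed]
      intro y hy
      refine h.mem_of_mem_closure ?_ (hSim y y.2)
      exact closure_mono (image_preimage_subset Subtype.val (c '' Iio b))
        (image_closure_subset_closure_image continuous_subtype_val ⟨y, hy, rfl⟩)
    · rw [isOpen_iff_mem_nhds]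
      intro y hy
      filter_upwards [continuous_subtype_val.continuousAt.eventually (h.eventually_mem hy)]
        with u hu using hu (hSloc u.2)
  intro y hy
  have h2 := hcl.eq_univ ⟨⟨z, hzS⟩, hz⟩
  exact (h2 ▸ mem_univ (⟨y, hy⟩ : S) : (⟨y, hy⟩ : S) ∈ {y : S | (y : ℂ) ∈ c '' Iio b})

theorem IsArc.mem_closure_start (h : IsArc N Q x c b e) : (x : ℂ) ∈ closure (c '' Iio b) :=
  mem_closure_of_tendsto h.start ((eventually_lt_atBot b).mono fun _ ht => mem_image_of_mem c ht)

theorem IsArc.image_eq {x' b' : ℝ} {c' : ℝ → ℂ} {e' : OnePoint ℂ} (h : IsArc N Q x c b e)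
    (h' : IsArc N Q x' c' b' e') {z : ℂ} (hz : z ∈ c '' Iio b) (hz' : z ∈ c' '' Iio b') :
    c '' Iio b = c' '' Iio b' :=
  Subset.antisymm
    (h'.subset_of_isPreconnected h.isPreconnected (fun _ => h.im_pos) (fun _ => h.mem_locus) hz hz')
    (h.subset_of_isPreconnected h'.isPreconnected (fun _ => h'.im_pos) (fun _ => h'.mem_locus) hz' hz)

/-- Two arcs with different starting points that meet are opposite to each other. -/
theorem IsArc.finish_eq_start {x' b' : ℝ} {c' : ℝ → ℂ} {e' : OnePoint ℂ} (h : IsArc N Q x c b e)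
    (h' : IsArc N Q x' c' b' e') {z : ℂ} (hz : z ∈ c '' Iio b) (hz' : z ∈ c' '' Iio b')
    (hne : x ≠ x') : e' = ((x : ℂ) : OnePoint ℂ) := by
  have h1 := h.mem_closure_start
  rw [h.image_eq h' hz hz'] at h1
  rcases h'.closure_subset h1 with h2 | h2 | h2
  · have := h'.im_pos h2
    simp at this
  · exact absurd (by exact_mod_cast h2) hne
  · exact h2

theorem IsArc.exists_mem_of_tendsto (h : IsArc N Q x c b e) {α : Type*} {l : Filter α} [l.NeBot]
    {f : α → ℂ} (hf : Tendsto f l (𝓝 (x : ℂ)))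
    (hfl : ∀ᶠ t in l, 0 < (f t).im ∧ f t ∈ locus N Q) : ∃ᶠ t in l, f t ∈ c '' Iio b := by
  refine Eventually.frequently ?_
  filter_upwards [hf.eventually h.nhds, hfl] with t h1 h2 using h1 h2.1 h2.2

/-- An arc that ends at the starting point of another one meets it. -/
theorem IsArc.exists_mem_of_finish_eq {x' b' : ℝ} {c' : ℝ → ℂ} {e' : OnePoint ℂ}
    (h : IsArc N Q x c b e) (h' : IsArc N Q x' c' b' e') (he : e = ((x' : ℂ) : OnePoint ℂ)) :
    ∃ z, z ∈ c '' Iio b ∧ z ∈ c' '' Iio b' := by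
  have hl : Tendsto c (𝓝[<] b) (𝓝 (x' : ℂ)) := tendsto_coe_coe_iff.1 (he ▸ h.finish)
  have hm : ∀ᶠ t in 𝓝[<] b, c t ∈ c '' Iio b := by
    filter_upwards [self_mem_nhdsWithin] with t ht using mem_image_of_mem c ht
  obtain ⟨t, h1, h2⟩ := ((h'.exists_mem_of_tendsto hl
    (hm.mono fun t ht => ⟨h.im_pos ht, h.mem_locus ht⟩)).and_eventually hm).exists
  exact ⟨c t, h2, h1⟩

/-- Near x the locus above the axis is covered by the arc, so a lift tending to x meets the arc;
connectedness then puts the whole lift on it. -/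
theorem IsArc.mem_of_limit {N Q N' Q' : ℂ[X]} {x b : ℝ} {c : ℝ → ℂ} {e : OnePoint ℂ}
    (h : IsArc N Q x c b e) (hloc : locus N' Q' = locus N Q) {a β : ℝ} {d : ℝ → ℂ}
    (hβ : a < β) (hd : IsLift N' Q' (fun t => (t : ℂ)) (Ico a β) d)
    (hlim : Tendsto d (𝓝[<] β) (𝓝 (x : ℂ))) : d a ∈ c '' Iio b := by
  have hm : ∀ᶠ t in 𝓝[<] β, t ∈ Ico a β := Ico_mem_nhdsLT hβ
  have hloc' : ∀ t ∈ Ico a β, d t ∈ locus N Q := fun t ht => hloc ▸ hd.mem_locus ht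
  obtain ⟨t, h1, h2⟩ := ((h.exists_mem_of_tendsto hlim
    (hm.mono fun t ht => ⟨hd.im_pos t ht, hloc' t ht⟩)).and_eventually hm).exists
  refine h.subset_of_isPreconnected (S := d '' Ico a β) (isPreconnected_Ico.image _ hd.continuousOn)
    ?_ ?_ (mem_image_of_mem d h2) h1 (mem_image_of_mem d ⟨le_rfl, hβ⟩)
  · rintro _ ⟨u, hu, rfl⟩; exact hd.im_pos u hu
  · rintro _ ⟨u, hu, rfl⟩; exact hloc' u hu

/-! ### The arcs cover the real locus -/

section Cover

variable {ι : Type*} {N Q : ℂ[X]} {x b : ι → ℝ} {c : ι → ℝ → ℂ} {e : ι → OnePoint ℂ}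

/-- The locus is followed from z in the direction of increasing values. It cannot run to ∞ at a
finite value, since deg N > deg Q makes ∞ a pole; if it stops, it stops at a critical point, whose
arc contains z. -/
theorem exists_full_lift_or_mem_arc (harc : ∀ j, IsArc N Q (x j) (c j) (b j) (e j))
    {N' Q' : ℂ[X]} (h : IsPencil N' Q') (hloc : locus N' Q' = locus N Q)
    (hW : ∀ z : ℂ, (wronskian Q' N').eval z = 0 → ∃ j, z = x j)
    (hdeg : Q'.natDegree < N'.natDegree) {z : ℂ} (him : 0 < z.im) (hQ : Q'.eval z ≠ 0) {a : ℝ}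
    (ha : quot N' Q' z = a) :
    (∃ d, IsLift N' Q' (fun t => (t : ℂ)) (Ici a) d ∧ d a = z) ∨ ∃ j, z ∈ c j '' Iio (b j) := by
  rcases h.exists_maximal_lift Complex.continuous_ofReal him hQ ha with
    h1 | ⟨β, hβ, d, hd, hda, e, he, rfl | ⟨y, rfl, hy, hNQ⟩⟩
  · exact Or.inl h1
  · exfalso
    have := coeff_eq_of_tendsto_cobounded le_rfl hdeg.le (tendsto_coe_infty_iff.1 he)
      (Complex.continuous_ofReal.continuousAt.tendsto.mono_left nhdsWithin_le_nhds)
      (by filter_upwards [Ico_mem_nhdsLT hβ] with t ht using hd.eval_eq ht)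
    rw [coeff_eq_zero_of_natDegree_lt hdeg, mul_zero, coeff_natDegree, leadingCoeff_eq_zero] at this
    exact h.num_ne_zero this
  · right
    have hlim := tendsto_coe_coe_iff.1 he
    obtain ⟨j, rfl⟩ := hW y (h.wronskian_eq_zero_of_limit hβ hd hlim hy (by
      intro h'
      rw [h', mul_zero] at hNQ
      exact h.coprime y hNQ h'))
    exact ⟨j, hda ▸ (harc j).mem_of_limit hloc hβ hd hlim⟩

theorem IsPencil.neg {N Q : ℂ[X]} (h : IsPencil N Q) : IsPencil (-N) Q := by
  refine ⟨h.real_num.neg, h.real_den, fun z hz => h.coprime z (by simpa using hz), fun z hz => ?_⟩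
  have : (wronskian Q (-N)).eval z = -(wronskian Q N).eval z := by simp [wronskian]; ring
  rw [this]
  exact neg_ne_zero.2 (h.wronskian_ne z hz)

theorem locus_neg (N Q : ℂ[X]) : locus (-N) Q = locus N Q := by
  ext z
  simp only [locus, mem_ofPred_eq, eval_neg, neg_mul, Complex.neg_im, neg_eq_zero]

theorem IsLift.comp_neg {N Q : ℂ[X]} {a : ℝ} {f : ℝ → ℂ}
    (hf : IsLift (-N) Q (fun t => (t : ℂ)) (Ici (-a)) f) :
    IsLift N Q (fun t => (t : ℂ)) (Iic a) (fun t => f (-t)) := by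
  have hmem : ∀ t ∈ Iic a, -t ∈ Ici (-a) := fun t ht => mem_Ici.2 (neg_le_neg (mem_Iic.1 ht))
  refine ⟨hf.continuousOn.comp continuous_neg.continuousOn hmem,
    fun t ht => hf.im_pos _ (hmem t ht), fun t ht => hf.den_ne _ (hmem t ht), fun t ht => ?_⟩
  have := hf.eq _ (hmem t ht)
  rw [quot, eval_neg, neg_div] at this
  rw [quot, neg_eq_iff_eq_neg.1 this]
  simp

theorem IsPencil.not_full_lifts {N Q : ℂ[X]} (h : IsPencil N Q) {a a' : ℝ} {d f : ℝ → ℂ}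
    (haa : a < a') (hd : IsLift N Q (fun t => (t : ℂ)) (Ici a) d)
    (hf : IsLift N Q (fun t => (t : ℂ)) (Iic a') f) (hfd : f a' = d a') : False := by
  have hag : EqOn f d (Icc a a') :=
    IsLift.eqOn h isPreconnected_Icc (hf.mono Icc_subset_Iic_self) (hd.mono Icc_subset_Ici_self)
      ⟨haa.le, le_rfl⟩ hfd
  have := IsLift.union h ordConnected_Ici le_rfl self_mem_Ici haa
    (hf.mono Iio_subset_Iic_self) hd (hag ⟨le_rfl, haa.le⟩)
  rw [Iio_union_Ici] at this
  exact h.not_isLift_univ _ this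

/-- The locus is followed both ways, with -N in place of N for decreasing values. If neither
direction reaches a growth point, the two lifts glue to one over all of ℝ, which is impossible. -/
theorem IsPencil.mem_arc_of_den_ne (h : IsPencil N Q)
    (harc : ∀ j, IsArc N Q (x j) (c j) (b j) (e j))
    (hW : ∀ z : ℂ, (wronskian Q N).eval z = 0 → ∃ j, z = x j)
    (hdeg : Q.natDegree < N.natDegree) {z : ℂ} (him : 0 < z.im) (hloc : z ∈ locus N Q)
    (hQ : Q.eval z ≠ 0) : ∃ j, z ∈ c j '' Iio (b j) := by
  obtain ⟨a, ha⟩ : ∃ a : ℝ, quot N Q z = a := ⟨(quot N Q z).re, by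
    apply Complex.ext
    · simp
    · simpa using (mem_locus_iff hQ).1 hloc⟩
  rcases exists_full_lift_or_mem_arc harc h rfl hW hdeg him hQ ha with ⟨d, hd, hda⟩ | h1
  swap
  · exact h1
  -- The backward lift starts at the later value a', so that the two lifts overlap on [a, a'] and
  -- can be glued.
  obtain ⟨a', haa⟩ : ∃ a', a < a' := ⟨a + 1, lt_add_one a⟩
  have h1a : a' ∈ Ici a := haa.le
  have hWn : ∀ z : ℂ, (wronskian Q (-N)).eval z = -(wronskian Q N).eval z := fun z => by
    simp [wronskian]; ring
  have hW' : ∀ z : ℂ, (wronskian Q (-N)).eval z = 0 → ∃ j, z = x j := fun z hz =>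
    hW z (by rwa [hWn, neg_eq_zero] at hz)
  have hq : quot (-N) Q (d a') = ((-a' : ℝ) : ℂ) := by
    rw [quot, eval_neg, neg_div, Complex.ofReal_neg, neg_inj]
    exact hd.eq _ h1a
  have hdeg' : Q.natDegree < (-N).natDegree := by rwa [natDegree_neg]
  rcases exists_full_lift_or_mem_arc harc h.neg (locus_neg N Q) hW' hdeg' (hd.im_pos _ h1a)
    (hd.den_ne _ h1a) hq with ⟨f, hf, hfa⟩ | ⟨j, hj⟩
  · exact (h.not_full_lifts haa hd hf.comp_neg hfa).elim
  · refine ⟨j, (harc j).subset_of_isPreconnected (S := d '' Ici a)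
      (isPreconnected_Ici.image _ hd.continuousOn) ?_ ?_ (mem_image_of_mem d h1a) hj
      (hda ▸ mem_image_of_mem d self_mem_Ici)⟩
    · rintro _ ⟨u, hu, rfl⟩; exact hd.im_pos u hu
    · rintro _ ⟨u, hu, rfl⟩; exact hd.mem_locus hu

/-- The arcs started at the critical points cover the real locus in the upper half-plane. -/
theorem IsPencil.mem_arc (h : IsPencil N Q)
    (harc : ∀ j, IsArc N Q (x j) (c j) (b j) (e j))
    (hW : ∀ z : ℂ, (wronskian Q N).eval z = 0 → ∃ j, z = x j)
    (hdeg : Q.natDegree < N.natDegree) {z : ℂ} (him : 0 < z.im) (hloc : z ∈ locus N Q) :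
    ∃ j, z ∈ c j '' Iio (b j) := by
  by_cases hQ : Q.eval z = 0
  swap
  · exact h.mem_arc_of_den_ne harc hW hdeg him hloc hQ
  have hN : N.eval z ≠ 0 := fun h' => h.coprime z h' hQ
  -- At a pole the locus is followed with Q / N, which vanishes there. The nearby point with value δ
  -- / 2 is not a pole, and the arc through it contains the pole by connectedness.
  have hP := h.comb (ε := 1) (v := 0) one_ne_zero
  have hPloc := locus_comb (N := N) (Q := Q) 1 0 one_ne_zero
  obtain ⟨δ, hδ, d, hd, hd0⟩ := hP.exists_local_lift Complex.continuous_ofReal him (by simpa using hN)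
    (t₀ := 0) (by simp [quot, hQ])
  have hm : δ / 2 ∈ Ioo (0 - δ) (0 + δ) := ⟨by linarith, by linarith⟩
  have hm0 : (0 : ℝ) ∈ Ioo (0 - δ) (0 + δ) := ⟨by linarith, by linarith⟩
  have hdloc : ∀ t ∈ Ioo (0 - δ) (0 + δ), d t ∈ locus N Q := fun t ht => hPloc ▸ hd.mem_locus ht
  obtain ⟨j, hj⟩ := h.mem_arc_of_den_ne harc hW hdeg (hd.im_pos _ hm) (hdloc _ hm) (by
    intro h0
    have h2 : ((δ / 2 : ℝ) : ℂ) = 0 := by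
      rw [← hd.eq _ hm]
      simp [quot, h0]
    linarith [Complex.ofReal_eq_zero.1 h2])
  refine ⟨j, (harc j).subset_of_isPreconnected (S := d '' Ioo (0 - δ) (0 + δ))
    (isPreconnected_Ioo.image _ hd.continuousOn) ?_ ?_ (mem_image_of_mem d hm) hj
    (hd0 ▸ mem_image_of_mem d hm0)⟩
  · rintro _ ⟨u, hu, rfl⟩; exact hd.im_pos u hu
  · rintro _ ⟨u, hu, rfl⟩; exact hdloc u hu

end Cover

/-! ### The real locus near infinity -/

theorem neg_inv_im_pos {z : ℂ} : 0 < (-z⁻¹).im ↔ 0 < z.im := by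
  rw [Complex.neg_im, Complex.inv_im]
  by_cases hz : z = 0
  · simp [hz]
  · have : 0 < Complex.normSq z := Complex.normSq_pos.2 hz
    rw [neg_div, neg_neg, div_pos_iff_of_pos_right this]

/-- A coordinate at infinity in which the real locus is given by `Im (u ^ k) = 0`. -/
theorem IsPencil.exists_coordinate_infty {N Q : ℂ[X]} (h : IsPencil N Q) {k : ℕ} (hk : k ≠ 0)
    (hdeg : N.natDegree = Q.natDegree + k) :
    ∃ ρ > 0, ∃ Φ Ψ : ℂ → ℂ,
      (∀ u : ℂ, ‖u‖ < ρ → 0 < u.im → ContinuousAt Ψ u ∧ 0 < (Ψ u).im ∧ Φ (Ψ u) = u ∧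
        (Ψ u ∈ locus N Q ↔ (u ^ k).im = 0)) ∧
      Tendsto Ψ (𝓝[≠] 0) (Bornology.cobounded ℂ) ∧
      ∀ᶠ z in Bornology.cobounded ℂ, 0 < z.im →
        ContinuousAt Φ z ∧ ‖Φ z‖ < ρ ∧ 0 < (Φ z).im ∧ Ψ (Φ z) = z := by
  set a : ℂ := N.leadingCoeff / Q.leadingCoeff with ha
  have hNl : N.leadingCoeff ≠ 0 := leadingCoeff_ne_zero.2 h.num_ne_zero
  have hQl : Q.leadingCoeff ≠ 0 := leadingCoeff_ne_zero.2 h.den_ne_zero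
  obtain ⟨a', ha'⟩ : ∃ a' : ℝ, a = a' := ⟨a.re, by
    apply Complex.ext
    · simp
    · rw [ha, Complex.div_im, leadingCoeff, leadingCoeff, h.real_num.im_coeff, h.real_den.im_coeff]
      simp⟩
  have ha'0 : a' ≠ 0 := by
    have := div_ne_zero hNl hQl
    rw [← ha, ha'] at this
    exact_mod_cast this
  set Nr := N.reflect N.natDegree with hNr
  set Qr := Q.reflect Q.natDegree with hQr
  have hNr0 : Nr.eval 0 = N.leadingCoeff := by rw [hNr, eval_zero_reflect]; rfl
  have hQr0 : Qr.eval 0 = Q.leadingCoeff := by rw [hQr, eval_zero_reflect]; rfl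
  have hNrr : IsRealPoly Nr := by
    have := h.real_num
    simp only [IsRealPoly] at this ⊢
    rw [hNr, ← reflect_map, this]
  have hQrr : IsRealPoly Qr := by
    have := h.real_den
    simp only [IsRealPoly] at this ⊢
    rw [hQr, ← reflect_map, this]
  -- The variable ζ = -1 / z preserves the upper half-plane, and ζ ^ k f(ζ) = (-1) ^ k a' Q(z) /
  -- N(z). The factor a', the ratio of leading coefficients, normalizes f(0) = 1, so the root
  -- coordinate applies and its k-th power is real exactly on the locus.
  set f : ℂ → ℂ := fun ζ => a' * (Qr.eval (-ζ) / Nr.eval (-ζ)) with hf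
  have hfd : HasStrictDerivAt f (deriv f 0) 0 := by
    have : AnalyticAt ℂ f 0 := by
      refine analyticAt_const.mul (AnalyticAt.div ?_ ?_ ?_)
      · exact AnalyticAt.aeval_polynomial (analyticAt_id.neg) Qr
      · exact AnalyticAt.aeval_polynomial (analyticAt_id.neg) Nr
      · simpa [hNr0] using h.num_ne_zero
    exact this.hasStrictDerivAt
  have hf0 : f 0 = 1 := by
    simp only [hf, neg_zero, hNr0, hQr0, ← ha', ha]
    field_simp
  obtain ⟨φ, h0φ, hφ0, hφ, hφim⟩ := exists_root_coordinate hk (x := 0) (h := f) (h' := deriv f 0)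
    (by simpa using hfd) (by
      intro z
      simp only [hf, map_mul, map_div₀, Complex.conj_ofReal, ← map_neg, hNrr.eval_conj,
        hQrr.eval_conj]) (by simp [hf0])
  rw [Complex.ofReal_zero] at h0φ hφ0
  have hval : ∀ z : ℂ, z ≠ 0 → N.eval z ≠ 0 → -z⁻¹ ∈ φ.source →
      φ (-z⁻¹) ^ k = ((a' * (-1) ^ k : ℝ) : ℂ) * (Q.eval z / N.eval z) := by
    intro z hz hN hs
    rw [hφ _ hs, eval_eq_reflect (le_refl Q.natDegree) hz, eval_eq_reflect (le_refl N.natDegree) hz,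
      hdeg, ← hQr]
    simp only [hf, neg_neg]
    rw [← hdeg, ← hNr, hdeg, pow_add]
    have hzd : z ^ Q.natDegree ≠ 0 := pow_ne_zero _ hz
    have hzk : z ^ k ≠ 0 := pow_ne_zero _ hz
    have hNz : Nr.eval z⁻¹ ≠ 0 := by
      intro h0
      rw [eval_eq_reflect (le_refl N.natDegree) hz, ← hNr, h0, zero_mul] at hN
      exact hN rfl
    have : (-z⁻¹ - ((0 : ℝ) : ℂ)) ^ k = (-1) ^ k / z ^ k := by
      rw [Complex.ofReal_zero, sub_zero, neg_pow, inv_pow, div_eq_mul_inv]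
    rw [this]
    push_cast
    field_simp
  have hloc : ∀ z : ℂ, z ≠ 0 → N.eval z ≠ 0 → -z⁻¹ ∈ φ.source →
      (z ∈ locus N Q ↔ (φ (-z⁻¹) ^ k).im = 0) := by
    intro z hz hN hs
    rw [hval z hz hN hs, Complex.im_ofReal_mul]
    have h1 : a' * (-1) ^ k ≠ 0 := mul_ne_zero ha'0 (pow_ne_zero _ (by norm_num))
    rw [mul_eq_zero, or_iff_right h1, im_div_eq_zero_iff hN, ← neg_eq_zero (a := (_ * _ : ℂ).im),
      ← Complex.conj_im, map_mul, Complex.conj_conj, mul_comm]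
    rfl
  have h0t : (0 : ℂ) ∈ φ.target := hφ0 ▸ φ.map_source h0φ
  have hsymm0 : φ.symm 0 = 0 := by
    conv_lhs => rw [← hφ0]
    exact φ.left_inv h0φ
  have hNev : ∀ᶠ z in Bornology.cobounded ℂ, N.eval z ≠ 0 := by
    have hfin : Bornology.IsBounded {z | N.eval z = 0} :=
      (finite_setOfPred_isRoot h.num_ne_zero).isBounded
    exact hfin
  have hNev' : ∀ᶠ ζ in 𝓝[≠] (0 : ℂ), N.eval (-ζ⁻¹) ≠ 0 := by
    have := tendsto_neg_cobounded.comp (tendsto_inv₀_nhdsNE_zero (α := ℂ))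
    exact this.eventually hNev
  rw [eventually_nhdsWithin_iff] at hNev'
  have hca : Tendsto φ.symm (𝓝 0) (𝓝 0) := by
    have := (φ.continuousAt_symm h0t).tendsto
    rwa [hsymm0] at this
  obtain ⟨ρ, hρ, hball⟩ := Metric.eventually_nhds_iff_ball.1
    ((φ.open_target.eventually_mem h0t).and (hca.eventually hNev'))
  have hinv : ∀ z : ℂ, -(-z⁻¹)⁻¹ = z := fun z => by rw [inv_neg, neg_neg, inv_inv]
  refine ⟨ρ, hρ, fun z => φ (-z⁻¹), fun u => -(φ.symm u)⁻¹, ?_, ?_, ?_⟩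
  · intro u hu him
    obtain ⟨h1, h2⟩ := hball u (by simpa using hu)
    have hs := φ.map_target h1
    have hui : 0 < (φ.symm u).im := by
      rw [← hφim _ hs, φ.right_inv h1]; exact him
    have hne : φ.symm u ≠ 0 := fun h0 => by simp [h0] at hui
    have hΨim : 0 < (-(φ.symm u)⁻¹).im := neg_inv_im_pos.2 hui
    have h3 : -(-(φ.symm u)⁻¹)⁻¹ = φ.symm u := hinv _
    refine ⟨((φ.continuousAt_symm h1).inv₀ hne).neg, hΨim, ?_, ?_⟩
    · simp only [h3]; exact φ.right_inv h1
    · rw [hloc _ (neg_ne_zero.2 (inv_ne_zero hne)) (h2 hne) (by rw [h3]; exact hs), h3,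
        φ.right_inv h1]
  · have h1 : Tendsto φ.symm (𝓝[≠] 0) (𝓝[≠] 0) := by
      refine tendsto_nhdsWithin_iff.2 ⟨hca.mono_left nhdsWithin_le_nhds, ?_⟩
      filter_upwards [self_mem_nhdsWithin, mem_nhdsWithin_of_mem_nhds
        (φ.open_target.mem_nhds h0t)] with u hu hut h0
      apply hu
      have h0 : φ.symm u = 0 := h0
      have := φ.right_inv hut
      rw [h0, hφ0] at this
      exact this.symm
    exact tendsto_neg_cobounded.comp ((tendsto_inv₀_nhdsNE_zero (α := ℂ)).comp h1)
  · have h1 : Tendsto (fun z : ℂ => -z⁻¹) (Bornology.cobounded ℂ) (𝓝 0) := by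
      simpa using (tendsto_inv₀_cobounded (α := ℂ)).neg
    have h2 : Tendsto φ (𝓝 0) (𝓝 0) := by
      have := (φ.continuousAt h0φ).tendsto
      rwa [hφ0] at this
    filter_upwards [h1.eventually (φ.open_source.eventually_mem h0φ),
      (h2.comp h1).eventually (Metric.ball_mem_nhds 0 hρ)] with z hz1 hz2 him
    have hz0 : z ≠ 0 := fun h0 => by simp [h0] at him
    refine ⟨ContinuousAt.comp (f := fun z : ℂ => -z⁻¹) (φ.continuousAt hz1)
      (continuousAt_inv₀ hz0).neg, by simpa using hz2,
      (hφim _ hz1).2 (neg_inv_im_pos.2 him), ?_⟩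
    rw [φ.left_inv hz1, hinv]

/-- The directions `u` in the upper half-plane along which `u ^ k` is real. -/
def rayDirections (k : ℕ) : Set ℂ := {u | ‖u‖ = 1 ∧ 0 < u.im ∧ (u ^ k).im = 0}

theorem rayDirections_eq_image {k : ℕ} (hk : k ≠ 0) :
    rayDirections k =
      (fun j : ℕ => Complex.exp ((Real.pi * j / k : ℝ) * Complex.I)) '' (Finset.Ioo 0 k : Set ℕ) := by
  have hk' : (0 : ℝ) < k := by exact_mod_cast Nat.pos_of_ne_zero hk
  have hkC : (k : ℂ) ≠ 0 := by exact_mod_cast hk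
  ext u
  constructor
  · rintro ⟨h1, h2, h3⟩
    have hu : u = Complex.exp (u.arg * Complex.I) := by
      conv_lhs => rw [← Complex.norm_mul_exp_arg_mul_I u, h1]
      simp
    have ha0 : 0 < u.arg := by
      rcases (Complex.arg_nonneg_iff.2 h2.le).lt_or_eq with h | h
      · exact h
      · have := Complex.arg_eq_zero_iff.1 h.symm
        exact absurd this.2 h2.ne'
    have haπ : u.arg < Real.pi := Complex.arg_lt_pi_iff.2 (Or.inr h2.ne')
    have hs : Real.sin (k * u.arg) = 0 := by
      rw [hu, ← Complex.exp_nat_mul, ← mul_assoc, ← Complex.ofReal_natCast, ← Complex.ofReal_mul,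
        Complex.exp_ofReal_mul_I_im] at h3
      exact h3
    obtain ⟨i, hi⟩ := Real.sin_eq_zero_iff.1 hs
    have hi0 : 0 < i := by
      have : 0 < (i : ℝ) * Real.pi := by rw [hi]; positivity
      exact_mod_cast (pos_iff_pos_of_mul_pos this).2 Real.pi_pos
    lift i to ℕ using hi0.le
    have hik : i < k := by
      have : (i : ℝ) * Real.pi < k * Real.pi := by
        have h5 := mul_lt_mul_of_pos_left haπ hk'
        have h6 : ((i : ℤ) : ℝ) * Real.pi = i * Real.pi := by push_cast; ring
        linarith
      exact_mod_cast lt_of_mul_lt_mul_right this Real.pi_pos.le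
    refine ⟨i, by simpa using ⟨by exact_mod_cast hi0, hik⟩, ?_⟩
    have : Real.pi * i / k = u.arg := by
      rw [div_eq_iff hk'.ne']
      push_cast at hi
      linarith
    simp only
    rw [this, ← hu]
  · rintro ⟨j, hj, rfl⟩
    rw [Finset.coe_Ioo, mem_Ioo] at hj
    have hj0 : (0 : ℝ) < j := by exact_mod_cast hj.1
    have hjk : (j : ℝ) < k := by exact_mod_cast hj.2
    refine ⟨Complex.norm_exp_ofReal_mul_I _, ?_, ?_⟩
    · simp only
      rw [Complex.exp_ofReal_mul_I_im]
      apply Real.sin_pos_of_pos_of_lt_pi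
      · have := Real.pi_pos; positivity
      · rw [div_lt_iff₀ hk']; exact mul_lt_mul_of_pos_left hjk Real.pi_pos
    · simp only
      rw [← Complex.exp_nat_mul, ← mul_assoc, ← Complex.ofReal_natCast, ← Complex.ofReal_mul,
        Complex.exp_ofReal_mul_I_im]
      have : (k : ℝ) * (Real.pi * j / k) = j * Real.pi := by field_simp
      rw [this, Real.sin_nat_mul_pi]

theorem finite_rayDirections {k : ℕ} (hk : k ≠ 0) : (rayDirections k).Finite := by
  rw [rayDirections_eq_image hk]
  exact (Finset.finite_toSet _).image _

theorem ncard_rayDirections {k : ℕ} (hk : k ≠ 0) : (rayDirections k).ncard = k - 1 := by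
  have hk' : (0 : ℝ) < k := by exact_mod_cast Nat.pos_of_ne_zero hk
  rw [rayDirections_eq_image hk, InjOn.ncard_image, ncard_coe_finset]
  · simp
  · intro i hi j hj hij
    rw [Finset.coe_Ioo, mem_Ioo] at hi hj
    have hmem : ∀ l : ℕ, 0 < l → l < k → (Real.pi * l / k) ∈ Icc (0 : ℝ) Real.pi := by
      intro l hl0 hlk
      have hlk' : (l : ℝ) ≤ k := by exact_mod_cast hlk.le
      have := Real.pi_pos
      refine ⟨by positivity, ?_⟩
      rw [div_le_iff₀ hk']
      exact mul_le_mul_of_nonneg_left hlk' this.le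
    have h1 := congrArg Complex.re hij
    simp only [Complex.exp_ofReal_mul_I_re] at h1
    have h2 := Real.injOn_cos (hmem i hi.1 hi.2) (hmem j hj.1 hj.2) h1
    have h3 : Real.pi * i = Real.pi * j := by
      field_simp at h2
      rw [h2]
    exact_mod_cast mul_left_cancel₀ Real.pi_pos.ne' h3

/-! ### Counting the arcs that end at infinity -/

section Count

variable {n : ℕ} {N Q : ℂ[X]} {x b : Fin n → ℝ} {c : Fin n → ℝ → ℂ} {e : Fin n → OnePoint ℂ}

/-- Close to infinity, an arc that ends at infinity is a ray in the coordinate `Φ`. -/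
theorem exists_direction {x b : ℝ} {c : ℝ → ℂ}
    (h : IsArc N Q x c b OnePoint.infty) {k : ℕ} (hk : k ≠ 0) {ρ : ℝ} {Φ Ψ : ℂ → ℂ}
    (h1 : ∀ u : ℂ, ‖u‖ < ρ → 0 < u.im → ContinuousAt Ψ u ∧ 0 < (Ψ u).im ∧ Φ (Ψ u) = u ∧
        (Ψ u ∈ locus N Q ↔ (u ^ k).im = 0))
    (h3 : ∀ᶠ z in Bornology.cobounded ℂ, 0 < z.im →
        ContinuousAt Φ z ∧ ‖Φ z‖ < ρ ∧ 0 < (Φ z).im ∧ Ψ (Φ z) = z) :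
    ∃ u ∈ rayDirections k, ∃ β < b, ∀ t ∈ Ioo β b, ∃ r : ℝ, 0 < r ∧ r < ρ ∧ c t = Ψ (r * u) := by
  have hcb := tendsto_coe_infty_iff.1 h.finish
  obtain ⟨β, hβ, hβb⟩ := (mem_nhdsLT_iff_exists_Ioo_subset' (sub_one_lt b)).1 (hcb.eventually h3)
  have hβ : β < b := hβ
  have hmem : ∀ t ∈ Ioo β b, c t ∈ c '' Iio b := fun t ht => mem_image_of_mem c ht.2
  have hgood : ∀ t ∈ Ioo β b, ContinuousAt Φ (c t) ∧ ‖Φ (c t)‖ < ρ ∧ 0 < (Φ (c t)).im ∧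
      Ψ (Φ (c t)) = c t := fun t ht => hβb ht (h.im_pos (hmem t ht))
  have hne : ∀ t ∈ Ioo β b, Φ (c t) ≠ 0 := fun t ht h0 => by
    have := (hgood t ht).2.2.1
    rw [h0] at this
    simp at this
  -- The direction of Φ along the arc varies continuously in the finite set of ray directions, hence
  -- is constant.
  set d : ℝ → ℂ := fun t => ((‖Φ (c t)‖⁻¹ : ℝ) : ℂ) * Φ (c t) with hd
  have hdc : ContinuousOn d (Ioo β b) := by
    intro t ht
    have hΦc : ContinuousWithinAt (fun t => Φ (c t)) (Ioo β b) t :=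
      ContinuousAt.comp_continuousWithinAt (f := c) (hgood t ht).1
        (h.continuousOn.mono Ioo_subset_Iio_self t ht)
    refine ContinuousWithinAt.mul ?_ hΦc
    exact Complex.continuous_ofReal.continuousAt.comp_continuousWithinAt
      (hΦc.norm.inv₀ (norm_ne_zero_iff.2 (hne t ht)))
  have hdD : MapsTo d (Ioo β b) (rayDirections k) := by
    intro t ht
    obtain ⟨-, hρ', him, hΨ⟩ := hgood t ht
    have hpos : 0 < ‖Φ (c t)‖⁻¹ := inv_pos.2 (norm_pos_iff.2 (hne t ht))
    refine ⟨?_, ?_, ?_⟩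
    · rw [hd]; simp only
      rw [norm_mul, Complex.norm_real, norm_inv, norm_norm,
        inv_mul_cancel₀ (norm_ne_zero_iff.2 (hne t ht))]
    · rw [hd]; simp only
      rw [Complex.im_ofReal_mul]
      exact mul_pos hpos him
    · rw [hd]; simp only
      rw [mul_pow, ← Complex.ofReal_pow, Complex.im_ofReal_mul]
      have := ((h1 _ hρ' him).2.2.2).1 (by rw [hΨ]; exact h.mem_locus (hmem t ht))
      rw [this, mul_zero]
  have hT : IsPreconnected (Ioo β b) := isPreconnected_Ioo
  obtain ⟨t₀, ht₀⟩ : (Ioo β b).Nonempty := nonempty_Ioo.2 hβ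
  refine ⟨d t₀, hdD ht₀, β, hβ, fun t ht => ⟨‖Φ (c t)‖, norm_pos_iff.2 (hne t ht),
    (hgood t ht).2.1, ?_⟩⟩
  have hconst : d t₀ = d t :=
    hT.constant_of_mapsTo (finite_rayDirections hk).isDiscrete hdc hdD ht₀ ht
  rw [hconst]
  simp only [hd]
  rw [← mul_assoc, ← Complex.ofReal_mul, mul_inv_cancel₀ (norm_ne_zero_iff.2 (hne t ht)),
    Complex.ofReal_one, one_mul, (hgood t ht).2.2.2]

theorem IsArc.finish_eq_infty {x b : ℝ} {c : ℝ → ℂ} {e : OnePoint ℂ} (h : IsArc N Q x c b e)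
    {α : Type*} {l : Filter α} [l.NeBot] {f : α → ℂ} (hf : Tendsto f l (Bornology.cobounded ℂ))
    (hfm : ∀ᶠ t in l, f t ∈ c '' Iio b) : e = OnePoint.infty := by
  obtain ⟨γ, -, h0, h1, hi, hs⟩ := h.exists_path
  have hcl : IsClosed (range γ) := (isCompact_range γ.continuous).isClosed
  obtain ⟨t, ht⟩ := hcl.mem_of_tendsto (tendsto_coe_infty_iff.2 hf) (hfm.mono fun t ht => by
    obtain ⟨s, -, -, hs⟩ := hs _ ht
    exact ⟨s, hs⟩)
  by_cases ht0 : t = 0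
  · rw [ht0, h0] at ht
    exact absurd ht (OnePoint.coe_ne_infty _)
  · by_cases ht1 : t = 1
    · rw [← h1, ← ht1, ht]
    · obtain ⟨y, hy, hty⟩ := hi t ht0 ht1
      rw [hty] at ht
      exact absurd ht (OnePoint.coe_ne_infty _)

/-- Early times stay near x and the remaining times form a compact interval, so an arc can be near ∞
only at times close to b. -/
theorem IsArc.isBounded_image_Iic {x b : ℝ} {c : ℝ → ℂ} {e : OnePoint ℂ} (h : IsArc N Q x c b e)
    {β : ℝ} (hβ : β < b) : Bornology.IsBounded (c '' Iic β) := by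
  obtain ⟨a, ha⟩ := eventually_atBot.1 (h.start.eventually (Metric.ball_mem_nhds (x : ℂ) one_pos))
  have h1 : Bornology.IsBounded (c '' Icc a β) :=
    (isCompact_Icc.image_of_continuousOn (h.continuousOn.mono fun t ht => ht.2.trans_lt hβ)).isBounded
  refine (Metric.isBounded_ball.union h1).subset (s := c '' Iic β) (t := Metric.ball (x : ℂ) 1 ∪ _) ?_
  rintro _ ⟨t, ht, rfl⟩
  rcases le_total t a with hta | hta
  · exact Or.inl (ha t hta)
  · exact Or.inr (mem_image_of_mem c ⟨hta, ht⟩)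

/-- The number of arcs that end at infinity. -/
theorem card_finish_infty (hP : IsPencil N Q)
    (harc : ∀ j, IsArc N Q (x j) (c j) (b j) (e j)) (hx : Function.Injective x)
    (hW : ∀ z : ℂ, (wronskian Q N).eval z = 0 → ∃ j, z = x j)
    {k : ℕ} (hk : k ≠ 0) (hdeg : N.natDegree = Q.natDegree + k) :
    {j | e j = OnePoint.infty}.ncard = k - 1 := by
  obtain ⟨ρ, hρ, Φ, Ψ, h1, h2, h3⟩ := hP.exists_coordinate_infty hk hdeg
  have hex : ∀ j, ∃ u, e j = OnePoint.infty → u ∈ rayDirections k ∧ ∃ β < b j, ∀ t ∈ Ioo β (b j),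
      ∃ r : ℝ, 0 < r ∧ r < ρ ∧ c j t = Ψ (r * u) := by
    intro j
    by_cases hj : e j = OnePoint.infty
    · obtain ⟨u, hu, hu'⟩ := exists_direction (hj ▸ harc j) hk h1 h3
      exact ⟨u, fun _ => ⟨hu, hu'⟩⟩
    · exact ⟨0, fun h => absurd h hj⟩
  choose u hu using hex
  -- the rays
  have hray : ∀ v ∈ rayDirections k, ∀ r : ℝ, 0 < r → r < ρ → ‖(r : ℂ) * v‖ < ρ ∧
      0 < ((r : ℂ) * v).im ∧ (((r : ℂ) * v) ^ k).im = 0 := by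
    rintro v ⟨hv1, hv2, hv3⟩ r hr0 hrρ
    refine ⟨by rw [norm_mul, hv1, Complex.norm_real, Real.norm_eq_abs, abs_of_pos hr0]; simpa, ?_, ?_⟩
    · rw [Complex.im_ofReal_mul]; exact mul_pos hr0 hv2
    · rw [mul_pow, ← Complex.ofReal_pow, Complex.im_ofReal_mul, hv3, mul_zero]
  set Ray : ℂ → Set ℂ := fun v => (fun r : ℝ => Ψ (r * v)) '' Ioo 0 ρ with hRay
  have hRpre : ∀ v ∈ rayDirections k, IsPreconnected (Ray v) := by
    intro v hv
    refine isPreconnected_Ioo.image _ fun r hr => ?_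
    obtain ⟨a1, a2, -⟩ := hray v hv r hr.1 hr.2
    refine ContinuousAt.continuousWithinAt ?_
    exact ContinuousAt.comp (f := fun r : ℝ => (r : ℂ) * v) (h1 _ a1 a2).1 (by fun_prop)
  have hRim : ∀ v ∈ rayDirections k, ∀ z ∈ Ray v, 0 < z.im := by
    rintro v hv _ ⟨r, hr, rfl⟩
    obtain ⟨a1, a2, -⟩ := hray v hv r hr.1 hr.2
    exact (h1 _ a1 a2).2.1
  have hRloc : ∀ v ∈ rayDirections k, Ray v ⊆ locus N Q := by
    rintro v hv _ ⟨r, hr, rfl⟩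
    obtain ⟨a1, a2, a3⟩ := hray v hv r hr.1 hr.2
    exact (h1 _ a1 a2).2.2.2.2 a3
  have hRA : ∀ j, e j = OnePoint.infty → Ray (u j) ⊆ c j '' Iio (b j) := by
    intro j hj
    obtain ⟨hu1, β, hβ, hu2⟩ := hu j hj
    obtain ⟨t, ht⟩ := nonempty_Ioo.2 hβ
    obtain ⟨r, hr0, hrρ, hr⟩ := hu2 t ht
    exact (harc j).subset_of_isPreconnected (hRpre _ hu1) (hRim _ hu1) (hRloc _ hu1)
      (z := c j t) ⟨r, ⟨hr0, hrρ⟩, hr.symm⟩ (mem_image_of_mem _ ht.2)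
  have hRne : ∀ v, (Ray v).Nonempty := fun v => (nonempty_Ioo.2 hρ).image _
  rw [← ncard_rayDirections hk]
  -- Arcs ending at ∞ correspond to rays. Two such arcs with a common ray would be opposite, so one
  -- would end at a finite point. A given ray is connected, so it lies on one arc, which must end at
  -- ∞.
  refine ncard_congr (fun j _ => u j) (fun j hj => (hu j hj).1) ?_ ?_
  · intro i j hi hj hij
    by_contra hne
    obtain ⟨z, hz⟩ := hRne (u i)
    have := (harc i).finish_eq_start (harc j) (hRA i hi hz)
      (hRA j hj (by rw [← show u i = u j from hij]; exact hz)) (hx.ne hne)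
    rw [show e j = OnePoint.infty from hj] at this
    exact OnePoint.coe_ne_infty _ this.symm
  · intro v hv
    obtain ⟨z, hz⟩ := hRne v
    have hdeg' : Q.natDegree < N.natDegree := by omega
    obtain ⟨j, hj⟩ := hP.mem_arc harc hW hdeg' (hRim v hv z hz) (hRloc v hv hz)
    have hsub := (harc j).subset_of_isPreconnected (hRpre v hv) (hRim v hv) (hRloc v hv) hz hj
    have hlim : Tendsto (fun r : ℝ => Ψ (r * v)) (𝓝[>] 0) (Bornology.cobounded ℂ) := by
      refine h2.comp (tendsto_nhdsWithin_iff.2 ⟨?_, ?_⟩)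
      · have : Continuous (fun r : ℝ => (r : ℂ) * v) := by fun_prop
        simpa using (this.tendsto 0).mono_left nhdsWithin_le_nhds
      · have hv0 : v ≠ 0 := by
          rintro rfl
          have := hv.1
          simp at this
        filter_upwards [self_mem_nhdsWithin] with r hr
        exact mul_ne_zero (Complex.ofReal_ne_zero.2 (mem_Ioi.1 hr).ne') hv0
    have hmem : ∀ᶠ r : ℝ in 𝓝[>] 0, r ∈ Ioo 0 ρ := Ioo_mem_nhdsGT hρ
    have he : e j = OnePoint.infty := (harc j).finish_eq_infty hlim
      (hmem.mono fun r hr => hsub (mem_image_of_mem _ hr))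
    refine ⟨j, he, ?_⟩
    obtain ⟨hu1, β, hβ, hu2⟩ := hu j he
    have hbd : ∀ᶠ z in Bornology.cobounded ℂ, z ∉ c j '' Iic β :=
      (harc j).isBounded_image_Iic hβ
    -- For r small the point of the ray lies outside the bounded initial part of the arc, hence on
    -- its final part, which runs along u j; applying Φ shows v = u j.
    obtain ⟨r, hr1, hr2⟩ := ((hlim.eventually hbd).and hmem).exists
    obtain ⟨t, ht, htr⟩ := hsub (mem_image_of_mem _ hr2)
    have htβ : t ∈ Ioo β (b j) := ⟨not_le.1 fun h' => hr1 ⟨t, h', htr⟩, ht⟩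
    obtain ⟨s, hs0, hsρ, hs⟩ := hu2 t htβ
    obtain ⟨a1, a2, -⟩ := hray _ hu1 s hs0 hsρ
    obtain ⟨a3, a4, -⟩ := hray _ hv r hr2.1 hr2.2
    have heq : (s : ℂ) * u j = r * v := by
      rw [← (h1 _ a1 a2).2.2.1, ← (h1 _ a3 a4).2.2.1, ← hs, htr]
    have hnorm := congrArg norm heq
    rw [norm_mul, norm_mul, hu1.1, hv.1, Complex.norm_real, Complex.norm_real, Real.norm_eq_abs,
      Real.norm_eq_abs, abs_of_pos hs0, abs_of_pos hr2.1, mul_one, mul_one] at hnorm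
    rw [hnorm] at heq
    exact mul_left_cancel₀ (Complex.ofReal_ne_zero.2 hr2.1.ne') heq

end Count

/-! ### Assembling the link pattern -/

section Pattern

variable {n : ℕ} {N Q : ℂ[X]} {x b : Fin n → ℝ} {c : Fin n → ℝ → ℂ} {e : Fin n → OnePoint ℂ}

/-- The involution on the growth points induced by the arcs. -/
theorem exists_pairing (harc : ∀ j, IsArc N Q (x j) (c j) (b j) (e j))
    (hx : Function.Injective x) (hW : ∀ z : ℂ, (wronskian Q N).eval z = 0 → ∃ j, z = x j) :
    ∃ σ : Fin n → Fin n, Function.Involutive σ ∧ (∀ j, σ j = j ↔ e j = OnePoint.infty) ∧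
      (∀ j, σ j ≠ j → e j = ((x (σ j) : ℂ) : OnePoint ℂ)) ∧
      (∀ j, c (σ j) '' Iio (b (σ j)) = c j '' Iio (b j)) ∧
      ∀ i j, i ≠ j → i ≠ σ j → Disjoint (c i '' Iio (b i)) (c j '' Iio (b j)) := by
  classical
  have hex : ∀ j, ∃ i, (e j = OnePoint.infty ∧ i = j) ∨ (i ≠ j ∧ e j = ((x i : ℂ) : OnePoint ℂ)) := by
    intro j
    rcases (harc j).finish_eq with h | ⟨z, hz, -, hw⟩
    · exact ⟨j, Or.inl ⟨h, rfl⟩⟩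
    · obtain ⟨i, rfl⟩ := hW z hw
      refine ⟨i, Or.inr ⟨?_, hz⟩⟩
      rintro rfl
      exact (harc i).finish_ne hz
  choose σ hσ using hex
  have hfix : ∀ j, σ j = j ↔ e j = OnePoint.infty := by
    intro j
    rcases hσ j with ⟨h1, h2⟩ | ⟨h1, h2⟩
    · exact ⟨fun _ => h1, fun _ => h2⟩
    · exact ⟨fun h => absurd h h1, fun h => absurd (h2.symm.trans h) (OnePoint.coe_ne_infty _)⟩
  have hpair : ∀ j, σ j ≠ j → e j = ((x (σ j) : ℂ) : OnePoint ℂ) := fun j hj =>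
    ((hσ j).resolve_left fun h => hj h.2).2
  have huniq : ∀ j i, e j = ((x i : ℂ) : OnePoint ℂ) → σ j = i := by
    intro j i h
    have hj : σ j ≠ j := fun h' => OnePoint.coe_ne_infty _ (h.symm.trans ((hfix j).1 h'))
    have := (hpair j hj).symm.trans h
    rw [OnePoint.coe_eq_coe] at this
    exact hx (by exact_mod_cast this)
  have hmeet : ∀ i j, i ≠ j → ∀ z, z ∈ c i '' Iio (b i) → z ∈ c j '' Iio (b j) → σ j = i :=
    fun i j hij z hi hj => huniq j i ((harc i).finish_eq_start (harc j) hi hj (hx.ne hij))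
  refine ⟨σ, ?_, hfix, hpair, ?_, ?_⟩
  · intro j
    by_cases hj : σ j = j
    · rw [hj, hj]
    · obtain ⟨z, hz1, hz2⟩ := (harc j).exists_mem_of_finish_eq (harc (σ j)) (hpair j hj)
      exact hmeet j (σ j) (Ne.symm hj) z hz1 hz2
  · intro j
    by_cases hj : σ j = j
    · rw [hj]
    · obtain ⟨z, hz1, hz2⟩ := (harc j).exists_mem_of_finish_eq (harc (σ j)) (hpair j hj)
      exact (harc (σ j)).image_eq (harc j) hz2 hz1
  · intro i j hij hiσ
    rw [Set.disjoint_left]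
    intro z hi hj
    exact hiσ (hmeet i j hij z hi hj).symm

/-- The properties of a closed-up arc that joins `x_j` to its partner. -/
structure IsPatternPath (A : Set ℂ) (p q : OnePoint ℂ) (γ : C(unitInterval, OnePoint ℂ)) : Prop where
  injective : Function.Injective γ
  zero : γ 0 = p
  one : γ 1 = q
  interior : ∀ t, t ≠ 0 → t ≠ 1 → ∃ z ∈ A, γ t = (z : OnePoint ℂ)
  surj : ∀ z ∈ A, ∃ t, t ≠ 0 ∧ t ≠ 1 ∧ γ t = (z : OnePoint ℂ)

theorem symm_ne {t : unitInterval} (h0 : t ≠ 0) (h1 : t ≠ 1) :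
    unitInterval.symm t ≠ 0 ∧ unitInterval.symm t ≠ 1 := by
  constructor
  · intro h; exact h1 (by rw [← unitInterval.symm_symm t, h, unitInterval.symm_zero])
  · intro h; exact h0 (by rw [← unitInterval.symm_symm t, h, unitInterval.symm_one])

theorem IsPatternPath.reverse {A : Set ℂ} {p q : OnePoint ℂ} {γ : C(unitInterval, OnePoint ℂ)}
    (h : IsPatternPath A p q γ) :
    IsPatternPath A q p (γ.comp ⟨unitInterval.symm, unitInterval.continuous_symm⟩) := by
  refine ⟨h.injective.comp unitInterval.symm_bijective.injective, ?_, ?_, ?_, ?_⟩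
  · change γ (unitInterval.symm 0) = q
    rw [unitInterval.symm_zero, h.one]
  · change γ (unitInterval.symm 1) = p
    rw [unitInterval.symm_one, h.zero]
  · intro t h0 h1
    exact h.interior _ (symm_ne h0 h1).1 (symm_ne h0 h1).2
  · intro z hz
    obtain ⟨t, h0, h1, ht⟩ := h.surj z hz
    refine ⟨unitInterval.symm t, (symm_ne h0 h1).1, (symm_ne h0 h1).2, ?_⟩
    change γ (unitInterval.symm (unitInterval.symm t)) = z
    rw [unitInterval.symm_symm, ht]

/-- The real locus of a real rational function with prescribed real critical points forms a link
pattern. -/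
theorem IsPencil.formsLinkPattern {m : ℕ} (hnm : 2 * m ≤ n) (hP : IsPencil N Q)
    (hx : Function.Injective x)
    (hW : ∀ z : ℂ, (wronskian Q N).eval z = 0 → ∃ j, z = x j)
    (hW0 : ∀ j, (wronskian Q N).eval (x j : ℂ) = 0)
    (hW1 : ∀ j, (derivative (wronskian Q N)).eval (x j : ℂ) ≠ 0)
    (hQx : ∀ j, Q.eval (x j : ℂ) ≠ 0)
    (hdeg : N.natDegree = Q.natDegree + (n - 2 * m + 1)) {Γ : Set ℂ}
    (hΓ : ∀ z : ℂ, 0 < z.im → (z ∈ Γ ↔ z ∈ locus N Q)) :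
    FormsLinkPattern m x Γ := by
  classical
  choose c b e harc using fun j => exists_arc hP (hQx j) (hW0 j) (hW1 j)
  obtain ⟨σ, hinv, hfix, hpair, hA, hdisj⟩ := exists_pairing harc hx hW
  choose γ hγ using fun j => (harc j).exists_path
  have hbase : ∀ j, IsPatternPath (c j '' Iio (b j)) ((x j : ℂ) : OnePoint ℂ) (e j) (γ j) := fun j =>
    ⟨(hγ j).1, (hγ j).2.1, (hγ j).2.2.1, (hγ j).2.2.2.1, (hγ j).2.2.2.2⟩
  -- The two arcs of a pair have the same image but unrelated parametrizations, while the pattern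
  -- requires exact reversals. The path of the smaller index is therefore kept and reversed for its
  -- partner.
  set δ : Fin n → C(unitInterval, OnePoint ℂ) := fun j =>
    if j ≤ σ j then γ j else (γ (σ j)).comp ⟨unitInterval.symm, unitInterval.continuous_symm⟩ with hδ
  have hgood : ∀ j, IsPatternPath (c j '' Iio (b j)) ((x j : ℂ) : OnePoint ℂ) (e j) (δ j) := by
    intro j
    by_cases hj : j ≤ σ j
    · simp only [hδ, hj, if_true]; exact hbase j
    · simp only [hδ, hj, if_false]
      have hne : σ j ≠ j := fun h => hj h.ge
      have h1 := (hbase (σ j)).reverse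
      rw [hA j, hpair (σ j) (by rw [hinv j]; exact hne.symm), hinv j, ← hpair j hne] at h1
      exact h1
  refine ⟨σ, δ, hinv, ?_, fun j => (hgood j).injective, fun j => (hgood j).zero, ?_, ?_, ?_, ?_, ?_⟩
  -- A pole of order n - 2m + 1 gives n - 2m fixed points, which leaves 2m paired growth points.
  · have h1 := card_finish_infty hP harc hx hW (Nat.succ_ne_zero (n - 2 * m)) hdeg
    have h2 : {j | e j = OnePoint.infty} = ((Finset.univ.filter fun j => σ j = j : Finset (Fin n)) :
        Set (Fin n)) := by
      ext j; simp [hfix j]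
    rw [h2, ncard_coe_finset] at h1
    have h3 := Finset.card_filter_add_card_filter_not (s := (Finset.univ : Finset (Fin n)))
      (fun j => σ j = j)
    rw [Finset.card_univ, Fintype.card_fin] at h3
    have h4 : (Finset.univ.filter fun j => σ j ≠ j).card =
      (Finset.univ.filter fun j => ¬ (σ j = j)).card := rfl
    omega
  · intro j hj
    rw [(hgood j).one]
    exact (hfix j).1 hj
  · intro j hj t
    rcases lt_or_gt_of_ne hj with h1 | h1
    · have h2 : ¬ j ≤ σ j := not_le.2 h1
      have h3 : σ j ≤ σ (σ j) := by rw [hinv j]; exact h1.le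
      simp only [hδ, h2, h3, if_true, if_false, ContinuousMap.comp_apply, ContinuousMap.coe_mk,
        unitInterval.symm_symm]
    · have h2 : j ≤ σ j := le_of_lt h1
      have h3 : ¬ σ j ≤ σ (σ j) := by rw [hinv j]; exact not_le.2 h1
      simp only [hδ, h2, h3, if_true, if_false, ContinuousMap.comp_apply, ContinuousMap.coe_mk]
      rw [hinv j]
  · intro j t h0 h1
    obtain ⟨z, hz, ht⟩ := (hgood j).interior t h0 h1
    exact ⟨z, (harc j).im_pos hz, ht⟩
  · intro i j hij hiσ s t hs0 hs1 ht0 ht1 heq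
    obtain ⟨z, hz, hs⟩ := (hgood i).interior s hs0 hs1
    obtain ⟨y, hy, ht⟩ := (hgood j).interior t ht0 ht1
    rw [hs, ht, OnePoint.coe_eq_coe] at heq
    exact Set.disjoint_left.1 (hdisj i j hij hiσ) hz (heq ▸ hy)
  · intro z hz
    rw [hΓ z hz]
    constructor
    · intro h
      obtain ⟨j, hj⟩ := hP.mem_arc harc hW (by omega) hz h
      obtain ⟨t, -, -, ht⟩ := (hgood j).surj z hj
      exact ⟨j, t, ht⟩
    · rintro ⟨j, t, ht⟩
      by_cases h0 : t = 0
      · rw [h0, (hgood j).zero, OnePoint.coe_eq_coe] at ht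
        rw [← ht] at hz
        simp at hz
      · by_cases h1 : t = 1
        · rw [h1, (hgood j).one] at ht
          rcases (harc j).finish_eq with h2 | ⟨y, h2, hy, -⟩
          · exact absurd (ht.symm.trans h2) (OnePoint.coe_ne_infty _)
          · rw [h2, OnePoint.coe_eq_coe] at ht
            rw [← ht, hy] at hz
            exact absurd hz (lt_irrefl _)
        · obtain ⟨y, hy, hty⟩ := (hgood j).interior t h0 h1
          rw [hty, OnePoint.coe_eq_coe] at ht
          exact ht ▸ (harc j).mem_locus hy

end Pattern

/-! ### Monic polynomials with prescribed simple zeros -/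

/-- The monic polynomial with zeros `a i`. -/
noncomputable def rootPoly {ι : Type*} [Fintype ι] (a : ι → ℂ) : ℂ[X] := ∏ i, (X - C (a i))

section RootPoly

variable {ι : Type*} [Fintype ι]

theorem monic_rootPoly (a : ι → ℂ) : (rootPoly a).Monic := monic_prod_X_sub_C _ _

theorem natDegree_rootPoly (a : ι → ℂ) : (rootPoly a).natDegree = Fintype.card ι := by
  rw [rootPoly, natDegree_finsetProd_X_sub_C_eq_card, Finset.card_univ]

theorem eval_rootPoly (a : ι → ℂ) (z : ℂ) : (rootPoly a).eval z = ∏ i, (z - a i) := by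
  simp [rootPoly, eval_prod]

theorem eval_rootPoly_eq_zero_iff {a : ι → ℂ} {z : ℂ} :
    (rootPoly a).eval z = 0 ↔ ∃ i, z = a i := by
  simp [eval_rootPoly, Finset.prod_eq_zero_iff, sub_eq_zero]

theorem rootPoly_dvd {a : ι → ℂ} (ha : Function.Injective a) {p : ℂ[X]}
    (hp : ∀ i, p.eval (a i) = 0) : rootPoly a ∣ p :=
  Finset.prod_dvd_of_coprime (fun _ _ _ _ hij => pairwise_coprime_X_sub_C ha hij)
    fun i _ => dvd_iff_isRoot.2 (hp i)

theorem eval_derivative_prod_X_sub_C {ι : Type*} {a : ι → ℂ} (s : Finset ι) {z : ℂ} (hz : ∀ i ∈ s, z ≠ a i) :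
    (derivative (∏ i ∈ s, (X - C (a i)))).eval z =
      (∏ i ∈ s, (X - C (a i))).eval z * ∑ i ∈ s, 1 / (z - a i) := by
  classical
  induction s using Finset.induction_on with
  | empty => simp
  | insert i s hi ih =>
    have hzi : z - a i ≠ 0 := sub_ne_zero.2 (hz i (Finset.mem_insert_self _ _))
    rw [Finset.prod_insert hi, Finset.sum_insert hi, derivative_mul, eval_add, eval_mul, eval_mul,
      ih fun j hj => hz j (Finset.mem_insert_of_mem hj)]
    simp
    field_simp

theorem eval_derivative_rootPoly {a : ι → ℂ} {z : ℂ} (hz : ∀ i, z ≠ a i) :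
    (derivative (rootPoly a)).eval z = (rootPoly a).eval z * ∑ i, 1 / (z - a i) :=
  eval_derivative_prod_X_sub_C Finset.univ fun i _ => hz i

/-- With rootPoly a = (X - a_k) q, the first and second derivatives at a_k are q(a_k) and 2 q'(a_k);
the factor 2 is the one in the stationary relations. -/
theorem rootPoly_derivatives [DecidableEq ι] {a : ι → ℂ} (ha : Function.Injective a) (k : ι) :
    (derivative (rootPoly a)).eval (a k) ≠ 0 ∧
      (derivative (derivative (rootPoly a))).eval (a k) =
        (derivative (rootPoly a)).eval (a k) * ∑ l ∈ Finset.univ.erase k, 2 / (a k - a l) := by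
  set q : ℂ[X] := ∏ i ∈ Finset.univ.erase k, (X - C (a i)) with hq
  have h : rootPoly a = (X - C (a k)) * q :=
    (Finset.mul_prod_erase Finset.univ (fun i => X - C (a i)) (Finset.mem_univ k)).symm
  have hne : ∀ i ∈ Finset.univ.erase k, a k ≠ a i := fun i hi h =>
    (Finset.ne_of_mem_erase hi) (ha h).symm
  have h1 : (derivative (rootPoly a)).eval (a k) = q.eval (a k) := by
    rw [h, derivative_mul]; simp
  have h2 : (derivative (derivative (rootPoly a))).eval (a k) = 2 * (derivative q).eval (a k) := by
    rw [h, derivative_mul]; simp; ring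
  refine ⟨?_, ?_⟩
  · rw [h1, hq, eval_prod]
    refine Finset.prod_ne_zero_iff.2 fun i hi => ?_
    simpa [sub_eq_zero] using hne i hi
  · rw [h2, h1, eval_derivative_prod_X_sub_C _ hne, ← hq, mul_left_comm, Finset.mul_sum]
    simp [div_eq_mul_inv]

theorem isRealPoly_rootPoly {a : ι → ℂ} (ha : Function.Injective a)
    (hc : ∀ i, ∃ j, a j = (starRingEnd ℂ) (a i)) : IsRealPoly (rootPoly a) := by
  choose ρ hρ using hc
  have hinj : Function.Injective ρ := by
    intro i j hij
    have := hρ i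
    rw [hij, hρ j] at this
    exact ha ((starRingEnd ℂ).injective this).symm
  have hbij : Function.Bijective ρ := Finite.injective_iff_bijective.1 hinj
  rw [IsRealPoly, rootPoly, Polynomial.map_prod]
  rw [← hbij.prod_comp (fun i => X - C (a i))]
  refine Finset.prod_congr rfl fun i _ => ?_
  simp [hρ]

theorem isRealPoly_rootPoly_ofReal (x : ι → ℝ) : IsRealPoly (rootPoly fun i => (x i : ℂ)) := by
  rw [IsRealPoly, rootPoly, Polynomial.map_prod]
  refine Finset.prod_congr rfl fun i _ => by simp

end RootPoly

theorem eq_C_mul_of_monic_dvd {p q : ℂ[X]} (hp : p.Monic) (hq : q ≠ 0)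
    (h : p ∣ q) (hdeg : q.natDegree ≤ p.natDegree) : ∃ c : ℂ, c ≠ 0 ∧ q = C c * p := by
  obtain ⟨r, rfl⟩ := h
  have hr : r ≠ 0 := right_ne_zero_of_mul hq
  rw [natDegree_mul hp.ne_zero hr] at hdeg
  have hr0 : r.natDegree = 0 := by omega
  rw [natDegree_eq_zero] at hr0
  obtain ⟨c, rfl⟩ := hr0
  exact ⟨c, by simpa using hr, mul_comm _ _⟩

theorem monic_eq_of_dvd_dvd {p q : ℂ[X]} (hp : p.Monic) (hq : q.Monic) (h : p ∣ q) (h' : q ∣ p) :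
    p = q :=
  eq_of_monic_of_associated hp hq (associated_of_dvd_dvd h h')

/-! ### The Wronskian -/

theorem coeff_wronskian {N Q : ℂ[X]} {a b : ℕ} (hN : N.natDegree ≤ a + 1) (hQ : Q.natDegree ≤ b) :
    (wronskian Q N).coeff (a + b) = ((a : ℂ) + 1 - b) * (N.coeff (a + 1) * Q.coeff b) := by
  have h1 : (Q * derivative N).coeff (b + a) = Q.coeff b * (derivative N).coeff a := by
    refine coeff_mul_add_eq_of_natDegree_le hQ ?_
    exact (natDegree_derivative_le N).trans (by omega)
  have h2 : (derivative Q * N).coeff (a + b) = b * (N.coeff (a + 1) * Q.coeff b) := by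
    cases b with
    | zero =>
      have : derivative Q = 0 := by
        rw [natDegree_eq_zero.1 (Nat.le_zero.1 hQ) |>.choose_spec.symm]; simp
      simp [this]
    | succ b =>
      have : a + (b + 1) = b + (a + 1) := by omega
      rw [this, coeff_mul_add_eq_of_natDegree_le ((natDegree_derivative_le Q).trans (by omega)) hN,
        coeff_derivative]
      push_cast; ring
  rw [wronskian, coeff_sub, h2, add_comm a b, h1, coeff_derivative]
  ring

/-- The coefficient of degree deg N + deg Q - 1 is (deg N - deg Q) times the leading coefficients,
so unequal degrees prevent cancellation. -/
theorem natDegree_wronskian {N Q : ℂ[X]} (hN : N ≠ 0) (hQ : Q ≠ 0)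
    (hdeg : Q.natDegree < N.natDegree) :
    (wronskian Q N).natDegree = N.natDegree + Q.natDegree - 1 := by
  obtain ⟨a, ha⟩ : ∃ a, N.natDegree = a + 1 := ⟨N.natDegree - 1, by omega⟩
  have hc : (wronskian Q N).coeff (a + Q.natDegree) ≠ 0 := by
    rw [coeff_wronskian ha.le le_rfl]
    refine mul_ne_zero ?_ (mul_ne_zero ?_ ?_)
    · have : ((a + 1 : ℕ) : ℂ) ≠ (Q.natDegree : ℂ) := by
        norm_cast; omega
      rw [sub_ne_zero]; push_cast at this; exact this
    · rw [← ha]; exact leadingCoeff_ne_zero.2 hN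
    · exact leadingCoeff_ne_zero.2 hQ
  have hw : wronskian Q N ≠ 0 := fun h => hc (by simp [h])
  have h1 := natDegree_wronskian_lt_add hw
  have h2 := le_natDegree_of_ne_zero hc
  omega

/-- At a simple root of Q the Wronskian is -Q' M, so Q divides M; with M = Q r the Wronskian is Q ^
2 r', hence r is constant. -/
theorem exists_eq_C_mul_of_wronskian_eq_zero {ι : Type*} [Fintype ι] {a : ι → ℂ}
    (ha : Function.Injective a) {M : ℂ[X]} (h : wronskian (rootPoly a) M = 0) :
    ∃ c : ℂ, M = C c * rootPoly a := by
  classical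
  have hdvd : rootPoly a ∣ M := rootPoly_dvd ha fun i => by
    have h1 := congrArg (fun p => p.eval (a i)) h
    have h2 : (rootPoly a).eval (a i) = 0 := eval_rootPoly_eq_zero_iff.2 ⟨i, rfl⟩
    simpa [wronskian, h2, (rootPoly_derivatives ha i).1] using h1
  obtain ⟨r, rfl⟩ := hdvd
  have h1 : rootPoly a ^ 2 * derivative r = 0 := by
    rw [← h, wronskian, derivative_mul]; ring
  have h2 : derivative r = 0 :=
    (mul_eq_zero.1 h1).resolve_left (pow_ne_zero 2 (monic_rootPoly a).ne_zero)
  obtain ⟨c, rfl⟩ := natDegree_eq_zero.1 (derivative_eq_zero.1 h2)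
  exact ⟨c, mul_comm _ _⟩

/-- Integration of `P / Q ^ 2` when all residues vanish. -/
theorem exists_wronskian_eq {ι : Type*} [Fintype ι] {a : ι → ℂ} (ha : Function.Injective a)
    {P : ℂ[X]} (hres : ∀ i, (derivative P).eval (a i) * (derivative (rootPoly a)).eval (a i) =
      P.eval (a i) * (derivative (derivative (rootPoly a))).eval (a i)) :
    ∃ N, wronskian (rootPoly a) N = P := by
  classical
  set Q := rootPoly a with hQ
  have hQa : ∀ i, Q.eval (a i) = 0 := fun i => eval_rootPoly_eq_zero_iff.2 ⟨i, rfl⟩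
  have hQ' : ∀ i, (derivative Q).eval (a i) ≠ 0 := fun i => (rootPoly_derivatives ha i).1
  -- At a root of Q the Wronskian with N is -Q' N, so these values match W(Q, N₀) with P at the
  -- roots. The residue condition is exactly what makes the first derivatives match too, so Q ^ 2
  -- divides P - W(Q, N₀).
  set N₀ := Lagrange.interpolate Finset.univ a (fun i => -P.eval (a i) / (derivative Q).eval (a i))
    with hN₀
  have hN₀a : ∀ i, N₀.eval (a i) = -P.eval (a i) / (derivative Q).eval (a i) := fun i =>
    Lagrange.eval_interpolate_at_node _ ha.injOn (Finset.mem_univ i)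
  set D := P - wronskian Q N₀ with hD
  have hD0 : ∀ i, D.eval (a i) = 0 := by
    intro i
    simp only [hD, wronskian, eval_sub, eval_mul, hQa, hN₀a]
    have := hQ' i
    field_simp
    ring
  have hD1 : ∀ i, (derivative D).eval (a i) = 0 := by
    intro i
    simp only [hD, wronskian, derivative_sub, derivative_mul, eval_sub, eval_add, eval_mul, hQa,
      hN₀a]
    have h1 := hQ' i
    have h2 := hres i
    field_simp
    linear_combination h2
  obtain ⟨E, hE⟩ := rootPoly_dvd ha hD0
  have hE0 : ∀ i, E.eval (a i) = 0 := by
    intro i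
    have := hD1 i
    rw [hE, derivative_mul, eval_add, eval_mul, eval_mul, ← hQ, hQa, zero_mul, add_zero] at this
    exact (mul_eq_zero.1 this).resolve_left (hQ' i)
  obtain ⟨S, hS⟩ := rootPoly_dvd ha hE0
  obtain ⟨T, hT⟩ : ∃ T, derivative T = S := by
    refine ⟨∑ k ∈ Finset.range (S.natDegree + 1), C (S.coeff k / (k + 1)) * X ^ (k + 1), ?_⟩
    rw [derivative_sum]
    conv_rhs => rw [S.as_sum_range_C_mul_X_pow]
    refine Finset.sum_congr rfl fun k _ => ?_
    rw [derivative_C_mul_X_pow]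
    have : (k : ℂ) + 1 ≠ 0 := Nat.cast_add_one_ne_zero k
    simp [this]
  -- Adding Q T to N₀ changes the Wronskian by Q ^ 2 T', so T is taken as a primitive of the
  -- cofactor S.
  refine ⟨N₀ + Q * T, ?_⟩
  have h1 : wronskian Q (N₀ + Q * T) = wronskian Q N₀ + Q * (Q * derivative T) := by
    simp only [wronskian, derivative_add, derivative_mul]; ring
  rw [h1, hT, ← hS, ← hE, hD]
  ring

theorem wronskian_map_conj (Q N : ℂ[X]) :
    wronskian (Q.map (starRingEnd ℂ)) (N.map (starRingEnd ℂ)) =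
      (wronskian Q N).map (starRingEnd ℂ) := by
  simp [wronskian, derivative_map]

/-- The equation is linear in N and has real data, so the average of a solution and its conjugate is
again a solution. -/
theorem exists_real_wronskian_eq {Q P N : ℂ[X]} (hQ : IsRealPoly Q) (hP : IsRealPoly P)
    (h : wronskian Q N = P) : ∃ N', IsRealPoly N' ∧ wronskian Q N' = P := by
  refine ⟨C (1 / 2) * (N + N.map (starRingEnd ℂ)), ?_, ?_⟩
  · have h2 : (N.map (starRingEnd ℂ)).map (starRingEnd ℂ) = N := by
      rw [Polynomial.map_map]
      have : (starRingEnd ℂ).comp (starRingEnd ℂ) = RingHom.id ℂ := by ext; simp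
      rw [this, Polynomial.map_id]
    rw [IsRealPoly, Polynomial.map_mul, Polynomial.map_add, h2, add_comm]
    simp [Complex.conj_ofNat]
  · have h1 := wronskian_map_conj Q N
    rw [hQ, h, hP] at h1
    have h2 : wronskian Q (C (1 / 2) * (N + N.map (starRingEnd ℂ))) =
        C (1 / 2) * (wronskian Q N + wronskian Q (N.map (starRingEnd ℂ))) := by
      simp only [wronskian, derivative_mul, derivative_add, derivative_C]; ring
    rw [h2, h, h1, ← two_mul, ← mul_assoc]
    have : (C (1 / 2) * 2 : ℂ[X]) = 1 := by
      rw [← C_ofNat, ← C_mul]; norm_num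
    rw [this, one_mul]

/-! ### Stationary relations, residues and the master function -/

section Stationary

variable {n m : ℕ} {x : Fin n → ℝ} {ξ : Fin m → ℂ}

/-- The left-hand side of the stationary relation for the charge `ξ k`. -/
noncomputable def residue (x : Fin n → ℝ) (ξ : Fin m → ℂ) (k : Fin m) : ℂ :=
  -∑ j, 1 / (ξ k - (x j : ℂ)) + ∑ l ∈ Finset.univ.erase k, 2 / (ξ k - ξ l)

/-- At ξ_k the two sums are P' / P and Q'' / Q', so the relation reads P' Q' = P Q'' there: the
residue of P / Q ^ 2 at the double pole ξ_k vanishes. -/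
theorem stationary_iff_derivatives (hξ : Function.Injective ξ) (hne : ∀ k j, ξ k ≠ (x j : ℂ)) :
    Stationary x ξ ↔ ∀ k,
      (derivative (rootPoly fun j => (x j : ℂ))).eval (ξ k) * (derivative (rootPoly ξ)).eval (ξ k) =
        (rootPoly fun j => (x j : ℂ)).eval (ξ k) *
          (derivative (derivative (rootPoly ξ))).eval (ξ k) := by
  refine forall_congr' fun k => ?_
  obtain ⟨h1, h2⟩ := rootPoly_derivatives hξ k
  have h3 : (rootPoly fun j => (x j : ℂ)).eval (ξ k) ≠ 0 := fun h => by
    obtain ⟨j, hj⟩ := eval_rootPoly_eq_zero_iff.1 h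
    exact hne k j hj
  rw [h2, eval_derivative_rootPoly (hne k), neg_add_eq_zero]
  constructor
  · intro h
    rw [h]; ring
  · intro h
    refine mul_left_cancel₀ (mul_ne_zero h3 h1) ?_
    linear_combination h

/-- Regroups the sum over pairs i < j, as it comes from the product over pairs, by the coefficient
of each v_i. -/
theorem sum_Ioi_antisymm (v : Fin m → ℂ) (b : Fin m → Fin m → ℂ) (hb : ∀ i j, b j i = -b i j) :
    ∑ i, ∑ j ∈ Finset.Ioi i, (v i - v j) * b i j = ∑ i, v i * ∑ j ∈ Finset.univ.erase i, b i j := by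
  have h1 : ∑ i, ∑ j ∈ Finset.Ioi i, v j * b i j = -∑ i, ∑ j ∈ Finset.Iio i, v i * b i j := by
    rw [Finset.sum_comm' (s' := fun j => Finset.Iio j) (t' := Finset.univ) (by simp),
      ← Finset.sum_neg_distrib]
    refine Finset.sum_congr rfl fun i _ => ?_
    rw [← Finset.sum_neg_distrib]
    refine Finset.sum_congr rfl fun j _ => ?_
    rw [hb i j]; ring
  have h2 : ∀ i : Fin m, Finset.univ.erase i = Finset.Iio i ∪ Finset.Ioi i := by
    intro i; ext j
    simp only [Finset.mem_erase, Finset.mem_univ, and_true, Finset.mem_union, Finset.mem_Iio,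
      Finset.mem_Ioi]
    exact lt_or_lt_iff_ne.symm
  have h3 : ∀ i : Fin m, Disjoint (Finset.Iio i) (Finset.Ioi i) := fun i =>
    Finset.disjoint_left.2 fun j hj hj' =>
      lt_asymm (Finset.mem_Iio.1 hj) (Finset.mem_Ioi.1 hj')
  simp only [sub_mul, Finset.sum_sub_distrib, h1, h2, Finset.sum_union (h3 _), mul_add,
    Finset.sum_add_distrib, Finset.mul_sum]
  ring

theorem masterFunction_ne_zero (hx : Function.Injective x) (hξ : Function.Injective ξ)
    (hne : ∀ k j, ξ k ≠ (x j : ℂ)) : masterFunction (fun j => (x j : ℂ)) ξ ≠ 0 := by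
  refine mul_ne_zero (mul_ne_zero ?_ ?_) ?_ <;>
    refine Finset.prod_ne_zero_iff.2 fun i _ => Finset.prod_ne_zero_iff.2 fun j hj => ?_
  · refine pow_ne_zero _ (sub_ne_zero.2 fun h => ?_)
    exact (Finset.mem_Ioi.1 hj).ne (hx (Complex.ofReal_injective h))
  · exact pow_ne_zero _ (sub_ne_zero.2 fun h => (Finset.mem_Ioi.1 hj).ne (hξ h))
  · exact zpow_ne_zero _ (sub_ne_zero.2 (hne j i).symm)

theorem differentiableAt_finset_prod {ι E : Type*} [NormedAddCommGroup E] [NormedSpace ℂ E]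
    {s : Finset ι} {f : ι → E → ℂ} {a : E} (h : ∀ i ∈ s, DifferentiableAt ℂ (f i) a) :
    DifferentiableAt ℂ (fun y => ∏ i ∈ s, f i y) a := by
  classical
  exact (HasFDerivAt.finsetProd fun i hi => (h i hi).hasFDerivAt).differentiableAt

theorem differentiableAt_masterFunction (hne : ∀ k j, ξ k ≠ (x j : ℂ)) :
    DifferentiableAt ℂ (fun η : Fin m → ℂ => masterFunction (fun j => (x j : ℂ)) η) ξ := by
  unfold masterFunction
  refine DifferentiableAt.mul (DifferentiableAt.mul (differentiableAt_const _) ?_) ?_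
  · exact differentiableAt_finset_prod fun i _ => differentiableAt_finset_prod fun j _ => by
      fun_prop
  · refine differentiableAt_finset_prod fun i _ => differentiableAt_finset_prod fun j _ => ?_
    refine DifferentiableAt.zpow (by fun_prop) (Or.inl ?_)
    exact sub_ne_zero.2 (hne j i).symm

/-- The exponents 8 and -4 are 4 times the coefficients 2 and -1 in the stationary relations.
Restricting to a line reduces the computation to logarithmic derivatives of affine functions of one
variable. -/
theorem logDeriv_masterFunction_line (hx : Function.Injective x) (hξ : Function.Injective ξ)
    (hne : ∀ k j, ξ k ≠ (x j : ℂ)) (v : Fin m → ℂ) :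
    logDeriv (fun t : ℂ => masterFunction (fun j => (x j : ℂ)) (ξ + t • v)) 0 =
      4 * ∑ k, v k * residue x ξ k := by
  have hd : ∀ a b : ℂ, DifferentiableAt ℂ (fun t : ℂ => a + t * b) 0 := fun a b => by fun_prop
  have hld : ∀ a b : ℂ, logDeriv (fun t : ℂ => a + t * b) 0 = b / a := fun a b => by
    have : HasDerivAt (fun t : ℂ => a + t * b) b 0 := by
      simpa using ((hasDerivAt_id (0 : ℂ)).mul_const b).const_add a
    rw [logDeriv_apply, this.deriv]; simp
  have hA : (∏ i : Fin n, ∏ j ∈ Finset.Ioi i, ((x i : ℂ) - (x j : ℂ)) ^ 2) ≠ 0 :=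
    Finset.prod_ne_zero_iff.2 fun i _ => Finset.prod_ne_zero_iff.2 fun j hj =>
      pow_ne_zero _ (sub_ne_zero.2 fun h => (Finset.mem_Ioi.1 hj).ne (hx (by exact_mod_cast h)))
  have hB : ∀ i, ∀ j ∈ Finset.Ioi i, ξ i - ξ j ≠ 0 := fun i j hj =>
    sub_ne_zero.2 fun h => (Finset.mem_Ioi.1 hj).ne (hξ h)
  have hC : ∀ (i : Fin n) (j : Fin m), (x i : ℂ) - ξ j ≠ 0 := fun i j =>
    sub_ne_zero.2 (hne j i).symm
  have hfun : (fun t : ℂ => masterFunction (fun j => (x j : ℂ)) (ξ + t • v)) = fun t =>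
      (∏ i : Fin n, ∏ j ∈ Finset.Ioi i, ((x i : ℂ) - (x j : ℂ)) ^ 2) *
        ((∏ i, ∏ j ∈ Finset.Ioi i, ((ξ i - ξ j) + t * (v i - v j)) ^ 8) *
        ∏ i : Fin n, ∏ j, (((x i : ℂ) - ξ j) + t * (-v j)) ^ (-4 : ℤ)) := by
    funext t
    rw [masterFunction, mul_assoc]
    congr 2
    · refine Finset.prod_congr rfl fun i _ => Finset.prod_congr rfl fun j _ => ?_
      congr 1
      simp only [Pi.add_apply, Pi.smul_apply, smul_eq_mul]
      ring
    · refine Finset.prod_congr rfl fun i _ => Finset.prod_congr rfl fun j _ => ?_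
      congr 1
      simp only [Pi.add_apply, Pi.smul_apply, smul_eq_mul]
      ring
  have hBd : ∀ i j, DifferentiableAt ℂ (fun t : ℂ => ((ξ i - ξ j) + t * (v i - v j)) ^ 8) 0 :=
    fun i j => (hd _ _).pow 8
  have hCd : ∀ (i : Fin n) (j : Fin m),
      DifferentiableAt ℂ (fun t : ℂ => (((x i : ℂ) - ξ j) + t * (-v j)) ^ (-4 : ℤ)) 0 :=
    fun i j => (hd _ _).zpow (Or.inl (by simpa using hC i j))
  have hB0 : ∀ i, ∀ j ∈ Finset.Ioi i, ((ξ i - ξ j) + 0 * (v i - v j)) ^ 8 ≠ 0 := fun i j hj =>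
    pow_ne_zero _ (by simpa using hB i j hj)
  have hC0 : ∀ (i : Fin n) (j : Fin m), (((x i : ℂ) - ξ j) + 0 * (-v j)) ^ (-4 : ℤ) ≠ 0 :=
    fun i j => zpow_ne_zero _ (by simpa using hC i j)
  rw [hfun, logDeriv_const_mul _ _ hA, logDeriv_mul, logDeriv_prod, logDeriv_prod]
  rotate_left
  · exact fun i _ => Finset.prod_ne_zero_iff.2 fun j _ => hC0 i j
  · exact fun i _ => DifferentiableAt.fun_finsetProd fun j _ => hCd i j
  · exact fun i _ => Finset.prod_ne_zero_iff.2 fun j hj => hB0 i j hj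
  · exact fun i _ => DifferentiableAt.fun_finsetProd fun j _ => hBd i j
  · exact Finset.prod_ne_zero_iff.2 fun i _ => Finset.prod_ne_zero_iff.2 fun j hj => hB0 i j hj
  · exact Finset.prod_ne_zero_iff.2 fun i _ => Finset.prod_ne_zero_iff.2 fun j _ => hC0 i j
  · exact DifferentiableAt.fun_finsetProd fun i _ =>
      DifferentiableAt.fun_finsetProd fun j _ => hBd i j
  · exact DifferentiableAt.fun_finsetProd fun i _ =>
      DifferentiableAt.fun_finsetProd fun j _ => hCd i j
  have e1 : ∀ i, logDeriv (fun t : ℂ => ∏ j ∈ Finset.Ioi i, ((ξ i - ξ j) + t * (v i - v j)) ^ 8) 0 =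
      ∑ j ∈ Finset.Ioi i, (v i - v j) * (8 / (ξ i - ξ j)) := by
    intro i
    rw [logDeriv_prod (f := fun j (t : ℂ) => ((ξ i - ξ j) + t * (v i - v j)) ^ 8)
      (fun j hj => hB0 i j hj) fun j _ => hBd i j]
    refine Finset.sum_congr rfl fun j _ => ?_
    rw [logDeriv_fun_pow (hd _ _), hld]
    push_cast; ring
  have e2 : ∀ i : Fin n,
      logDeriv (fun t : ℂ => ∏ j, (((x i : ℂ) - ξ j) + t * (-v j)) ^ (-4 : ℤ)) 0 =
      ∑ j, v j * (-4 * (1 / (ξ j - x i))) := by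
    intro i
    rw [logDeriv_prod (f := fun j (t : ℂ) => (((x i : ℂ) - ξ j) + t * (-v j)) ^ (-4 : ℤ))
      (fun j _ => hC0 i j) fun j _ => hCd i j]
    refine Finset.sum_congr rfl fun j _ => ?_
    rw [logDeriv_fun_zpow (hd _ _), hld, ← neg_sub (ξ j), div_neg]
    push_cast; ring
  rw [Finset.sum_congr rfl fun i _ => e1 i, Finset.sum_congr rfl fun i _ => e2 i,
    sum_Ioi_antisymm v (fun i j => 8 / (ξ i - ξ j)) (fun i j => by rw [← neg_sub, div_neg]),
    Finset.sum_comm, ← Finset.sum_add_distrib, Finset.mul_sum]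
  refine Finset.sum_congr rfl fun k _ => ?_
  rw [residue, ← Finset.mul_sum, ← mul_add, ← Finset.mul_sum, mul_left_comm]
  congr 1
  have : ∀ l ∈ Finset.univ.erase k, 8 / (ξ k - ξ l) = 4 * (2 / (ξ k - ξ l)) := fun l _ => by ring
  rw [Finset.sum_congr rfl this, ← Finset.mul_sum]
  ring

/-- The master function is nonzero at ξ, so its differential vanishes iff its logarithmic derivative
vanishes in every direction; coordinate directions isolate the single relations. -/
theorem isMasterCritical_iff_stationary (hx : Function.Injective x) (hξ : Function.Injective ξ)
    (hne : ∀ k j, ξ k ≠ (x j : ℂ)) : IsMasterCritical x ξ ↔ Stationary x ξ := by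
  have hd := differentiableAt_masterFunction (x := x) hne
  have hline : ∀ v : Fin m → ℂ, HasDerivAt (fun t : ℂ => ξ + t • v) v 0 := fun v => by
    simpa using ((hasDerivAt_id (0 : ℂ)).smul_const v).const_add ξ
  have hval : ∀ (L : (Fin m → ℂ) →L[ℂ] ℂ),
      HasFDerivAt (fun η : Fin m → ℂ => masterFunction (fun j => (x j : ℂ)) η) L ξ → ∀ v,
      L v = (4 * ∑ k, v k * residue x ξ k) * masterFunction (fun j => (x j : ℂ)) ξ := by
    intro L hL v
    have h0 : ξ + (0 : ℂ) • v = ξ := by simp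
    have h1 : HasDerivAt (fun t : ℂ => masterFunction (fun j => (x j : ℂ)) (ξ + t • v)) (L v) 0 :=
      HasFDerivAt.comp_hasDerivAt
        (l := fun η : Fin m → ℂ => masterFunction (fun j => (x j : ℂ)) η)
        (f := fun t : ℂ => ξ + t • v) 0 (by rwa [h0]) (hline v)
    rw [← logDeriv_masterFunction_line hx hξ hne v, logDeriv_apply, h1.deriv, h0,
      div_mul_cancel₀ _ (masterFunction_ne_zero hx hξ hne)]
  constructor
  · intro h k
    have := hval 0 h (Pi.single k 1)
    rw [_root_.zero_apply, eq_comm, mul_eq_zero,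
      or_iff_left (masterFunction_ne_zero hx hξ hne), mul_eq_zero, or_iff_right (by norm_num)] at this
    rw [Finset.sum_eq_single k (fun l _ hl => by simp [hl]) (by simp)] at this
    simpa [residue] using this
  · intro h
    have h2 : fderiv ℂ (fun η : Fin m → ℂ => masterFunction (fun j => (x j : ℂ)) η) ξ = 0 := by
      ext v
      have hr : ∀ k, residue x ξ k = 0 := h
      rw [hval _ hd.hasFDerivAt v]
      simp [hr]
    have h3 := hd.hasFDerivAt
    rwa [h2] at h3

end Stationary

/-! ### Rational functions with prescribed critical points -/

theorem value_eq_quot (R : RatFunc ℂ) : value R = quot R.num R.denom := rfl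

theorem num_denom_div {N Q : ℂ[X]} (hQ : Q.Monic) (h : ∀ z, N.eval z = 0 → Q.eval z ≠ 0) :
    (algebraMap ℂ[X] (RatFunc ℂ) N / algebraMap ℂ[X] (RatFunc ℂ) Q).num = N ∧
      (algebraMap ℂ[X] (RatFunc ℂ) N / algebraMap ℂ[X] (RatFunc ℂ) Q).denom = Q := by
  set R := algebraMap ℂ[X] (RatFunc ℂ) N / algebraMap ℂ[X] (RatFunc ℂ) Q with hR
  have hco : IsCoprime N Q := by
    refine (Polynomial.isCoprime_iff_aeval_ne_zero_of_isAlgClosed ℂ ℂ N Q).2 fun z => ?_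
    by_cases hN : N.eval z = 0
    · exact Or.inr (by simpa using h z hN)
    · exact Or.inl (by simpa using hN)
  have h1 : R.num * Q = N * R.denom := (RatFunc.num_mul_eq_mul_denom_iff hQ.ne_zero).2 hR
  have h2 : R.denom ∣ Q := RatFunc.denom_div_dvd N Q
  have h3 : Q ∣ R.denom := hco.symm.dvd_of_dvd_mul_left ⟨R.num, by rw [← h1, mul_comm]⟩
  have h4 : R.denom = Q := monic_eq_of_dvd_dvd (RatFunc.monic_denom R) hQ h2 h3
  refine ⟨?_, h4⟩
  rw [h4] at h1
  exact mul_right_cancel₀ hQ.ne_zero h1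

theorem map_conj_map_conj (p : ℂ[X]) : (p.map (starRingEnd ℂ)).map (starRingEnd ℂ) = p := by
  rw [Polynomial.map_map]
  have : (starRingEnd ℂ).comp (starRingEnd ℂ) = RingHom.id ℂ := by ext; simp
  rw [this, Polynomial.map_id]

theorem eval_map_conj (p : ℂ[X]) (z : ℂ) :
    (p.map (starRingEnd ℂ)).eval z = (starRingEnd ℂ) (p.eval ((starRingEnd ℂ) z)) := by
  conv_lhs => rw [← Complex.conj_conj z]
  rw [Polynomial.eval_map_apply]

/-- Off the poles R agrees with its conjugate, and multiplying by both denominators makes this a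
polynomial identity valid everywhere. Coprimality and monic denominators then force equal
denominators, hence equal numerators. -/
theorem isRealPoly_num_denom {R : RatFunc ℂ}
    (h : ∀ z, (starRingEnd ℂ) (value R ((starRingEnd ℂ) z)) = value R z) :
    IsRealPoly R.num ∧ IsRealPoly R.denom := by
  set A := R.num with hA
  set B := R.denom with hB
  set A' := A.map (starRingEnd ℂ) with hA'
  set B' := B.map (starRingEnd ℂ) with hB'
  have hB0 : B ≠ 0 := R.denom_ne_zero
  have hmon : B.Monic := RatFunc.monic_denom R
  have hmon' : B'.Monic := hmon.map _
  have h1 : (A' * B - A * B') * (B * B') = 0 := by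
    refine Polynomial.funext fun z => ?_
    rw [eval_mul, eval_zero]
    by_cases hz : B.eval z = 0
    · simp [hz]
    by_cases hz' : B'.eval z = 0
    · simp [hz']
    have h2 : A'.eval z / B'.eval z = A.eval z / B.eval z := by
      have := h z
      rw [value_eq_quot, quot, quot, map_div₀, ← eval_map_conj, ← eval_map_conj] at this
      exact this
    rw [div_eq_div_iff hz' hz] at h2
    simp [h2]
  have h2 : A' * B = A * B' :=
    sub_eq_zero.1 ((mul_eq_zero.1 h1).resolve_right (mul_ne_zero hB0 hmon'.ne_zero))
  have hco : IsCoprime A B := RatFunc.isCoprime_num_denom R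
  have hdvd : B ∣ B' := hco.symm.dvd_of_dvd_mul_left ⟨A', by rw [← h2, mul_comm]⟩
  have hdvd' : B' ∣ B := by
    have := Polynomial.map_dvd (starRingEnd ℂ) hdvd
    rwa [hB', map_conj_map_conj] at this
  have hBB : B' = B := monic_eq_of_dvd_dvd hmon' hmon hdvd' hdvd
  refine ⟨?_, hBB⟩
  rw [hBB] at h2
  exact mul_right_cancel₀ hB0 h2

theorem injective_of_ncard_range {m : ℕ} {ξ : Fin m → ℂ} (h : (range ξ).ncard = m) :
    Function.Injective ξ := by
  classical
  have h1 : (Finset.univ.image ξ).card = (Finset.univ : Finset (Fin m)).card := by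
    rw [← Set.ncard_coe_finset]
    simpa using h
  simpa using Finset.card_image_iff.1 h1

theorem eq_rootPoly_of_simple {m : ℕ} {ξ : Fin m → ℂ} {q : ℂ[X]} (hq : q.Monic)
    (hξ : Function.Injective ξ) (hz : ∀ z, q.eval z = 0 ↔ z ∈ range ξ)
    (hs : ∀ z, q.eval z = 0 → q.rootMultiplicity z = 1) : q = rootPoly ξ := by
  classical
  have hnd : q.roots.Nodup := Multiset.nodup_iff_count_le_one.2 fun z => by
    rw [count_roots]
    by_cases h : q.eval z = 0
    · exact (hs z h).le
    · rw [rootMultiplicity_eq_zero h]; exact zero_le_one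
  have h1 : q = (q.roots.map fun a => X - C a).prod :=
    (IsAlgClosed.splits q).eq_prod_roots_of_monic hq
  have h2 : q.roots = Finset.univ.val.map ξ := by
    refine (Multiset.Nodup.ext hnd ?_).2 fun z => ?_
    · exact Multiset.Nodup.map hξ Finset.univ.nodup
    · rw [mem_roots hq.ne_zero, IsRoot, hz]
      simp
  rw [h1, h2, Multiset.map_map]
  rfl

/-! ### The class CR and its poles -/

section CR

variable {n m : ℕ} {x : Fin n → ℝ} {ξ ξ' : Fin m → ℂ}

theorem ofReal_injective_comp (hx : Function.Injective x) :
    Function.Injective fun j => (x j : ℂ) := Complex.ofReal_injective.comp hx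

/-- The pole order at ∞ gives deg N = n - m + 1, so the Wronskian has degree n. It vanishes at the n
growth points, hence is a constant times P, and the constant is real because all coefficients are.
-/
theorem IsCR.data {R : RatFunc ℂ} (hnm : 2 * m ≤ n) (hx : Function.Injective x)
    (h : IsCR m x R) (hp : poles R = range ξ) :
    Function.Injective ξ ∧ R.denom = rootPoly ξ ∧ IsRealPoly R.num ∧ IsRealPoly R.denom ∧
      (∀ k j, ξ k ≠ (x j : ℂ)) ∧
      ∃ c : ℝ, c ≠ 0 ∧ wronskian R.denom R.num = C (c : ℂ) * rootPoly fun j => (x j : ℂ) := by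
  have hξ : Function.Injective ξ := injective_of_ncard_range (by rw [← hp, h.poles_ncard])
  have hden : R.denom = rootPoly ξ :=
    eq_rootPoly_of_simple (RatFunc.monic_denom R) hξ (fun z => by rw [← hp]; rfl) h.poles_simple
  obtain ⟨hrn, hrd⟩ := isRealPoly_num_denom h.conj_symm
  have hcrit : ∀ j, R.denom.eval (x j : ℂ) ≠ 0 ∧ deriv (value R) (x j : ℂ) = 0 := fun j => by
    have : (x j : ℂ) ∈ {z | z ∉ poles R ∧ deriv (value R) z = 0} := by
      rw [h.critical]; exact ⟨j, rfl⟩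
    exact this
  have hne : ∀ k j, ξ k ≠ (x j : ℂ) := fun k j hk => by
    refine (hcrit j).1 ?_
    rw [← hk, hden]
    exact eval_rootPoly_eq_zero_iff.2 ⟨k, rfl⟩
  refine ⟨hξ, hden, hrn, hrd, hne, ?_⟩
  have hd : ∀ z, R.denom.eval z ≠ 0 → deriv (value R) z =
      (wronskian R.denom R.num).eval z / R.denom.eval z ^ 2 := fun z hz => by
    rw [value_eq_quot, (hasStrictDerivAt_quot hz).hasDerivAt.deriv]
  have hW0 : ∀ j, (wronskian R.denom R.num).eval (x j : ℂ) = 0 := fun j => by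
    have h1 := (hcrit j).2
    rw [hd _ (hcrit j).1, div_eq_zero_iff] at h1
    exact h1.resolve_right (pow_ne_zero 2 (hcrit j).1)
  have hdQ : R.denom.natDegree = m := by rw [hden, natDegree_rootPoly, Fintype.card_fin]
  have hdN : R.num.natDegree = n - m + 1 := by
    have := h.pole_infty
    rw [RatFunc.intDegree, hdQ] at this
    omega
  have hN0 : R.num ≠ 0 := fun h0 => by rw [h0, natDegree_zero] at hdN; omega
  have hWd : (wronskian R.denom R.num).natDegree = n := by
    rw [natDegree_wronskian hN0 R.denom_ne_zero (by omega)]; omega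
  have hWn : wronskian R.denom R.num ≠ 0 := fun h0 => by
    -- For n = 0 the degree does not exclude a zero Wronskian; then Q = 1 and N has degree 1, so N'
    -- ≠ 0.
    by_cases hn : n = 0
    · subst hn
      have hm : m = 0 := by omega
      subst hm
      have h1 : R.denom = 1 := by rw [hden]; simp [rootPoly]
      rw [h1] at h0
      have h2 : derivative R.num = 0 := by simpa [wronskian] using h0
      have := derivative_eq_zero.1 h2
      omega
    · rw [h0, natDegree_zero] at hWd; omega
  obtain ⟨c, hc, hcW⟩ := eq_C_mul_of_monic_dvd (monic_rootPoly fun j => (x j : ℂ)) hWn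
    (rootPoly_dvd (ofReal_injective_comp hx) hW0) (by rw [hWd, natDegree_rootPoly, Fintype.card_fin])
  have hcr : c.im = 0 := by
    have hWr : IsRealPoly (wronskian R.denom R.num) := by
      have := wronskian_map_conj R.denom R.num
      rw [hrn, hrd] at this
      exact this.symm
    have h1 := hWr.im_coeff n
    have h2 := monic_rootPoly fun j => (x j : ℂ)
    rw [Monic, leadingCoeff, natDegree_rootPoly, Fintype.card_fin] at h2
    rwa [hcW, coeff_C_mul, h2, mul_one] at h1
  obtain ⟨r, rfl⟩ : ∃ r : ℝ, c = r := ⟨c.re, Complex.ext rfl (by simpa using hcr)⟩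
  exact ⟨r, by exact_mod_cast hc, hcW⟩

/-- The poles of a rational function of the class `CR` solve the stationary relations. -/
theorem IsCR.isScreening_stationary {R : RatFunc ℂ} (hnm : 2 * m ≤ n) (hx : Function.Injective x)
    (h : IsCR m x R) (hp : poles R = range ξ) : IsScreening x ξ ∧ Stationary x ξ := by
  obtain ⟨hξ, hden, -, hrd, hne, c, hc, hW⟩ := h.data hnm hx hp
  refine ⟨⟨hξ, hne, fun k => ?_⟩, (stationary_iff_derivatives hξ hne).2 fun k => ?_⟩
  · have h1 : R.denom.eval ((starRingEnd ℂ) (ξ k)) = 0 := by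
      rw [hrd.eval_conj, hden, eval_rootPoly_eq_zero_iff.2 ⟨k, rfl⟩, map_zero]
    rw [hden] at h1
    obtain ⟨l, hl⟩ := eval_rootPoly_eq_zero_iff.1 h1
    exact ⟨l, hl.symm⟩
  · have h0 : (rootPoly ξ).eval (ξ k) = 0 := eval_rootPoly_eq_zero_iff.2 ⟨k, rfl⟩
    have h1 := congrArg (fun p => p.eval (ξ k)) hW
    have h2 := congrArg (fun p => (derivative p).eval (ξ k)) hW
    simp only [hden, wronskian, derivative_sub, derivative_mul, derivative_C, eval_sub, eval_add,
      eval_mul, h0, eval_C, zero_mul, zero_add, zero_sub] at h1 h2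
    have hc' : (c : ℂ) ≠ 0 := by exact_mod_cast hc
    -- At ξ_k, W = c P and W' = c P' become -Q' N = c P and -Q'' N = c P'; eliminating N gives the
    -- relation.
    refine mul_left_cancel₀ hc' ?_
    linear_combination (-(derivative (rootPoly ξ)).eval (ξ k)) * h2 +
      (derivative (derivative (rootPoly ξ))).eval (ξ k) * h1

/-- Stationary screening charges are the poles of a rational function with link pattern. -/
theorem exists_isLinkRational (hnm : 2 * m ≤ n) (hx : Function.Injective x)
    (hs : IsScreening x ξ) (hst : Stationary x ξ) : ∃ R, IsLinkRational x ξ R := by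
  set P := rootPoly fun j => (x j : ℂ) with hP
  set Q := rootPoly ξ with hQ
  have hPr : IsRealPoly P := isRealPoly_rootPoly_ofReal x
  have hQr : IsRealPoly Q := isRealPoly_rootPoly hs.injective hs.conj_mem
  obtain ⟨N₀, hN₀⟩ := exists_wronskian_eq hs.injective
    ((stationary_iff_derivatives hs.injective hs.ne_growth).1 hst)
  obtain ⟨N, hNr, hW⟩ := exists_real_wronskian_eq hQr hPr hN₀
  have hP0 : P ≠ 0 := (monic_rootPoly _).ne_zero
  have hQm : Q.Monic := monic_rootPoly _
  have hPd : P.natDegree = n := by rw [hP, natDegree_rootPoly, Fintype.card_fin]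
  have hQd : Q.natDegree = m := by rw [hQ, natDegree_rootPoly, Fintype.card_fin]
  have hN0 : N ≠ 0 := fun h => hP0 (by rw [← hW, h, wronskian_zero_right])
  -- The Wronskian has degree n < deg Q + deg N, hence deg N > n - m ≥ m = deg Q.
  have hlt : Q.natDegree < N.natDegree := by
    have := natDegree_wronskian_lt_add (hW ▸ hP0 : wronskian Q N ≠ 0)
    rw [hW] at this
    omega
  have hNd : N.natDegree = n + 1 - m := by
    have := natDegree_wronskian hN0 hQm.ne_zero hlt
    rw [hW, hPd, hQd] at this
    omega
  have hPξ : ∀ z, Q.eval z = 0 → P.eval z ≠ 0 := fun z hz hz' => by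
    obtain ⟨k, rfl⟩ := eval_rootPoly_eq_zero_iff.1 hz
    obtain ⟨j, hj⟩ := eval_rootPoly_eq_zero_iff.1 hz'
    exact hs.ne_growth k j hj
  have hco : ∀ z, N.eval z = 0 → Q.eval z ≠ 0 := fun z hz hz' => by
    refine hPξ z hz' ?_
    rw [← hW, wronskian, eval_sub, eval_mul, eval_mul, hz, hz']; ring
  have hPx : ∀ j, P.eval (x j : ℂ) = 0 := fun j => eval_rootPoly_eq_zero_iff.2 ⟨j, rfl⟩
  have hPx' : ∀ j, (derivative P).eval (x j : ℂ) ≠ 0 := fun j =>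
    (rootPoly_derivatives (ofReal_injective_comp hx) j).1
  have hQx : ∀ j, Q.eval (x j : ℂ) ≠ 0 := fun j hj => hPξ _ hj (hPx j)
  set R := algebraMap ℂ[X] (RatFunc ℂ) N / algebraMap ℂ[X] (RatFunc ℂ) Q with hR
  obtain ⟨hnum, hden⟩ := num_denom_div hQm hco
  rw [← hR] at hnum hden
  have hpoles : poles R = range ξ := by
    ext z
    have h1 : z ∈ poles R ↔ Q.eval z = 0 := by rw [← hden]; rfl
    rw [h1, eval_rootPoly_eq_zero_iff]
    simp [eq_comm]
  have hval : value R = quot N Q := by rw [value_eq_quot, hnum, hden]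
  have hmem : ∀ z, z ∈ poles R ↔ Q.eval z = 0 := fun z => by rw [← hden]; rfl
  have hderiv : ∀ z, Q.eval z ≠ 0 → deriv (quot N Q) z = P.eval z / Q.eval z ^ 2 := fun z hz => by
    rw [(hasStrictDerivAt_quot hz).hasDerivAt.deriv, hW]
  refine ⟨R, ⟨?_, ?_, ?_, ?_, ?_, ?_⟩, hpoles, ?_⟩
  · intro z
    rw [hval, quot, quot, hNr.eval_conj, hQr.eval_conj, map_div₀, Complex.conj_conj,
      Complex.conj_conj]
  · ext z
    rw [mem_ofPred_eq, hmem, hval]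
    constructor
    · rintro ⟨h1, h2⟩
      rw [hderiv z h1, div_eq_zero_iff, or_iff_left (pow_ne_zero 2 h1)] at h2
      obtain ⟨j, hj⟩ := eval_rootPoly_eq_zero_iff.1 h2
      exact ⟨j, hj.symm⟩
    · rintro ⟨j, rfl⟩
      exact ⟨hQx j, by simp only [hderiv _ (hQx j), hPx j, zero_div]⟩
  · intro j
    have h1 : deriv (value R) =ᶠ[𝓝 (x j : ℂ)] fun z => P.eval z / Q.eval z ^ 2 := by
      filter_upwards [eventually_ne_eval (hQx j)] with z hz
      rw [hval, hderiv z hz]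
    rw [h1.deriv_eq]
    have h2 := (P.hasDerivAt (x j : ℂ)).div ((Q.hasDerivAt (x j : ℂ)).pow 2) (pow_ne_zero 2 (hQx j))
    have h3 := h2.deriv
    simp only [hPx j] at h3
    have h4 : deriv (fun z => P.eval z / Q.eval z ^ 2) (x j : ℂ) =
        (derivative P).eval (x j : ℂ) * Q.eval (x j : ℂ) ^ 2 / (Q.eval (x j : ℂ) ^ 2) ^ 2 := by
      rw [show (fun z => P.eval z / Q.eval z ^ 2) =
        ((fun z => P.eval z) / (fun z => Q.eval z) ^ 2) from rfl, h3]
      simp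
    rw [h4]
    exact div_ne_zero (mul_ne_zero (hPx' j) (pow_ne_zero 2 (hQx j)))
      (pow_ne_zero 2 (pow_ne_zero 2 (hQx j)))
  · rw [hpoles, ← Set.image_univ, Set.ncard_image_of_injective _ hs.injective, Set.ncard_univ,
      Nat.card_fin]
  · intro z hz
    rw [hpoles] at hz
    obtain ⟨k, rfl⟩ := hz
    have h0 : Q.eval (ξ k) = 0 := eval_rootPoly_eq_zero_iff.2 ⟨k, rfl⟩
    have h1 := (rootPoly_derivatives hs.injective k).1
    rw [hden]
    refine le_antisymm ?_ ((rootMultiplicity_pos hQm.ne_zero).2 h0)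
    by_contra! hlt
    have := (one_lt_rootMultiplicity_iff_isRoot hQm.ne_zero).1 hlt
    exact h1 this.2
  · rw [RatFunc.intDegree, hnum, hden, hNd, hQd]
    omega
  · have hpen : IsPencil N Q := ⟨hNr, hQr, hco, fun z hz h0 => by
      rw [hW] at h0
      obtain ⟨j, rfl⟩ := eval_rootPoly_eq_zero_iff.1 h0
      simp at hz⟩
    refine hpen.formsLinkPattern hnm hx ?_ ?_ ?_ hQx (by omega) fun z _ => ?_
    · rw [hW]; exact fun z hz => eval_rootPoly_eq_zero_iff.1 hz
    · rw [hW]; exact hPx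
    · rw [hW]; exact hPx'
    · have h1 : z ∈ realLocus R ↔ Q.eval z = 0 ∨ (quot N Q z).im = 0 := by
        rw [← hmem, ← hval]; rfl
      rw [h1]
      by_cases hz : Q.eval z = 0
      · simp [hz, locus]
      · rw [or_iff_right hz, mem_locus_iff hz]

theorem exists_perm_of_range_subset (hξ' : Function.Injective ξ')
    (h : ∀ k, ∃ l, ξ' k = ξ l) : ∃ π : Equiv.Perm (Fin m), ξ' = ξ ∘ π := by
  choose ρ hρ using h
  have hinj : Function.Injective ρ := fun i j hij => hξ' (by rw [hρ, hρ, hij])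
  exact ⟨Equiv.ofBijective ρ (Finite.injective_iff_bijective.1 hinj), funext hρ⟩

theorem poles_affine_subset (R : RatFunc ℂ) (a b : ℂ) :
    poles (RatFunc.C a * R + RatFunc.C b) ⊆ poles R := by
  intro z hz
  have h1 := RatFunc.denom_add_dvd (RatFunc.C a * R) (RatFunc.C b)
  have h2 := RatFunc.denom_mul_dvd (RatFunc.C a) R
  rw [RatFunc.denom_C, one_mul] at h2
  rw [RatFunc.denom_C, mul_one] at h1
  obtain ⟨p, hp⟩ := h1.trans h2
  rw [poles, mem_ofPred_eq] at hz ⊢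
  rw [hp, eval_mul, hz, zero_mul]

/-- Affine maps create no poles. Conversely, equal poles give equal denominators Q and Wronskians c
P and c' P, so the second numerator minus c' / c times the first has zero Wronskian with Q and is a
multiple of Q, real by reality of coefficients. -/
theorem IsLinkRational.realAffineEquiv_iff (hnm : 2 * m ≤ n) (hx : Function.Injective x)
    {R R' : RatFunc ℂ} (h : IsLinkRational x ξ R) (h' : IsLinkRational x ξ' R') :
    RealAffineEquiv R R' ↔ ∃ π : Equiv.Perm (Fin m), ξ' = ξ ∘ π := by
  obtain ⟨hξ, hden, hrn, hrd, -, c, hc, hW⟩ := h.isCR.data hnm hx h.poles_eq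
  obtain ⟨hξ', hden', hrn', hrd', -, c', hc', hW'⟩ := h'.isCR.data hnm hx h'.poles_eq
  constructor
  · rintro ⟨a, b, -, rfl⟩
    refine exists_perm_of_range_subset hξ' fun k => ?_
    have h1 : ξ' k ∈ poles R := by
      refine poles_affine_subset R a b ?_
      rw [h'.poles_eq]
      exact ⟨k, rfl⟩
    rw [h.poles_eq] at h1
    obtain ⟨l, hl⟩ := h1
    exact ⟨l, hl.symm⟩
  · rintro ⟨π, rfl⟩
    have hQ : R'.denom = R.denom := by
      rw [hden, hden', rootPoly, rootPoly]
      exact Equiv.prod_comp π fun i => X - C (ξ i)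
    have hc0 : (c : ℂ) ≠ 0 := by exact_mod_cast hc
    obtain ⟨b, hb⟩ := exists_eq_C_mul_of_wronskian_eq_zero hξ
      (M := R'.num - C ((c' / c : ℝ) : ℂ) * R.num) (by
        rw [← hden]
        have h1 : wronskian R.denom (R'.num - C ((c' / c : ℝ) : ℂ) * R.num) =
            wronskian R'.denom R'.num - C ((c' / c : ℝ) : ℂ) * wronskian R.denom R.num := by
          rw [hQ]
          simp only [wronskian, derivative_sub, derivative_mul, derivative_C]
          ring
        rw [h1, hW, hW', ← mul_assoc, ← C_mul]
        push_cast
        rw [div_mul_cancel₀ _ hc0, sub_self])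
    have hbr : b.im = 0 := by
      have h1 : IsRealPoly (C b * rootPoly ξ) := by
        rw [← hb]; exact hrn'.sub ((isRealPoly_C _).mul hrn)
      have h2 := h1.im_coeff (rootPoly ξ).natDegree
      rwa [coeff_C_mul, show (rootPoly ξ).coeff (rootPoly ξ).natDegree = 1 from monic_rootPoly ξ,
        mul_one] at h2
    obtain ⟨r, rfl⟩ : ∃ r : ℝ, b = r := ⟨b.re, Complex.ext rfl (by simpa using hbr)⟩
    refine ⟨c' / c, r, div_ne_zero hc' hc, ?_⟩
    have hd0 : algebraMap ℂ[X] (RatFunc ℂ) R.denom ≠ 0 :=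
      RatFunc.algebraMap_ne_zero R.denom_ne_zero
    conv_lhs => rw [← RatFunc.num_div_denom R']
    conv_rhs => rw [← RatFunc.num_div_denom R]
    rw [hQ, div_eq_iff hd0, add_mul, mul_assoc, div_mul_cancel₀ _ hd0, ← RatFunc.algebraMap_C,
      ← RatFunc.algebraMap_C, ← map_mul, ← map_mul, ← map_add]
    congr 1
    rw [hden, ← hb]; ring

/-- The charges are determined up to order by the initial speeds of the growth points. -/
theorem exists_perm_of_sum_eq (hnm : 2 * m ≤ n) (hx : Function.Injective x)
    (h : IsScreening x ξ) (h' : IsScreening x ξ')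
    (hsum : ∀ j, ∑ l, 1 / ((x j : ℂ) - ξ l) = ∑ l, 1 / ((x j : ℂ) - ξ' l)) :
    ∃ π : Equiv.Perm (Fin m), ξ' = ξ ∘ π := by
  have hW : wronskian (rootPoly ξ) (rootPoly ξ') = 0 := by
    by_contra hW
    have h1 := natDegree_wronskian_lt_add hW
    -- Equal logarithmic derivatives at each x_j make the Wronskian vanish at n points, but its
    -- degree is below 2 m ≤ n.
    have h2 : rootPoly (fun j => (x j : ℂ)) ∣ wronskian (rootPoly ξ) (rootPoly ξ') := by
      refine rootPoly_dvd (ofReal_injective_comp hx) fun j => ?_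
      rw [wronskian, eval_sub, eval_mul, eval_mul,
        eval_derivative_rootPoly fun l => (h.ne_growth l j).symm,
        eval_derivative_rootPoly fun l => (h'.ne_growth l j).symm, hsum j]
      ring
    have h3 := natDegree_le_of_dvd h2 hW
    simp only [natDegree_rootPoly, Fintype.card_fin] at h1 h3
    omega
  obtain ⟨c, hc⟩ := exists_eq_C_mul_of_wronskian_eq_zero h.injective hW
  refine exists_perm_of_range_subset h'.injective fun k => ?_
  have h1 : (rootPoly ξ').eval (ξ' k) = 0 := eval_rootPoly_eq_zero_iff.2 ⟨k, rfl⟩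
  have hc0 : c ≠ 0 := fun h0 => (monic_rootPoly ξ').ne_zero (by rw [hc, h0]; simp)
  rw [hc, eval_mul, eval_C, mul_eq_zero, or_iff_right hc0] at h1
  exact eval_rootPoly_eq_zero_iff.1 h1

end CR

/-! ### Ordinary differential equations driven by integrable rates -/

/-- The rates may be unbounded, so short times are measured by the integral of the rate, which is
continuous in its upper end. -/
theorem exists_Icc_integral_le {W : ℝ → ℝ} {a b ε : ℝ} (hab : a < b) (hε : 0 < ε)
    (hW : IntervalIntegrable W MeasureTheory.volume a b) :
    ∃ c, a < c ∧ c ≤ b ∧ ∀ q ∈ Icc a c, ∫ r in a..q, W r ≤ ε := by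
  have h1 := intervalIntegral.continuousOn_primitive_interval' hW left_mem_uIcc
  have h2 : ContinuousWithinAt (fun q => ∫ r in a..q, W r) (Icc a b) a := by
    rw [← uIcc_of_le hab.le]; exact h1 a left_mem_uIcc
  have h3 : ∀ᶠ q in 𝓝[≥] a, ∫ r in a..q, W r < ε := by
    rw [← nhdsWithin_Icc_eq_nhdsGE hab]
    refine h2.eventually_lt continuousWithinAt_const ?_
    simpa using hε
  obtain ⟨c, hc, hcs⟩ := mem_nhdsGE_iff_exists_Icc_subset.1 h3
  refine ⟨min c b, lt_min hc hab, min_le_right _ _, fun q hq => ?_⟩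
  exact (hcs ⟨hq.1, hq.2.trans (min_le_left _ _)⟩ : _ < ε).le

/-- A version of Grönwall's inequality. -/
theorem eq_zero_of_le_integral {u W : ℝ → ℝ} {t : ℝ} (hu : ContinuousOn u (Icc 0 t))
    (hu0 : ∀ s, 0 ≤ u s) (h0 : u 0 = 0) (hW0 : ∀ s ∈ Icc 0 t, 0 ≤ W s)
    (hW : IntervalIntegrable W MeasureTheory.volume 0 t)
    (h : ∀ r s, 0 ≤ r → r ≤ s → s ≤ t → u s ≤ u r + ∫ q in r..s, W q * u q) :
    ∀ s ∈ Icc 0 t, u s = 0 := by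
  have hcl : IsClosed ({s | u s = 0} ∩ Icc 0 t) := by
    have := hu.preimage_isClosed_of_isClosed isClosed_Icc (isClosed_singleton (x := (0 : ℝ)))
    rwa [inter_comm] at this
  refine fun s hs => hcl.Icc_subset_of_forall_exists_gt h0 ?_ hs
  rintro a ⟨ha0, ha⟩ b (hb : a < b)
  have ht : 0 ≤ t := ha.1.trans ha.2.le
  have hsub : ∀ {p q}, 0 ≤ p → p ≤ q → q ≤ t → IntervalIntegrable W MeasureTheory.volume p q :=
    fun hp hpq hq => hW.mono_set (by
      rw [uIcc_of_le hpq, uIcc_of_le ht]; exact Icc_subset_Icc hp hq)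
  -- Where the integral of W is at most 1 / 2, the maximum of u is at most half of itself, so the
  -- zero set extends to the right.
  obtain ⟨c, hac, hcb, hc⟩ := exists_Icc_integral_le (lt_min hb ha.2) (half_pos one_pos)
    (hsub ha.1 (lt_min hb ha.2).le (min_le_right _ _))
  have hct : c ≤ t := hcb.trans (min_le_right _ _)
  refine ⟨c, ?_, hac, hcb.trans (min_le_left _ _)⟩
  have huc : ContinuousOn u (Icc a c) := hu.mono (Icc_subset_Icc ha.1 hct)
  obtain ⟨q, hq, hmax⟩ := isCompact_Icc.exists_isMaxOn (nonempty_Icc.2 hac.le) huc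
  have h1 := h a q ha.1 hq.1 (hq.2.trans hct)
  rw [show u a = 0 from ha0, zero_add] at h1
  have hWq := hsub ha.1 hq.1 (hq.2.trans hct)
  have h2 : ∫ r in a..q, W r * u r ≤ ∫ r in a..q, W r * u q := by
    refine intervalIntegral.integral_mono_on hq.1 ?_ (hWq.mul_const _) fun r hr => ?_
    · refine hWq.mul_continuousOn (huc.mono ?_)
      rw [uIcc_of_le hq.1]; exact Icc_subset_Icc_right hq.2
    · exact mul_le_mul_of_nonneg_left (hmax ⟨hr.1, hr.2.trans hq.2⟩)
        (hW0 r ⟨ha.1.trans hr.1, hr.2.trans (hq.2.trans hct)⟩)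
  rw [intervalIntegral.integral_mul_const] at h2
  have h3 := mul_le_mul_of_nonneg_right (hc q hq) (hu0 q)
  have h4 := hu0 q
  have h5 : u c ≤ u q := hmax (right_mem_Icc.2 hac.le)
  exact le_antisymm (by linarith) (hu0 c)

section Rates

variable {n : ℕ} {ν : Fin n → ℝ → ℝ}

theorem IsParametrization.intervalIntegrable (hν : IsParametrization ν) (a : Fin n) {r s : ℝ}
    (hr : 0 ≤ r) (hs : 0 ≤ s) : IntervalIntegrable (ν a) MeasureTheory.volume r s :=
  (hν.integrable a r hr).symm.trans (hν.integrable a s hs)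

theorem IsParametrization.intervalIntegrable_sum (hν : IsParametrization ν) {r s : ℝ}
    (hr : 0 ≤ r) (hs : 0 ≤ s) :
    IntervalIntegrable (fun q => ∑ a, ν a q) MeasureTheory.volume r s := by
  have := IntervalIntegrable.sum Finset.univ (f := ν) fun a _ => hν.intervalIntegrable a hr hs
  exact this.congr fun q _ => by simp

theorem IsParametrization.intervalIntegrable_mul (hν : IsParametrization ν) {t : ℝ}
    {f : Fin n → ℝ → ℂ} (hf : ∀ a, ContinuousOn (f a) (Icc 0 t)) {r s : ℝ}
    (hr : r ∈ Icc 0 t) (hs : s ∈ Icc 0 t) :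
    IntervalIntegrable (fun q => ∑ a, (ν a q : ℂ) * f a q) MeasureTheory.volume r s := by
  have := IntervalIntegrable.sum Finset.univ (f := fun a q => (ν a q : ℂ) * f a q)
    (a := r) (b := s) (μ := MeasureTheory.volume) fun a _ => by
      have h1 := hν.intervalIntegrable a hr.1 hs.1
      have h2 : IntervalIntegrable (fun q => (ν a q : ℂ)) MeasureTheory.volume r s :=
        ⟨h1.1.ofReal, h1.2.ofReal⟩
      refine h2.mul_continuousOn ((hf a).mono ?_)
      exact (ordConnected_Icc).uIcc_subset hr hs
  exact this.congr fun q _ => by simp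

theorem IsParametrization.norm_sum_le (hν : IsParametrization ν) {q : ℝ} (hq : 0 ≤ q)
    {v : Fin n → ℂ} {C : ℝ} (hv : ∀ a, ‖v a‖ ≤ C) :
    ‖∑ a, (ν a q : ℂ) * v a‖ ≤ (∑ a, ν a q) * C := by
  rw [Finset.sum_mul]
  refine norm_sum_le_of_le _ fun a _ => ?_
  rw [norm_mul, Complex.norm_real, Real.norm_of_nonneg (hν.nonneg a q hq)]
  exact mul_le_mul_of_nonneg_left (hv a) (hν.nonneg a q hq)

theorem eqOn_of_integral_eq {ι : Type*} [Fintype ι] (hν : IsParametrization ν) {t C : ℝ}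
    {y z : ℝ → ι → ℂ} {y₀ : ι → ℂ} {f g : ι → Fin n → ℝ → ℂ} (hC0 : 0 ≤ C)
    (hf : ∀ i a, ContinuousOn (f i a) (Icc 0 t)) (hg : ∀ i a, ContinuousOn (g i a) (Icc 0 t))
    (hyc : ContinuousOn y (Icc 0 t)) (hzc : ContinuousOn z (Icc 0 t))
    (hy : ∀ s ∈ Icc 0 t, ∀ i, y s i = y₀ i + ∫ r in (0 : ℝ)..s, ∑ a, (ν a r : ℂ) * f i a r)
    (hz : ∀ s ∈ Icc 0 t, ∀ i, z s i = y₀ i + ∫ r in (0 : ℝ)..s, ∑ a, (ν a r : ℂ) * g i a r)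
    (hC : ∀ s ∈ Icc 0 t, ∀ i a, ‖f i a s - g i a s‖ ≤ C * ‖y s - z s‖) :
    ∀ s ∈ Icc 0 t, y s = z s := by
  intro s hs
  have ht : 0 ≤ t := hs.1.trans hs.2
  have h0 : (0 : ℝ) ∈ Icc 0 t := ⟨le_rfl, ht⟩
  have hnorm : ContinuousOn (fun s => ‖y s - z s‖) (Icc 0 t) := (hyc.sub hzc).norm
  refine sub_eq_zero.1 (norm_eq_zero.1 (eq_zero_of_le_integral
    (u := fun s => ‖y s - z s‖) (W := fun s => (∑ a, ν a s) * C) hnorm (fun s => norm_nonneg _)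
    ?_ ?_ ?_ ?_ s hs))
  · have : y 0 = z 0 := by
      funext i; rw [hy 0 h0, hz 0 h0]; simp
    simp [this]
  · exact fun q hq => mul_nonneg (Finset.sum_nonneg fun a _ => hν.nonneg a q hq.1) hC0
  · exact (hν.intervalIntegrable_sum le_rfl ht).mul_const _
  · intro p q hp hpq hqt
    have hp' : p ∈ Icc 0 t := ⟨hp, hpq.trans hqt⟩
    have hq' : q ∈ Icc 0 t := ⟨hp.trans hpq, hqt⟩
    have hint : IntervalIntegrable (fun r => (∑ a, ν a r) * C * ‖y r - z r‖)
        MeasureTheory.volume p q := by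
      refine ((hν.intervalIntegrable_sum hp'.1 hq'.1).mul_const _).mul_continuousOn (hnorm.mono ?_)
      exact ordConnected_Icc.uIcc_subset hp' hq'
    have hnn : 0 ≤ ∫ r in p..q, (∑ a, ν a r) * C * ‖y r - z r‖ :=
      intervalIntegral.integral_nonneg hpq fun r hr =>
        mul_nonneg (mul_nonneg (Finset.sum_nonneg fun a _ => hν.nonneg a r (hp.trans hr.1)) hC0)
          (norm_nonneg _)
    refine (pi_norm_le_iff_of_nonneg (add_nonneg (norm_nonneg _) hnn)).2 fun i => ?_
    have e1 : ∀ {F : Fin n → ℝ → ℂ}, (∀ a, ContinuousOn (F a) (Icc 0 t)) →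
        (∫ r in (0 : ℝ)..q, ∑ a, (ν a r : ℂ) * F a r) =
          (∫ r in (0 : ℝ)..p, ∑ a, (ν a r : ℂ) * F a r) +
            ∫ r in p..q, ∑ a, (ν a r : ℂ) * F a r := fun hF =>
      (intervalIntegral.integral_add_adjacent_intervals (hν.intervalIntegrable_mul hF h0 hp')
        (hν.intervalIntegrable_mul hF hp' hq')).symm
    have e2 : (y q - z q) i = (y p - z p) i +
        ∫ r in p..q, ∑ a, (ν a r : ℂ) * (f i a r - g i a r) := by
      simp only [mul_sub, Finset.sum_sub_distrib]
      rw [intervalIntegral.integral_sub (hν.intervalIntegrable_mul (hf i) hp' hq')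
        (hν.intervalIntegrable_mul (hg i) hp' hq'), Pi.sub_apply, Pi.sub_apply, hy q hq', hz q hq',
        hy p hp', hz p hp', e1 (hf i), e1 (hg i)]
      ring
    rw [e2]
    refine (norm_add_le _ _).trans (add_le_add (norm_le_pi_norm _ i) ?_)
    refine intervalIntegral.norm_integral_le_of_norm_le hpq (MeasureTheory.ae_of_all _ fun r hr => ?_) hint
    rw [mul_assoc]
    exact hν.norm_sum_le (hp.trans hr.1.le) fun a =>
      hC r ⟨hp.trans hr.1.le, hr.2.trans hqt⟩ i a

/-- Picard iteration on continuous paths in the closed ball, over an interval on which the total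
rate has small integral. -/
theorem exists_local_solution {ι : Type*} [Fintype ι] (hν : IsParametrization ν)
    {V : Fin n → (ι → ℂ) → ι → ℂ} {y₀ : ι → ℂ} {ρ C : ℝ} (hρ : 0 < ρ) (hC0 : 0 ≤ C)
    (hV : ∀ y ∈ Metric.closedBall y₀ ρ, ∀ z ∈ Metric.closedBall y₀ ρ, ∀ a i,
      ‖V a y i - V a z i‖ ≤ C * ‖y - z‖) :
    ∃ T > 0, ∃ y : ℝ → ι → ℂ, ContinuousOn y (Icc 0 T) ∧
      (∀ s ∈ Icc 0 T, y s ∈ Metric.closedBall y₀ ρ) ∧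
      ∀ s ∈ Icc 0 T, ∀ i, y s i = y₀ i + ∫ r in (0 : ℝ)..s, ∑ a, (ν a r : ℂ) * V a (y r) i := by
  set B := Metric.closedBall y₀ ρ with hB
  have hy₀ : y₀ ∈ B := Metric.mem_closedBall_self hρ.le
  set M : ℝ := C * ρ + ‖fun a => V a y₀‖ with hM
  have hM0 : 0 ≤ M := add_nonneg (mul_nonneg hC0 hρ.le) (norm_nonneg _)
  have hVM : ∀ y ∈ B, ∀ a i, ‖V a y i‖ ≤ M := by
    intro y hy a i
    have h1 := hV y hy y₀ hy₀ a i
    have h2 : ‖V a y₀ i‖ ≤ ‖fun a => V a y₀‖ :=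
      (norm_le_pi_norm (V a y₀) i).trans (norm_le_pi_norm (fun a => V a y₀) a)
    have h3 : C * ‖y - y₀‖ ≤ C * ρ :=
      mul_le_mul_of_nonneg_left (by simpa [hB, dist_eq_norm] using hy) hC0
    calc ‖V a y i‖ = ‖(V a y i - V a y₀ i) + V a y₀ i‖ := by rw [sub_add_cancel]
      _ ≤ _ := norm_add_le _ _
      _ ≤ M := add_le_add (h1.trans h3) h2
  -- The first bound keeps the iterates in the ball (ε M ≤ ρ), the second makes the map a
  -- contraction (ε C ≤ 1 / 2).
  set ε : ℝ := min (ρ / (M + 1)) (1 / (2 * (C + 1))) with hε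
  have hε0 : 0 < ε := lt_min (by positivity) (by positivity)
  have hεM : ε * M ≤ ρ := by
    have : ε * M ≤ ρ / (M + 1) * (M + 1) :=
      mul_le_mul (min_le_left _ _) (by linarith) hM0 (by positivity)
    rwa [div_mul_cancel₀ _ (by positivity)] at this
  have hεC : ε * C ≤ 1 / 2 := by
    have : ε * C ≤ 1 / (2 * (C + 1)) * (C + 1) :=
      mul_le_mul (min_le_right _ _) (by linarith) hC0 (by positivity)
    have h2 : 1 / (2 * (C + 1)) * (C + 1) = 1 / 2 := by field_simp
    linarith
  obtain ⟨T, hT, -, hTε⟩ := exists_Icc_integral_le one_pos hε0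
    (hν.intervalIntegrable_sum le_rfl zero_le_one)
  have hW0 : ∀ s ∈ Icc 0 T, 0 ≤ ∫ r in (0 : ℝ)..s, ∑ a, ν a r := fun s hs =>
    intervalIntegral.integral_nonneg hs.1 fun r hr =>
      Finset.sum_nonneg fun a _ => hν.nonneg a r hr.1
  have hVc : ∀ a i, ContinuousOn (fun y => V a y i) B := fun a i => by
    refine LipschitzOnWith.continuousOn (K := ⟨C, hC0⟩) (LipschitzOnWith.of_dist_le_mul ?_)
    intro y hy z hz
    rw [dist_eq_norm, dist_eq_norm]
    exact hV y hy z hz a i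
  let ext : C(Icc (0 : ℝ) T, B) → ℝ → B := fun f s => f (projIcc 0 T hT.le s)
  have hext : ∀ f i a, ContinuousOn (fun s => V a (ext f s : ι → ℂ) i) (Icc 0 T) := fun f i a => by
    refine (hVc a i).comp (Continuous.continuousOn ?_) fun s _ => (ext f s).2
    exact continuous_subtype_val.comp (f.continuous.comp continuous_projIcc)
  let Φ : C(Icc (0 : ℝ) T, B) → ℝ → ι → ℂ := fun f s i =>
    y₀ i + ∫ r in (0 : ℝ)..s, ∑ a, (ν a r : ℂ) * V a (ext f r : ι → ℂ) i
  have h0T : (0 : ℝ) ∈ Icc 0 T := ⟨le_rfl, hT.le⟩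
  have hΦB : ∀ f, ∀ s ∈ Icc 0 T, Φ f s ∈ B := by
    intro f s hs
    rw [hB, mem_closedBall_iff_norm, pi_norm_le_iff_of_nonneg hρ.le]
    intro i
    have h1 : (Φ f s - y₀) i = ∫ r in (0 : ℝ)..s, ∑ a, (ν a r : ℂ) * V a (ext f r : ι → ℂ) i := by
      simp [Φ]
    rw [h1]
    refine (intervalIntegral.norm_integral_le_of_norm_le (g := fun r => (∑ a, ν a r) * M) hs.1
      (MeasureTheory.ae_of_all _ fun r hr => hν.norm_sum_le hr.1.le fun a => hVM _ (ext f r).2 a i)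
      ((hν.intervalIntegrable_sum le_rfl hs.1).mul_const _)).trans ?_
    rw [intervalIntegral.integral_mul_const]
    exact (mul_le_mul_of_nonneg_right (hTε s hs) hM0).trans hεM
  have hΦc : ∀ f, ContinuousOn (Φ f) (Icc 0 T) := by
    intro f
    refine continuousOn_pi.2 fun i => continuousOn_const.add ?_
    rw [← uIcc_of_le hT.le]
    exact intervalIntegral.continuousOn_primitive_interval'
      (hν.intervalIntegrable_mul (hext f i) h0T (right_mem_Icc.2 hT.le)) left_mem_uIcc
  let Ψ : C(Icc (0 : ℝ) T, B) → C(Icc (0 : ℝ) T, B) := fun f =>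
    ⟨fun s => ⟨Φ f s, hΦB f s s.2⟩, Continuous.subtype_mk
      (continuousOn_iff_continuous_domRestrict.1 (hΦc f)) _⟩
  have hΨ : ContractingWith (1 / 2) Ψ := by
    refine ⟨by norm_num, LipschitzWith.of_dist_le_mul fun f g => ?_⟩
    have hd : 0 ≤ dist f g := dist_nonneg
    rw [ContinuousMap.dist_le (by positivity)]
    intro s
    rw [Subtype.dist_eq, dist_eq_norm, pi_norm_le_iff_of_nonneg (by positivity)]
    intro i
    have h1 : (Φ f s - Φ g s) i = ∫ r in (0 : ℝ)..s, ∑ a, (ν a r : ℂ) *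
        (V a (ext f r : ι → ℂ) i - V a (ext g r : ι → ℂ) i) := by
      simp only [mul_sub, Finset.sum_sub_distrib]
      rw [intervalIntegral.integral_sub (hν.intervalIntegrable_mul (hext f i) h0T s.2)
        (hν.intervalIntegrable_mul (hext g i) h0T s.2)]
      simp [Φ]
    change ‖(Φ f s - Φ g s) i‖ ≤ _
    rw [h1]
    have h2 : ∀ r a, ‖V a (ext f r : ι → ℂ) i - V a (ext g r : ι → ℂ) i‖ ≤ C * dist f g :=
      fun r a => by
        refine (hV _ (ext f r).2 _ (ext g r).2 a i).trans (mul_le_mul_of_nonneg_left ?_ hC0)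
        rw [← dist_eq_norm, ← Subtype.dist_eq]
        exact ContinuousMap.dist_apply_le_dist _
    refine (intervalIntegral.norm_integral_le_of_norm_le
      (g := fun r => (∑ a, ν a r) * (C * dist f g)) s.2.1
      (MeasureTheory.ae_of_all _ fun r hr => hν.norm_sum_le hr.1.le fun a => h2 r a)
      ((hν.intervalIntegrable_sum le_rfl s.2.1).mul_const _)).trans ?_
    rw [intervalIntegral.integral_mul_const]
    refine (mul_le_mul_of_nonneg_right (hTε s s.2) (mul_nonneg hC0 hd)).trans ?_
    rw [← mul_assoc]
    refine (mul_le_mul_of_nonneg_right hεC hd).trans (le_of_eq ?_)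
    norm_num
  have : CompleteSpace B := Metric.isClosed_closedBall.completeSpace_coe
  have : Nonempty C(Icc (0 : ℝ) T, B) := ⟨ContinuousMap.const _ ⟨y₀, hy₀⟩⟩
  obtain ⟨f, hf⟩ : ∃ f, Ψ f = f := ⟨_, hΨ.fixedPoint_isFixedPt⟩
  have hfs : ∀ s (hs : s ∈ Icc 0 T), (ext f s : ι → ℂ) = Φ f s := fun s hs => by
    have h1 := congrArg (fun g : C(Icc (0 : ℝ) T, B) => (g ⟨s, hs⟩ : ι → ℂ)) hf
    change Φ f s = (f ⟨s, hs⟩ : ι → ℂ) at h1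
    rw [h1]
    change (f (projIcc 0 T hT.le s) : ι → ℂ) = _
    rw [projIcc_of_mem hT.le hs]
  refine ⟨T, hT, fun s => ext f s, ?_, fun s _ => (ext f s).2, fun s hs i => ?_⟩
  · exact (hΦc f).congr hfs
  · change (ext f s : ι → ℂ) i = _
    rw [hfs s hs]

end Rates

/-! ### The Loewner vector fields -/

section Field

variable {n m : ℕ}

/-- The velocity of growth points and charges when only the growth point `a` is active. -/
noncomputable def loewnerField (a : Fin n) (y : Fin n ⊕ Fin m → ℂ) : Fin n ⊕ Fin m → ℂ :=
  Sum.elim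
    (fun j => if j = a then
      ∑ k ∈ Finset.univ.erase a, 2 / (y (Sum.inl a) - y (Sum.inl k)) -
        ∑ l, 4 / (y (Sum.inl a) - y (Sum.inr l))
      else 2 / (y (Sum.inl j) - y (Sum.inl a)))
    fun l => 2 / (y (Sum.inr l) - y (Sum.inl a))

/-- Growth points are `δ`-separated from each other and from the charges. -/
def IsSeparated (δ : ℝ) (y : Fin n ⊕ Fin m → ℂ) : Prop :=
  ∀ (j : Fin n) (p : Fin n ⊕ Fin m), p ≠ Sum.inl j → δ ≤ ‖y (Sum.inl j) - y p‖

theorem norm_div_sub_div_le {c p q : ℂ} {δ D : ℝ} (hδ : 0 < δ) (hp : δ ≤ ‖p‖) (hq : δ ≤ ‖q‖)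
    (hpq : ‖p - q‖ ≤ D) : ‖c / p - c / q‖ ≤ ‖c‖ * D / δ ^ 2 := by
  have hp0 : p ≠ 0 := norm_pos_iff.1 (hδ.trans_le hp)
  have hq0 : q ≠ 0 := norm_pos_iff.1 (hδ.trans_le hq)
  have h1 : c / p - c / q = c * (q - p) / (p * q) := by field_simp
  rw [h1, norm_div, norm_mul, norm_mul, norm_sub_rev]
  have h2 : δ ^ 2 ≤ ‖p‖ * ‖q‖ := by
    rw [sq]; exact mul_le_mul hp hq hδ.le (norm_nonneg _)
  exact div_le_div₀ (mul_nonneg (norm_nonneg _) ((norm_nonneg _).trans hpq))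
    (mul_le_mul_of_nonneg_left hpq (norm_nonneg _)) (by positivity) h2

/-- Each component is a combination of at most n + m quotients with numerators of norm at most 4,
each Lipschitz with constant 4 · 2 / δ ^ 2. The extra 1 covers the components with a single
quotient. -/
theorem norm_loewnerField_sub_le {δ : ℝ} (hδ : 0 < δ) {y z : Fin n ⊕ Fin m → ℂ}
    (hy : IsSeparated δ y) (hz : IsSeparated δ z) (a : Fin n) (i : Fin n ⊕ Fin m) :
    ‖loewnerField a y i - loewnerField a z i‖ ≤ (n + m + 1) * (8 / δ ^ 2) * ‖y - z‖ := by
  set K : ℝ := 8 / δ ^ 2 * ‖y - z‖ with hK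
  have hK0 : 0 ≤ K := by positivity
  have hdiff : ∀ p q : Fin n ⊕ Fin m, ‖(y p - y q) - (z p - z q)‖ ≤ 2 * ‖y - z‖ := fun p q => by
    have h1 := norm_le_pi_norm (y - z) p
    have h2 := norm_le_pi_norm (y - z) q
    rw [Pi.sub_apply] at h1 h2
    calc _ = ‖(y p - z p) - (y q - z q)‖ := by congr 1; ring
      _ ≤ _ := norm_sub_le _ _
      _ ≤ _ := by linarith
  have hterm : ∀ (c : ℂ) (p q : Fin n ⊕ Fin m), ‖c‖ ≤ 4 → δ ≤ ‖y p - y q‖ → δ ≤ ‖z p - z q‖ →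
      ‖c / (y p - y q) - c / (z p - z q)‖ ≤ K := fun c p q hc h1 h2 => by
    refine (norm_div_sub_div_le hδ h1 h2 (hdiff p q)).trans ?_
    rw [hK, div_mul_eq_mul_div]
    refine div_le_div_of_nonneg_right ?_ (by positivity)
    nlinarith [norm_nonneg (y - z)]
  have hle : K ≤ (n + m + 1) * K := by
    have : (0 : ℝ) ≤ (n + m : ℝ) * K := by positivity
    linarith
  have h2 : ‖(2 : ℂ)‖ ≤ 4 := by norm_num
  have h4 : ‖(4 : ℂ)‖ ≤ 4 := by norm_num
  rw [mul_assoc, ← hK]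
  rcases i with j | l
  · by_cases hj : j = a
    · subst hj
      simp only [loewnerField, Sum.elim_inl, if_true]
      rw [sub_sub_sub_comm, ← Finset.sum_sub_distrib, ← Finset.sum_sub_distrib]
      refine (norm_sub_le _ _).trans ?_
      have e1 := norm_sum_le_of_le (s := Finset.univ.erase j)
        (f := fun k => 2 / (y (Sum.inl j) - y (Sum.inl k)) - 2 / (z (Sum.inl j) - z (Sum.inl k)))
        fun k hk => hterm 2 (Sum.inl j) (Sum.inl k) h2
          (hy j _ fun h => Finset.ne_of_mem_erase hk (Sum.inl_injective h))
          (hz j _ fun h => Finset.ne_of_mem_erase hk (Sum.inl_injective h))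
      have e2 := norm_sum_le_of_le (s := Finset.univ)
        (f := fun l => 4 / (y (Sum.inl j) - y (Sum.inr l)) - 4 / (z (Sum.inl j) - z (Sum.inr l)))
        fun l _ => hterm 4 (Sum.inl j) (Sum.inr l) h4 (hy j _ Sum.inr_ne_inl)
          (hz j _ Sum.inr_ne_inl)
      rw [Finset.sum_const, nsmul_eq_mul] at e1 e2
      have e3 : (((Finset.univ.erase j).card : ℕ) : ℝ) ≤ n := by
        have := (Finset.card_erase_le (s := Finset.univ) (a := j))
        rw [Finset.card_univ, Fintype.card_fin] at this
        exact_mod_cast this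
      have e4 := mul_le_mul_of_nonneg_right e3 hK0
      rw [Finset.card_univ, Fintype.card_fin] at e2
      linarith
    · simp only [loewnerField, Sum.elim_inl, if_neg hj]
      refine (hterm 2 _ _ h2 ?_ ?_).trans hle
      · exact hy j _ fun h => hj (Sum.inl_injective h).symm
      · exact hz j _ fun h => hj (Sum.inl_injective h).symm
  · simp only [loewnerField, Sum.elim_inr]
    refine (hterm 2 _ _ h2 ?_ ?_).trans hle
    · rw [norm_sub_rev]; exact hy a _ Sum.inr_ne_inl
    · rw [norm_sub_rev]; exact hz a _ Sum.inr_ne_inl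

theorem exists_pos_forall_le {ι : Type*} [Finite ι] {g : ι → ℝ} (hg : ∀ i, 0 < g i) :
    ∃ δ > 0, ∀ i, δ ≤ g i := by
  have h1 : ∀ᶠ δ in 𝓝[>] (0 : ℝ), ∀ i, δ ≤ g i :=
    eventually_all.2 fun i => mem_of_superset (Ioc_mem_nhdsGT (hg i)) fun δ hδ => hδ.2
  obtain ⟨δ, h2, h3⟩ := (h1.and self_mem_nhdsWithin).exists
  exact ⟨δ, h3, h2⟩

theorem exists_pos_le_norm {ι : Type*} [Finite ι] {t : ℝ} (ht : 0 ≤ t) {g : ι → ℝ → ℂ}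
    (hc : ∀ i, ContinuousOn (g i) (Icc 0 t)) (hg : ∀ i, ∀ s ∈ Icc 0 t, g i s ≠ 0) :
    ∃ δ > 0, ∀ i, ∀ s ∈ Icc 0 t, δ ≤ ‖g i s‖ := by
  have h1 : ∀ i, ∃ d > 0, ∀ s ∈ Icc 0 t, d ≤ ‖g i s‖ := fun i => by
    obtain ⟨s₀, hs₀, hmin⟩ := isCompact_Icc.exists_isMinOn (nonempty_Icc.2 ht) (hc i).norm
    exact ⟨_, norm_pos_iff.2 (hg i s₀ hs₀), fun s hs => hmin hs⟩
  choose d hd0 hd using h1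
  obtain ⟨δ, hδ, hle⟩ := exists_pos_forall_le hd0
  exact ⟨δ, hδ, fun i s hs => (hle i).trans (hd i s hs)⟩

/-- No two growth points coincide and no growth point coincides with a charge. -/
def IsNoncolliding (y : Fin n ⊕ Fin m → ℂ) : Prop :=
  ∀ (j : Fin n) (p : Fin n ⊕ Fin m), p ≠ Sum.inl j → y (Sum.inl j) ≠ y p

theorem exists_isSeparated {t : ℝ} (ht : 0 ≤ t) {y : ℝ → Fin n ⊕ Fin m → ℂ}
    (hyc : ContinuousOn y (Icc 0 t)) (hy : ∀ s ∈ Icc 0 t, IsNoncolliding (y s)) :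
    ∃ δ > 0, ∀ s ∈ Icc 0 t, IsSeparated δ (y s) := by
  have hc := continuousOn_pi.1 hyc
  obtain ⟨δ, hδ, hle⟩ := exists_pos_le_norm ht
    (g := fun (q : {q : Fin n × (Fin n ⊕ Fin m) // q.2 ≠ Sum.inl q.1}) s =>
      y s (Sum.inl q.1.1) - y s q.1.2)
    (fun q => (hc _).sub (hc _)) fun q s hs => sub_ne_zero.2 (hy s hs _ _ q.2)
  exact ⟨δ, hδ, fun s hs j p hp => hle ⟨(j, p), hp⟩ s hs⟩

theorem IsSeparated.mono {δ δ' : ℝ} {y : Fin n ⊕ Fin m → ℂ} (h : IsSeparated δ y) (hδ : δ' ≤ δ) :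
    IsSeparated δ' y := fun j p hp => hδ.trans (h j p hp)

theorem IsSeparated.isNoncolliding {δ : ℝ} (hδ : 0 < δ) {y : Fin n ⊕ Fin m → ℂ}
    (h : IsSeparated δ y) : IsNoncolliding y := fun j p hp =>
  sub_ne_zero.1 (norm_pos_iff.1 (hδ.trans_le (h j p hp)))

theorem IsSeparated.of_mem_closedBall {δ : ℝ} {y z : Fin n ⊕ Fin m → ℂ}
    (h : IsSeparated (2 * δ) y) (hz : z ∈ Metric.closedBall y (δ / 2)) : IsSeparated δ z := by
  intro j p hp
  rw [mem_closedBall_iff_norm] at hz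
  have h1 := norm_le_pi_norm (z - y) (Sum.inl j)
  have h2 := norm_le_pi_norm (z - y) p
  rw [Pi.sub_apply] at h1 h2
  have h3 : ‖y (Sum.inl j) - y p‖ ≤ ‖z (Sum.inl j) - z p‖ + (‖z (Sum.inl j) - y (Sum.inl j)‖ +
      ‖z p - y p‖) := by
    calc _ = ‖(z (Sum.inl j) - z p) - ((z (Sum.inl j) - y (Sum.inl j)) - (z p - y p))‖ := by
          congr 1; ring
      _ ≤ _ := (norm_sub_le _ _).trans (add_le_add le_rfl (norm_sub_le _ _))
  have := h j p hp
  linarith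

/-- Growth points and charges moving by the Loewner equations up to time `t`. -/
structure IsFlow (ν : Fin n → ℝ → ℝ) (y₀ : Fin n ⊕ Fin m → ℂ) (t : ℝ)
    (y : ℝ → Fin n ⊕ Fin m → ℂ) : Prop where
  continuousOn : ContinuousOn y (Icc 0 t)
  noncolliding : ∀ s ∈ Icc 0 t, IsNoncolliding (y s)
  equation : ∀ s ∈ Icc 0 t, ∀ i,
    y s i = y₀ i + ∫ r in (0 : ℝ)..s, ∑ a, (ν a r : ℂ) * loewnerField a (y r) i

variable {ν : Fin n → ℝ → ℝ} {y₀ : Fin n ⊕ Fin m → ℂ} {t : ℝ} {y z : ℝ → Fin n ⊕ Fin m → ℂ}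

theorem IsFlow.mono {s : ℝ} (h : IsFlow ν y₀ t y) (hs : s ≤ t) : IsFlow ν y₀ s y :=
  ⟨h.continuousOn.mono (Icc_subset_Icc_right hs),
    fun r hr => h.noncolliding r (Icc_subset_Icc_right hs hr),
    fun r hr => h.equation r (Icc_subset_Icc_right hs hr)⟩

theorem continuousOn_loewnerField {S : Set ℝ} (hyc : ContinuousOn y S)
    (hy : ∀ s ∈ S, IsNoncolliding (y s)) (a : Fin n) (i : Fin n ⊕ Fin m) :
    ContinuousOn (fun s => loewnerField a (y s) i) S := by
  have hc : ∀ p, ContinuousOn (fun s => y s p) S := continuousOn_pi.1 hyc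
  have hne : ∀ j p, p ≠ Sum.inl j → ∀ s ∈ S, y s (Sum.inl j) - y s p ≠ 0 := fun j p hp s hs =>
    sub_ne_zero.2 (hy s hs j p hp)
  rcases i with j | l
  · by_cases hj : j = a
    · subst hj
      simp only [loewnerField, Sum.elim_inl, if_true]
      refine (continuousOn_finsetSum _ fun k hk => continuousOn_const.div ((hc _).sub (hc _)) ?_).sub
        (continuousOn_finsetSum _ fun l _ => continuousOn_const.div ((hc _).sub (hc _)) ?_)
      · exact hne j _ fun h => Finset.ne_of_mem_erase hk (Sum.inl_injective h)
      · exact hne j _ Sum.inr_ne_inl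
    · simp only [loewnerField, Sum.elim_inl, if_neg hj]
      exact continuousOn_const.div ((hc _).sub (hc _))
        (hne j _ fun h => hj (Sum.inl_injective h).symm)
  · simp only [loewnerField, Sum.elim_inr]
    refine continuousOn_const.div ((hc _).sub (hc _)) fun s hs => ?_
    rw [← neg_sub]
    exact neg_ne_zero.2 (hne a _ Sum.inr_ne_inl s hs)

theorem IsFlow.unique (hν : IsParametrization ν) (hy : IsFlow ν y₀ t y) (hz : IsFlow ν y₀ t z) :
    ∀ s ∈ Icc 0 t, y s = z s := by
  intro s hs
  have ht : 0 ≤ t := hs.1.trans hs.2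
  obtain ⟨δ₁, hδ₁, h1⟩ := exists_isSeparated ht hy.continuousOn hy.noncolliding
  obtain ⟨δ₂, hδ₂, h2⟩ := exists_isSeparated ht hz.continuousOn hz.noncolliding
  have hδ := lt_min hδ₁ hδ₂
  exact eqOn_of_integral_eq hν (by positivity)
    (fun i a => continuousOn_loewnerField hy.continuousOn hy.noncolliding a i)
    (fun i a => continuousOn_loewnerField hz.continuousOn hz.noncolliding a i)
    hy.continuousOn hz.continuousOn hy.equation hz.equation
    (fun r hr i a => norm_loewnerField_sub_le hδ ((h1 r hr).mono (min_le_left _ _))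
      ((h2 r hr).mono (min_le_right _ _)) a i) s hs

theorem exists_isFlow (hν : IsParametrization ν) (hy₀ : IsNoncolliding y₀) :
    ∃ T > 0, ∃ y, IsFlow ν y₀ T y := by
  obtain ⟨d, hd, h1⟩ := exists_isSeparated (t := 0) le_rfl (y := fun _ => y₀) continuousOn_const
    fun _ _ => hy₀
  have h2 : IsSeparated (2 * (d / 2)) y₀ := by
    rw [mul_div_cancel₀ d two_ne_zero]; exact h1 0 (left_mem_Icc.2 le_rfl)
  have hd2 : 0 < d / 2 := half_pos hd
  obtain ⟨T, hT, y, hyc, hyB, hy⟩ := exists_local_solution hν (V := loewnerField) (y₀ := y₀)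
    (half_pos hd2) (by positivity) fun y hy z hz a i =>
      norm_loewnerField_sub_le hd2 (h2.of_mem_closedBall hy) (h2.of_mem_closedBall hz) a i
  exact ⟨T, hT, y, hyc, fun s hs => (h2.of_mem_closedBall (hyB s hs)).isNoncolliding hd2, hy⟩

/-- The flow commutes with complex conjugation, up to a permutation of the charges. -/
theorem IsFlow.conj (h : IsFlow ν y₀ t y) {ρ : Equiv.Perm (Fin m)}
    (hl : ∀ j, (starRingEnd ℂ) (y₀ (Sum.inl j)) = y₀ (Sum.inl j))
    (hr : ∀ l, (starRingEnd ℂ) (y₀ (Sum.inr (ρ l))) = y₀ (Sum.inr l)) :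
    IsFlow ν y₀ t fun s i => (starRingEnd ℂ) (y s (Equiv.sumCongr (Equiv.refl _) ρ i)) := by
  set σ : Equiv.Perm (Fin n ⊕ Fin m) := Equiv.sumCongr (Equiv.refl _) ρ with hσ
  have hσl : ∀ j, σ (Sum.inl j) = Sum.inl j := fun j => rfl
  have hσr : ∀ l, σ (Sum.inr l) = Sum.inr (ρ l) := fun l => rfl
  have hfield : ∀ (a : Fin n) (w : Fin n ⊕ Fin m → ℂ) i,
      loewnerField a (fun i => (starRingEnd ℂ) (w (σ i))) i =
        (starRingEnd ℂ) (loewnerField a w (σ i)) := by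
    intro a w i
    rcases i with j | l
    · by_cases hj : j = a
      · subst hj
        simp only [hσl, hσr, loewnerField, Sum.elim_inl, if_true, map_sub, map_sum, map_div₀,
          Complex.conj_ofNat]
        congr 1
        exact Equiv.sum_comp ρ fun l =>
          4 / ((starRingEnd ℂ) (w (Sum.inl j)) - (starRingEnd ℂ) (w (Sum.inr l)))
      · simp only [hσl, loewnerField, Sum.elim_inl, if_neg hj, map_sub, map_div₀,
          Complex.conj_ofNat]
    · simp only [hσl, hσr, loewnerField, Sum.elim_inr, map_sub, map_div₀, Complex.conj_ofNat]
  refine ⟨?_, ?_, ?_⟩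
  · exact continuousOn_pi.2 fun i =>
      Complex.continuous_conj.comp_continuousOn (continuousOn_pi.1 h.continuousOn (σ i))
  · intro s hs j p hp heq
    refine h.noncolliding s hs j (σ p) (fun hp' => hp ?_) ((starRingEnd ℂ).injective heq)
    exact σ.injective (by rw [hp', hσl])
  · intro s hs i
    have h0 : (starRingEnd ℂ) (y₀ (σ i)) = y₀ i := by
      rcases i with j | l
      · exact hl j
      · exact hr l
    rw [h.equation s hs, map_add, h0, ← intervalIntegral.intervalIntegral_conj]
    congr 1
    refine intervalIntegral.integral_congr fun r _ => ?_
    simp only [map_sum, map_mul, Complex.conj_ofReal, hfield]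

end Field

/-! ### Multiple chordal SLE(0) chains -/

section Chain

variable {n m : ℕ} {x : Fin n → ℝ} {ξ ξ' : Fin m → ℂ} {ν : Fin n → ℝ → ℝ} {X X' : ℝ → Fin n → ℝ}
  {t : ℝ} {z : ℂ} {w w' : ℝ → ℂ} {c c' : Chain n}

theorem IsLoewnerOrbit.mono {s : ℝ} (h : IsLoewnerOrbit ν X t z w) (hs : s ≤ t) :
    IsLoewnerOrbit ν X s z w :=
  ⟨h.continuousOn.mono (Icc_subset_Icc_right hs),
    fun r hr => h.avoids r (Icc_subset_Icc_right hs hr),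
    fun r hr => h.equation r (Icc_subset_Icc_right hs hr)⟩

theorem IsLoewnerOrbit.congr (h : IsLoewnerOrbit ν X t z w) (hX : ∀ s ∈ Icc 0 t, X' s = X s)
    (hw : ∀ s ∈ Icc 0 t, w' s = w s) : IsLoewnerOrbit ν X' t z w' := by
  refine ⟨h.continuousOn.congr hw, fun s hs => ?_, fun s hs => ?_⟩
  · rw [hX s hs, hw s hs]; exact h.avoids s hs
  · rw [hw s hs, h.equation s hs]
    congr 1
    refine intervalIntegral.integral_congr fun r hr => ?_
    rw [uIcc_of_le hs.1] at hr
    have hr' : r ∈ Icc 0 t := ⟨hr.1, hr.2.trans hs.2⟩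
    simp only [hX r hr', hw r hr']

theorem IsAlive.congr (h : IsAlive ν X t z) (hX : ∀ s ∈ Icc 0 t, X' s = X s) :
    IsAlive ν X' t z := by
  obtain ⟨w, hw⟩ := h
  exact ⟨w, hw.congr hX fun _ _ => rfl⟩

theorem IsLoewnerOrbit.unique (hν : IsParametrization ν)
    (hX : ∀ j, ContinuousOn (fun s => X s j) (Icc 0 t)) (h : IsLoewnerOrbit ν X t z w)
    (h' : IsLoewnerOrbit ν X t z w') : ∀ s ∈ Icc 0 t, w s = w' s := by
  intro s hs
  have ht : 0 ≤ t := hs.1.trans hs.2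
  have hXc : ∀ j, ContinuousOn (fun s => (X s j : ℂ)) (Icc 0 t) := fun j =>
    Complex.continuous_ofReal.comp_continuousOn (hX j)
  have hd : ∀ {w}, IsLoewnerOrbit ν X t z w → ∀ a, ContinuousOn (fun s => w s - (X s a : ℂ)) (Icc 0 t) :=
    fun h a => h.continuousOn.sub (hXc a)
  have hne : ∀ {w}, IsLoewnerOrbit ν X t z w → ∀ a, ∀ s ∈ Icc 0 t, w s - (X s a : ℂ) ≠ 0 :=
    fun h a s hs => sub_ne_zero.2 (h.avoids s hs a)
  have heq : ∀ {w}, IsLoewnerOrbit ν X t z w → ∀ s ∈ Icc 0 t, ∀ _ : Unit,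
      w s = z + ∫ r in (0 : ℝ)..s, ∑ a, (ν a r : ℂ) * (2 / (w r - (X r a : ℂ))) := by
    intro w h s hs _
    rw [h.equation s hs]
    congr 1
    refine intervalIntegral.integral_congr fun r _ => Finset.sum_congr rfl fun a _ => ?_
    ring
  obtain ⟨δ₁, hδ₁, h1⟩ := exists_pos_le_norm ht (hd h) (hne h)
  obtain ⟨δ₂, hδ₂, h2⟩ := exists_pos_le_norm ht (hd h') (hne h')
  have hδ := lt_min hδ₁ hδ₂
  refine congrFun (eqOn_of_integral_eq hν (ι := Unit) (C := 2 / min δ₁ δ₂ ^ 2)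
    (y := fun s _ => w s) (z := fun s _ => w' s) (y₀ := fun _ => z)
    (f := fun _ a s => 2 / (w s - (X s a : ℂ))) (g := fun _ a s => 2 / (w' s - (X s a : ℂ)))
    (by positivity) (fun _ a => continuousOn_const.div (hd h a) (hne h a))
    (fun _ a => continuousOn_const.div (hd h' a) (hne h' a))
    (continuousOn_pi.2 fun _ => h.continuousOn) (continuousOn_pi.2 fun _ => h'.continuousOn)
    (heq h) (heq h') (fun r hr _ a => ?_) s hs) ()
  refine (norm_div_sub_div_le hδ ((min_le_left _ _).trans (h1 a r hr))
    ((min_le_right _ _).trans (h2 a r hr)) le_rfl).trans (le_of_eq ?_)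
  have h3 : (fun _ : Unit => w r) - (fun _ => w' r) = fun _ => w r - w' r := rfl
  rw [h3, pi_norm_const, sub_sub_sub_cancel_right]
  simp only [Complex.norm_ofNat]
  ring

open Classical in
/-- The Loewner flow of given driving functions (zero at swallowed points). -/
noncomputable def flowOf (ν : Fin n → ℝ → ℝ) (X : ℝ → Fin n → ℝ) (s : ℝ) (z : ℂ) : ℂ :=
  if h : IsAlive ν X s z then h.choose s else 0

/-- Orbits are unique, so orbits chosen independently for different times fit together. -/
theorem flowOf_eq (hν : IsParametrization ν)
    (hX : ∀ j, ContinuousOn (fun s => X s j) (Icc 0 t)) (h : IsLoewnerOrbit ν X t z w) :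
    ∀ s ∈ Icc 0 t, flowOf ν X s z = w s := by
  intro s hs
  have h1 : IsAlive ν X s z := ⟨w, h.mono hs.2⟩
  rw [flowOf, dif_pos h1]
  exact h1.choose_spec.unique hν (fun j => (hX j).mono (Icc_subset_Icc_right hs.2)) (h.mono hs.2) s
    (right_mem_Icc.2 hs.1)

/-- Growth points and charges as one vector. -/
def state (x : Fin n → ℝ) (ξ : Fin m → ℂ) : Fin n ⊕ Fin m → ℂ :=
  Sum.elim (fun j => (x j : ℂ)) ξ

theorem sum_loewnerField_inl (μ : Fin n → ℂ) (y : Fin n ⊕ Fin m → ℂ) (j : Fin n) :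
    ∑ a, μ a * loewnerField a y (Sum.inl j) =
      μ j * (∑ k ∈ Finset.univ.erase j, 2 / (y (Sum.inl j) - y (Sum.inl k)) -
        ∑ l, 4 / (y (Sum.inl j) - y (Sum.inr l))) +
      ∑ k ∈ Finset.univ.erase j, 2 * μ k / (y (Sum.inl j) - y (Sum.inl k)) := by
  rw [← Finset.add_sum_erase Finset.univ _ (Finset.mem_univ j)]
  congr 1
  · simp [loewnerField]
  · refine Finset.sum_congr rfl fun k hk => ?_
    simp only [loewnerField, Sum.elim_inl, if_neg (Finset.ne_of_mem_erase hk).symm]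
    ring

theorem sum_loewnerField_inr (μ : Fin n → ℂ) (y : Fin n ⊕ Fin m → ℂ) (l : Fin m) :
    ∑ a, μ a * loewnerField a y (Sum.inr l) =
      ∑ k, 2 * μ k / (y (Sum.inr l) - y (Sum.inl k)) := by
  refine Finset.sum_congr rfl fun k _ => ?_
  simp only [loewnerField, Sum.elim_inr]
  ring

theorem isNoncolliding_state (hx : Function.Injective x) (hs : ∀ k j, ξ k ≠ (x j : ℂ)) :
    IsNoncolliding (state x ξ) := by
  rintro j (k | l) hp
  · simp only [state, Sum.elim_inl, ne_eq, Complex.ofReal_inj]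
    exact fun h => hp (by rw [hx h])
  · exact (hs l j).symm

theorem Chain.Icc_subset_times (ht : t ∈ c.times) : Icc 0 t ⊆ c.times := fun _ hs =>
  ⟨hs.1, (ENNReal.ofReal_le_ofReal hs.2).trans_lt ht.2⟩

theorem Chain.exists_gt_mem_times (ht : t ∈ c.times) : ∃ t' ∈ c.times, t < t' := by
  obtain ⟨r, h1, h2⟩ := ENNReal.lt_iff_exists_nnreal_btwn.1 ht.2
  refine ⟨r, ⟨r.2, by rwa [ENNReal.ofReal_coe_nnreal]⟩, ?_⟩
  rw [← ENNReal.ofReal_coe_nnreal] at h1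
  exact (ENNReal.ofReal_lt_ofReal_iff_of_nonneg ht.1).1 h1

theorem IsSLEZeroSolution.charge_orbit (h : IsSLEZeroSolution x ξ ν c) (ht : t ∈ c.times)
    (l : Fin m) : IsLoewnerOrbit ν c.driving t (ξ l) fun s => c.flow s (ξ l) :=
  h.flow_orbit t ht _ (h.charge_alive t ht l)

/-- Growth points and charges form a closed finite-dimensional system; the flow at all other points
is determined by the driving functions. -/
theorem IsSLEZeroSolution.isFlow (h : IsSLEZeroSolution x ξ ν c) (ht : t ∈ c.times) :
    IsFlow ν (state x ξ) t fun s => state (c.driving s) fun l => c.flow s (ξ l) := by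
  have hsub := Chain.Icc_subset_times ht
  refine ⟨continuousOn_pi.2 ?_, fun s hs => ?_, ?_⟩
  · rintro (j | l)
    · exact Complex.continuous_ofReal.comp_continuousOn ((h.continuousOn j).mono hsub)
    · exact (h.charge_orbit ht l).continuousOn
  · exact isNoncolliding_state (h.no_collision s (hsub hs)) fun l j =>
      (h.charge_orbit ht l).avoids s hs j
  · rintro s hs (j | l)
    · simp only [sum_loewnerField_inl]
      exact h.driving_equation s (hsub hs) j
    · simp only [sum_loewnerField_inr]
      exact (h.charge_orbit ht l).equation s hs

theorem isSLEZeroSolution_of_isFlow (hν : IsParametrization ν) (hpos : 0 < c.lifetime)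
    (hflow : c.flow = flowOf ν c.driving)
    (h : ∀ t ∈ c.times, ∃ y, IsFlow ν (state x ξ) t y ∧
      ∀ s ∈ Icc 0 t, ∀ j, y s (Sum.inl j) = c.driving s j) : IsSLEZeroSolution x ξ ν c := by
  have hcI : ∀ t ∈ c.times, ∀ j, ContinuousOn (fun s => c.driving s j) (Icc 0 t) := by
    intro t ht j
    obtain ⟨y, hy, hyd⟩ := h t ht
    refine (Complex.continuous_re.comp_continuousOn
      (continuousOn_pi.1 hy.continuousOn (Sum.inl j))).congr fun s hs => ?_
    simp [hyd s hs j]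
  have horb : ∀ t ∈ c.times, ∀ z, IsAlive ν c.driving t z →
      IsLoewnerOrbit ν c.driving t z fun s => c.flow s z := by
    rintro t ht z ⟨w, hw⟩
    refine hw.congr (fun _ _ => rfl) fun s hs => ?_
    rw [hflow]
    exact flowOf_eq hν (hcI t ht) hw s hs
  have hcharge : ∀ {t}, t ∈ c.times → ∀ {y}, IsFlow ν (state x ξ) t y →
      (∀ s ∈ Icc 0 t, ∀ j, y s (Sum.inl j) = c.driving s j) →
      ∀ l, IsLoewnerOrbit ν c.driving t (ξ l) fun s => y s (Sum.inr l) := by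
    intro t ht y hy hyd l
    refine ⟨continuousOn_pi.1 hy.continuousOn _, fun s hs j => ?_, fun s hs => ?_⟩
    · rw [← hyd s hs j]
      exact (hy.noncolliding s hs j _ Sum.inr_ne_inl).symm
    · rw [hy.equation s hs (Sum.inr l)]
      simp only [sum_loewnerField_inr]
      congr 1
      refine intervalIntegral.integral_congr fun r hr => ?_
      rw [uIcc_of_le hs.1] at hr
      simp only [hyd r ⟨hr.1, hr.2.trans hs.2⟩]
  refine ⟨hpos, ?_, ?_, horb, ?_, ?_⟩
  · intro j t ht
    obtain ⟨t', ht', hlt⟩ := Chain.exists_gt_mem_times ht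
    refine (hcI t' ht' j t ⟨ht.1, hlt.le⟩).mono_of_mem_nhdsWithin ?_
    filter_upwards [self_mem_nhdsWithin, mem_nhdsWithin_of_mem_nhds (Iio_mem_nhds hlt)] with s hs hs'
    exact ⟨hs.1, hs'.le⟩
  · intro t ht i j hij
    obtain ⟨y, hy, hyd⟩ := h t ht
    have htt : t ∈ Icc 0 t := right_mem_Icc.2 ht.1
    by_contra hne
    refine hy.noncolliding t htt i (Sum.inl j) (fun h => hne (Sum.inl_injective h).symm) ?_
    rw [hyd t htt, hyd t htt, hij]
  · intro t ht l
    obtain ⟨y, hy, hyd⟩ := h t ht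
    exact ⟨_, hcharge ht hy hyd l⟩
  · intro t ht j
    obtain ⟨y, hy, hyd⟩ := h t ht
    have htt : t ∈ Icc 0 t := right_mem_Icc.2 ht.1
    rw [← hyd t htt, hy.equation t htt]
    simp only [sum_loewnerField_inl]
    congr 1
    refine intervalIntegral.integral_congr fun r hr => ?_
    rw [uIcc_of_le ht.1] at hr
    have hl : ∀ l, y r (Sum.inr l) = c.flow r (ξ l) := fun l => by
      rw [hflow]
      exact (flowOf_eq hν (hcI t ht) (hcharge ht hy hyd l) r hr).symm
    simp only [hyd r hr, hl, logDerivGrowth]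

/-- Conjugation permutes the charges and fixes the growth points, so the conjugate of the flow, with
charges permuted, starts at the same state; uniqueness makes the growth points real. -/
theorem IsScreening.im_eq_zero (hν : IsParametrization ν) (hs : IsScreening x ξ)
    {y : ℝ → Fin n ⊕ Fin m → ℂ} (hy : IsFlow ν (state x ξ) t y) {s : ℝ} (hst : s ∈ Icc 0 t)
    (j : Fin n) : (y s (Sum.inl j)).im = 0 := by
  choose ρ hρ using hs.conj_mem
  have hinj : Function.Injective ρ := fun i j hij => hs.injective (by
    have := hρ i
    rw [hij, hρ j] at this
    exact ((starRingEnd ℂ).injective this).symm)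
  have h1 := hy.conj (ρ := Equiv.ofBijective ρ (Finite.injective_iff_bijective.1 hinj))
    (fun j => by simp [state]) (fun l => by simp [state, hρ])
  have h2 := congrFun (hy.unique hν h1 s hst) (Sum.inl j)
  exact Complex.conj_eq_iff_im.1 h2.symm

/-- Existence of the multiple chordal SLE(0) chain. -/
theorem exists_isSLEZeroChain (hν : IsParametrization ν) (hx : Function.Injective x)
    (hs : IsScreening x ξ) : ∃ c, IsSLEZeroChain x ξ ν c := by
  classical
  set T : Set ℝ := {t | ∃ y, IsFlow ν (state x ξ) t y} with hT
  have hTle : ∀ {s t}, t ∈ T → s ≤ t → s ∈ T := by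
    rintro s t ⟨y, hy⟩ hst
    exact ⟨y, hy.mono hst⟩
  -- The driving functions are patched from flows on the intervals [0, s], which agree by
  -- uniqueness; the value 0 outside `T` is a dummy. The lifetime below is the supremum of `T`, and
  -- it is maximal because every solution restricts to flows.
  let X : ℝ → Fin n → ℝ := fun s j => if h : s ∈ T then (h.choose s (Sum.inl j)).re else 0
  let c : Chain n := ⟨⨆ t ∈ T, ENNReal.ofReal t, X, flowOf ν X⟩
  have hmem : ∀ t ∈ c.times, t ∈ T := by
    intro t ht
    obtain ⟨t', ht'⟩ := lt_iSup_iff.1 ht.2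
    obtain ⟨hT', hlt⟩ := lt_iSup_iff.1 ht'
    exact hTle hT' ((ENNReal.ofReal_lt_ofReal_iff_of_nonneg ht.1).1 hlt).le
  have hle : ∀ t ∈ T, ENNReal.ofReal t ≤ c.lifetime := fun t ht =>
    le_iSup₂ (f := fun t (_ : t ∈ T) => ENNReal.ofReal t) t ht
  refine ⟨c, isSLEZeroSolution_of_isFlow hν ?_ rfl fun t ht => ?_, fun c' hc' => ?_⟩
  · obtain ⟨t, ht, y, hy⟩ := exists_isFlow hν (isNoncolliding_state hx hs.ne_growth)
    exact (ENNReal.ofReal_pos.2 ht).trans_le (hle t ⟨y, hy⟩)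
  · obtain ⟨y, hy⟩ := hmem t ht
    refine ⟨y, hy, fun s hst j => ?_⟩
    have h1 : s ∈ T := hTle ⟨y, hy⟩ hst.2
    have h2 : h1.choose s = y s :=
      h1.choose_spec.unique hν (hy.mono hst.2) s (right_mem_Icc.2 hst.1)
    have h3 : X s j = (y s (Sum.inl j)).re := by
      simp only [X, dif_pos h1, h2]
    change _ = (X s j : ℂ)
    rw [h3]
    exact Complex.ext rfl (by simpa using hs.im_eq_zero hν hy hst j)
  · refine le_of_forall_lt_imp_le_of_dense fun a ha => ?_
    have ha' : a ≠ ⊤ := ha.ne_top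
    have h1 : a.toReal ∈ c'.times := ⟨ENNReal.toReal_nonneg, by rwa [ENNReal.ofReal_toReal ha']⟩
    have h2 := hle a.toReal ⟨_, hc'.isFlow h1⟩
    rwa [ENNReal.ofReal_toReal ha'] at h2

/-- Uniqueness of the multiple chordal SLE(0) chain. -/
theorem IsSLEZeroChain.unique (hν : IsParametrization ν) (h : IsSLEZeroChain x ξ ν c)
    (h' : IsSLEZeroChain x ξ ν c') : c.lifetime = c'.lifetime ∧ ∀ t ∈ c.times,
      c.driving t = c'.driving t ∧
        ∀ z, IsAlive ν c.driving t z → c.flow t z = c'.flow t z := by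
  have hlife : c.lifetime = c'.lifetime := le_antisymm (h'.2 c h.1) (h.2 c' h'.1)
  have htimes : c.times = c'.times := by simp only [Chain.times, hlife]
  refine ⟨hlife, fun t ht => ?_⟩
  have ht' : t ∈ c'.times := htimes ▸ ht
  have hd : ∀ s ∈ Icc 0 t, c'.driving s = c.driving s := fun s hs => by
    funext j
    have := congrFun ((h'.1.isFlow ht').unique hν (h.1.isFlow ht) s hs) (Sum.inl j)
    exact Complex.ofReal_injective this
  have htt : t ∈ Icc 0 t := right_mem_Icc.2 ht.1
  refine ⟨(hd t htt).symm, fun z hz => ?_⟩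
  have h2 := (h'.1.flow_orbit t ht' z (hz.congr hd)).congr (X' := c.driving)
    (fun s hs => (hd s hs).symm) fun _ _ => rfl
  exact (h.1.flow_orbit t ht z hz).unique hν
    (fun j => (h.1.continuousOn j).mono (Chain.Icc_subset_times ht)) h2 t htt

/-- The charges enter the driving equation only through a sum over all of them. -/
theorem IsSLEZeroSolution.comp_perm (h : IsSLEZeroSolution x ξ ν c) (π : Equiv.Perm (Fin m)) :
    IsSLEZeroSolution x (ξ ∘ π) ν c := by
  refine ⟨h.lifetime_pos, h.continuousOn, h.no_collision, h.flow_orbit,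
    fun t ht l => h.charge_alive t ht (π l), fun t ht j => ?_⟩
  have h1 : ∀ s, logDerivGrowth (c.driving s) (fun l => c.flow s ((ξ ∘ π) l)) j =
      logDerivGrowth (c.driving s) (fun l => c.flow s (ξ l)) j := fun s => by
    simp only [logDerivGrowth, Function.comp_apply]
    congr 1
    exact Equiv.sum_comp π fun l => 4 / ((c.driving s j : ℂ) - c.flow s (ξ l))
  simp only [h1]
  exact h.driving_equation t ht j

theorem isSLEZeroSolution_comp_perm_iff (π : Equiv.Perm (Fin m)) :
    IsSLEZeroSolution x (ξ ∘ π) ν c ↔ IsSLEZeroSolution x ξ ν c := by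
  refine ⟨fun h => ?_, fun h => h.comp_perm π⟩
  have h1 := h.comp_perm π.symm
  rwa [Function.comp_assoc, Equiv.self_comp_symm, Function.comp_id] at h1

/-! ### Recovering the charges from the driving functions -/

theorem eq_zero_of_integral_eq_zero {g : ℝ → ℂ} (ht : 0 < t) (hg : ContinuousOn g (Icc 0 t))
    (h : ∀ s ∈ Icc 0 t, ∫ r in (0 : ℝ)..s, g r = 0) : g 0 = 0 := by
  have h0 : ContinuousWithinAt g (Ioi 0) 0 :=
    ((hg 0 ⟨le_rfl, ht.le⟩).mono_of_mem_nhdsWithin (Icc_mem_nhdsGE ht)).mono Ioi_subset_Ici_self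
  have hm : StronglyMeasurableAtFilter g (𝓝[>] 0) MeasureTheory.volume :=
    ⟨Ioc 0 t, Ioc_mem_nhdsGT ht,
      (hg.mono Ioc_subset_Icc_self).aestronglyMeasurable measurableSet_Ioc⟩
  have h1 : HasDerivWithinAt (fun u => ∫ r in (0 : ℝ)..u, g r) (g 0) (Ici 0) 0 :=
    intervalIntegral.integral_hasDerivWithinAt_right (by simp) hm h0
  have h2 : HasDerivWithinAt (fun u => ∫ r in (0 : ℝ)..u, g r) 0 (Ici 0) 0 := by
    refine (hasDerivWithinAt_const (0 : ℝ) (Ici 0) (0 : ℂ)).congr_of_eventuallyEq ?_ (by simp)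
    filter_upwards [Icc_mem_nhdsGE ht] with s hs using h s hs
  exact (uniqueDiffOn_Ici (0 : ℝ) 0 (mem_Ici.2 le_rfl)).eq_deriv _ h1 h2

/-- The parametrization in which only the growth point `j` is active, at unit speed. -/
def singleRate (j : Fin n) : Fin n → ℝ → ℝ := fun a _ => if a = j then 1 else 0

theorem isParametrization_singleRate (j : Fin n) : IsParametrization (singleRate j) :=
  ⟨fun _ => measurable_const, fun a _ _ => by unfold singleRate; split_ifs <;> norm_num,
    fun _ _ _ => intervalIntegrable_const⟩

/-- With only x_j active at unit rate, the integrand in its equation is continuous and at time 0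
equals the logarithmic derivative. Equal driving functions have equal integrals over every [0, s],
hence equal integrands at time 0. -/
theorem logDerivGrowth_eq_of_driving_eq {j : Fin n} (h : IsSLEZeroSolution x ξ (singleRate j) c)
    (h' : IsSLEZeroSolution x ξ' (singleRate j) c') (hlife : c.lifetime = c'.lifetime)
    (hd : ∀ t ∈ c.times, c.driving t = c'.driving t) :
    logDerivGrowth x ξ j = logDerivGrowth x ξ' j := by
  have h0 : (0 : ℝ) ∈ c.times := ⟨le_rfl, by simpa using h.lifetime_pos⟩
  obtain ⟨t, ht, ht0⟩ := Chain.exists_gt_mem_times h0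
  have ht' : t ∈ c'.times := by
    have : c.times = c'.times := by simp only [Chain.times, hlife]
    rwa [← this]
  have hf := h.isFlow ht
  have hf' := h'.isFlow ht'
  set y := fun s => state (c.driving s) fun l => c.flow s (ξ l) with hy
  set y' := fun s => state (c'.driving s) fun l => c'.flow s (ξ' l) with hy'
  have hsum : ∀ (r : ℝ) (v : Fin n → ℂ), ∑ a, (singleRate j a r : ℂ) * v a = v j := fun r v => by
    rw [Finset.sum_eq_single j (fun a _ ha => by simp [singleRate, ha]) (by simp)]
    simp [singleRate]
  have h00 : (0 : ℝ) ∈ Icc 0 t := ⟨le_rfl, ht0.le⟩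
  have e0 : y 0 = state x ξ := by funext i; rw [hf.equation 0 h00]; simp
  have e0' : y' 0 = state x ξ' := by funext i; rw [hf'.equation 0 h00]; simp
  have hc := continuousOn_loewnerField hf.continuousOn hf.noncolliding j (Sum.inl j)
  have hc' := continuousOn_loewnerField hf'.continuousOn hf'.noncolliding j (Sum.inl j)
  have hint : ∀ {g : ℝ → ℂ}, ContinuousOn g (Icc 0 t) → ∀ s ∈ Icc 0 t,
      IntervalIntegrable g MeasureTheory.volume 0 s := fun hg s hs =>
    (hg.mono (by rw [uIcc_of_le hs.1]; exact Icc_subset_Icc_right hs.2)).intervalIntegrable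
  have key := eq_zero_of_integral_eq_zero ht0 (hc.sub hc') fun s hs => by
    simp only [Pi.sub_apply]
    rw [intervalIntegral.integral_sub (hint hc s hs) (hint hc' s hs)]
    have e1 := hf.equation s hs (Sum.inl j)
    have e2 := hf'.equation s hs (Sum.inl j)
    simp only [hsum] at e1 e2
    have e3 : y s (Sum.inl j) = y' s (Sum.inl j) := by
      change ((c.driving s j : ℝ) : ℂ) = (c'.driving s j : ℝ)
      rw [hd s (Chain.Icc_subset_times ht hs)]
    rw [e1, e2] at e3
    exact sub_eq_zero.2 (add_left_cancel e3)
  rw [Pi.sub_apply, e0, e0'] at key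
  simpa [loewnerField, state, logDerivGrowth] using sub_eq_zero.1 key

theorem exists_isSLEZeroSystem (hx : Function.Injective x) (hs : IsScreening x ξ) :
    ∃ S, IsSLEZeroSystem x ξ S := by
  classical
  have h : ∀ ν : Fin n → ℝ → ℝ, ∃ c, IsParametrization ν → IsSLEZeroChain x ξ ν c := fun ν => by
    by_cases hν : IsParametrization ν
    · obtain ⟨c, hc⟩ := exists_isSLEZeroChain hν hx hs
      exact ⟨c, fun _ => hc⟩
    · exact ⟨⟨0, 0, 0⟩, fun h => absurd h hν⟩
  choose S hS using h
  exact ⟨S, hS⟩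

/-- The initial speeds under the n single-point parametrizations give the sums ∑ 1 / (x_j - ξ_l),
after cancelling the part that depends on x alone, and these determine the charges up to order.
Conversely, permuting charges leaves the equations unchanged, so uniqueness of the chain applies. -/
theorem sameSystem_iff (hnm : 2 * m ≤ n) (hx : Function.Injective x) (hs : IsScreening x ξ)
    (hs' : IsScreening x ξ') {S S' : (Fin n → ℝ → ℝ) → Chain n} (hS : IsSLEZeroSystem x ξ S)
    (hS' : IsSLEZeroSystem x ξ' S') :
    SameSystem S S' ↔ ∃ π : Equiv.Perm (Fin m), ξ' = ξ ∘ π := by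
  constructor
  · intro h
    refine exists_perm_of_sum_eq hnm hx hs hs' fun j => ?_
    have hν := isParametrization_singleRate j
    obtain ⟨h1, h2⟩ := h _ hν
    have h3 := logDerivGrowth_eq_of_driving_eq (hS _ hν).1 (hS' _ hν).1 h1 fun t ht => (h2 t ht).1
    rw [logDerivGrowth, logDerivGrowth, sub_right_inj] at h3
    have h4 : ∀ η : Fin m → ℂ, ∑ l, 4 / ((x j : ℂ) - η l) = 4 * ∑ l, 1 / ((x j : ℂ) - η l) :=
      fun η => by
        rw [Finset.mul_sum]
        exact Finset.sum_congr rfl fun l _ => by ring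
    rw [h4, h4] at h3
    exact mul_left_cancel₀ (by norm_num : (4 : ℂ) ≠ 0) h3
  · rintro ⟨π, rfl⟩ ν hν
    obtain ⟨h1, h2⟩ := hS' ν hν
    exact (hS ν hν).unique hν ⟨(isSLEZeroSolution_comp_perm_iff π).1 h1,
      fun c' hc' => h2 c' ((isSLEZeroSolution_comp_perm_iff π).2 hc')⟩

end Chain

end ChordalSLE

theorem mainTheorem6 (n m : ℕ) (hnm : 2 * m ≤ n) (x : Fin n → ℝ) (hx : Function.Injective x) :
    (∀ ξ : Fin m → ℂ,
      List.TFAE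
        [ChordalSLE.IsScreening x ξ ∧ ChordalSLE.Stationary x ξ ∧
            ∃ S : (Fin n → ℝ → ℝ) → ChordalSLE.Chain n, ChordalSLE.IsSLEZeroSystem x ξ S,
          ∃ R : RatFunc ℂ, ChordalSLE.IsLinkRational x ξ R,
          ChordalSLE.IsScreening x ξ ∧ ChordalSLE.IsMasterCritical x ξ]) ∧
    (∀ ξ ξ' : Fin m → ℂ, ChordalSLE.IsScreening x ξ → ChordalSLE.Stationary x ξ →
      ChordalSLE.IsScreening x ξ' → ChordalSLE.Stationary x ξ' →
      ∀ S S' : (Fin n → ℝ → ℝ) → ChordalSLE.Chain n,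
        ChordalSLE.IsSLEZeroSystem x ξ S → ChordalSLE.IsSLEZeroSystem x ξ' S' →
        (ChordalSLE.SameSystem S S' ↔ ∃ π : Equiv.Perm (Fin m), ξ' = ξ ∘ π)) ∧
    (∀ ξ ξ' : Fin m → ℂ, ∀ R R' : RatFunc ℂ,
        ChordalSLE.IsLinkRational x ξ R → ChordalSLE.IsLinkRational x ξ' R' →
        (ChordalSLE.RealAffineEquiv R R' ↔ ∃ π : Equiv.Perm (Fin m), ξ' = ξ ∘ π)) := by
  refine ⟨fun ξ => ?_, fun ξ ξ' hs _ hs' _ S S' hS hS' =>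
    ChordalSLE.sameSystem_iff hnm hx hs hs' hS hS',
    fun ξ ξ' R R' hR hR' => hR.realAffineEquiv_iff hnm hx hR'⟩
  tfae_have 1 → 2 := fun h => ChordalSLE.exists_isLinkRational hnm hx h.1 h.2.1
  tfae_have 2 → 3 := by
    rintro ⟨R, hR⟩
    obtain ⟨hs, hst⟩ := hR.isCR.isScreening_stationary hnm hx hR.poles_eq
    exact ⟨hs, (ChordalSLE.isMasterCritical_iff_stationary hx hs.injective hs.ne_growth).2 hst⟩
  tfae_have 3 → 1 := fun h =>
    ⟨h.1, (ChordalSLE.isMasterCritical_iff_stationary hx h.1.injective h.1.ne_growth).1 h.2,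
      ChordalSLE.exists_isSLEZeroSystem hx h.1⟩
  tfae_finish
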